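/- **Admissible pairs.** For functions $g,h:\mathbb R\to[0,\infty)$ and $n\in\mathbb N=\{1,2,\dots\}$ write $\rho^n(x)\propto g(x)\,e^{-nh(x)}$. The pair $(g,h)$ is *admissible* if there are $x_0\in\mathbb R$ and $\delta>0$ such that: (a) $x_0$ is a global minimum of $h$, and for every $n\ge 1$ the function $\rho^n$ is differentiable almost everywhere, has its unique maximum at $x_0$, is nondecreasing on $(-\infty,x_0]$ and nonincreasing on $[x_0,\infty)$; (b) on $[x_0-\delta,x_0+\delta]$ the function $h$ is twice differentiable, $h''(x_0)>0$, and on this interval $$h(x)=h(x_0)+h''(x_0)\Big(\tfrac12(x-x_0)^2+r(x)\Big),\qquad g(x)=g(x_0)\big(1+q(x-x_0)\big)$$ with $|r(x)|\le \frac1{4\delta}|x-x_0|^3$ and $|q(x-x_0)|\le\frac1{4\delta}|x-x_0|$; (c) there are constants $\alpha,c,C\in(0,\infty)$ such that $h(x)\ge c\log(1+|x-x_0|)$ and $g(x)\le C(1+|x-x_0|^\alpha)$ for all $x\in\mathbb R\setminus[x_0-\delta,x_0+\delta]$. A pair of functions $G,H:[0,\infty)\to\mathbb R$ is *radially admissible*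 if the pair $g(s):=G(e^s)$, $h(s):=H(e^s)-s$ is admissible. Let $\mu^n$ be the rotationally invariant probability measure on $\mathbb R^n$ with Lebesgue density $\frac1{Z^n}G(\|s\|_2)\exp(-nH(\|s\|_2))$, where $Z^n$ is the normalising constant (for those $n$ for which $0<Z^n<\infty$). For a real random variable $X$ let $$\mathrm d_{KS}(X,N)=\sup_{r\in\mathbb R}\Big|\mathbb P[X<r]-\int_{-\infty}^r\frac{e^{-u^2/2}}{\sqrt{2\pi}}\,du\Big|$$ be its Kolmogorov-Smirnov distance to a standard Gaussian $N$. **Theorem H.** Let $(G,H)$ be a radially admissible pair. There are a constant $C_{G,H}\in(0,\infty)$ and $n_0\in\mathbb N$, depending only on $(G,H)$, such that the following holds for all integers $2\le p\le n$. Let $A^{n,p}$ be a random $n\times p$ matrix whose $p$ columns are independent and identically distributed according to $\mu^n$, and let $W:=\log\det\big((A^{n,p})^\top A^{n,p}\big)$. If $n\ge n_0$, then $W$ has a finite second moment. Moreover, for every $n$ for which $W$ has a finite second moment, $\mathrm{Var}[W]>0$ and $$\mathrm d_{KS}\left(\frac{W-\mathbb E[W]}{\sqrt{\mathrm{Var}[W]}},\,N\right)\le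 C_{G,H}\,\frac{\theta^2}{n(1-\theta)\left[\log\frac1{1-\theta}-\theta\right]^{3/2}},\qquad \theta:=\frac{p-1}{n}.$$ -/

import Mathlib

open MeasureTheory ProbabilityTheory

noncomputable section

/-- The function `x ↦ g x * exp (- n * h x)` on the line. Up to its normalising constant this is the
density `ρ^n`; none of the conditions below depends on that constant. -/
def laplaceWeight (g h : ℝ → ℝ) (n : ℕ) (x : ℝ) : ℝ :=
  g x * Real.exp (-(n : ℝ) * h x)

/-- Admissible pairs `(g, h)` of functions `ℝ → [0, ∞)`. The point `x₀` and the half-width `δ` do not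
depend on `n`. -/
structure Admissible (g h : ℝ → ℝ) : Prop where
  g_nonneg : ∀ x, 0 ≤ g x
  h_nonneg : ∀ x, 0 ≤ h x
  exists_center : ∃ x₀ δ : ℝ, 0 < δ ∧
    -- (a) `x₀` is a minimum of `h` and, for every `n ≥ 1`, `ρ^n` is a.e. differentiable and
    -- unimodal, with its unique maximum at `x₀`
    (∀ x, h x₀ ≤ h x) ∧
    (∀ n : ℕ, 1 ≤ n →
      (∀ᵐ x : ℝ, DifferentiableAt ℝ (laplaceWeight g h n) x) ∧
      (∀ x, x ≠ x₀ → laplaceWeight g h n x < laplaceWeight g h n x₀) ∧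
      MonotoneOn (laplaceWeight g h n) (Set.Iic x₀) ∧
      AntitoneOn (laplaceWeight g h n) (Set.Ici x₀)) ∧
    -- (b) `h` is twice differentiable on `[x₀ - δ, x₀ + δ]`, the minimum is nondegenerate, and the
    -- local expansions of `h` and `g` at `x₀` hold
    DifferentiableOn ℝ h (Set.Icc (x₀ - δ) (x₀ + δ)) ∧
    DifferentiableOn ℝ (derivWithin h (Set.Icc (x₀ - δ) (x₀ + δ))) (Set.Icc (x₀ - δ) (x₀ + δ)) ∧
    0 < deriv (deriv h) x₀ ∧
    (∃ r q : ℝ → ℝ, ∀ x ∈ Set.Icc (x₀ - δ) (x₀ + δ),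
      h x = h x₀ + deriv (deriv h) x₀ * (1 / 2 * (x - x₀) ^ 2 + r x) ∧
      g x = g x₀ * (1 + q (x - x₀)) ∧
      |r x| ≤ 1 / (4 * δ) * |x - x₀| ^ 3 ∧
      |q (x - x₀)| ≤ 1 / (4 * δ) * |x - x₀|) ∧
    -- (c) tail bounds
    (∃ α c C : ℝ, 0 < α ∧ 0 < c ∧ 0 < C ∧ ∀ x, x ∉ Set.Icc (x₀ - δ) (x₀ + δ) →
      c * Real.log (1 + |x - x₀|) ≤ h x ∧ g x ≤ C * (1 + |x - x₀| ^ α))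

/-- Radially admissible pairs. A function on `[0, ∞)` is represented by a function on `ℝ` of which
only the values at nonnegative arguments are ever used. -/
def RadiallyAdmissible (G H : ℝ → ℝ) : Prop :=
  Admissible (fun s => G (Real.exp s)) (fun s => H (Real.exp s) - s)

/-- The unnormalised density `s ↦ G ‖s‖ * exp (- n * H ‖s‖)` on Euclidean space `ℝ^n`. -/
def radialWeight (G H : ℝ → ℝ) (n : ℕ) (s : EuclideanSpace ℝ (Fin n)) : ENNReal :=
  ENNReal.ofReal (G ‖s‖ * Real.exp (-(n : ℝ) * H ‖s‖))

/-- The measure `μ^n` on `ℝ^n` with Lebesgue density `(1 / Z^n) * G ‖s‖ * exp (- n * H ‖s‖)`, where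
`Z^n` is the total mass of the unnormalised density. It is a probability measure exactly when
`0 < Z^n < ∞`, and it is the zero measure otherwise. -/
def radialMeasure (G H : ℝ → ℝ) (n : ℕ) : Measure (EuclideanSpace ℝ (Fin n)) :=
  (∫⁻ s, radialWeight G H n s)⁻¹ • volume.withDensity (radialWeight G H n)

/-- The `j`-th column of a matrix, as a vector of Euclidean space. -/
def euclideanCol {n p : ℕ} (M : Matrix (Fin n) (Fin p) ℝ) (j : Fin p) :
    EuclideanSpace ℝ (Fin n) :=
  WithLp.toLp 2 (fun i => M i j)

/-- `log det (Mᵀ M)`. -/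
def logDetGram {n p : ℕ} (M : Matrix (Fin n) (Fin p) ℝ) : ℝ :=
  Real.log (M.transpose * M).det

/-- The standardisation `(X - 𝔼 X) / √(Var X)` of a real random variable. -/
def standardized {Ω : Type*} [MeasurableSpace Ω] (P : Measure Ω) (X : Ω → ℝ) (ω : Ω) : ℝ :=
  (X ω - ∫ ω', X ω' ∂P) / Real.sqrt (variance X P)

/-- The Kolmogorov-Smirnov distance `sup_r |ℙ(X < r) - ℙ(N < r)|` between a real random variable `X`
and a standard Gaussian random variable `N`. -/
def ksDistGaussian {Ω : Type*} [MeasurableSpace Ω] (P : Measure Ω) (X : Ω → ℝ) : ℝ :=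
  ⨆ r : ℝ, |P.real {ω | X ω < r} - (gaussianReal 0 1).real (Set.Iio r)|

end

/-! Only the law of `W` matters, and that law is a convolution. Reflect the space so that the first
column `u` lands on the first axis. Gram entries do not change, and eliminating with the first row
leaves `‖u‖ ^ 2` times the Gram determinant of the other columns with their first coordinate
deleted. By rotation invariance these shortened columns are again i.i.d. and radial, independent of
`u`, in one dimension less. In polar coordinates the log squared norm of a shortened column is that
of a full column in dimension `d` plus an independent `2 log sin φ`, where `φ` has density
proportional to `sin ^ (d - 2)`. Iterating (`gramDet_eq_mul_gramDet_tail`, `logNormLaw_tailProfile`,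
`charFun_log_gramDet`), `W` is distributed as a sum of independent pieces: `p` radial ones, twice a
variable with density proportional to `g exp (-n h)`, and for each `i < p - 1` there are `p - 1 - i`
angular ones `2 log sin φ` with weight `sin ^ (n - 2 - i)`.

The normal approximation is Stein's method. Stein's equation for a half-line, expanded summand by
summand, turns the error into defects in the identity `E[X G(X)] = Var X * E[G'(X)]`, where `G'` is
the derivative of the Stein solution averaged over the other summands. That derivative jumps at `r`.
Averaging replaces the jump by the probability that the other summands lie in a short interval,
which `concentration_of_sum` bounds through an integration by parts formula for each summand.
`SteinRegular` collects what a summand must satisfy: a variance scale `a`, a defect bound `M`, and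
such a formula. The outcome (`ks_le_of_law_eq_sum`) is a bound by a multiple of `∑ M / (∑ a) ^ (3/2)
+ ∑ a ^ 2 / (∑ a) ^ 2`, provided no piece dominates.

An angular piece with `m = n - 1 - i` has `a = 1 / m ^ 2`, and its third absolute moment already
gives `M` of order `1 / m ^ 3`. A radial piece has `a` of order `1 / n`, where third moments would
only give `n ^ (-3/2)`. By Laplace's method, however, its rescaled density differs from the Gaussian
one by `O(n ^ (-1/2))` in a weighted `L¹` norm, and the Gaussian has no defect at all, so `M` is of
order `n ^ (-2)` (`steinRegular_of_nearGaussian`, `Admissible.exists_gaussian_approx`).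

With `L = log (1 / (1 - θ)) - θ`, the radial pieces contribute at least a multiple of `θ` to `∑ a`
and the angular ones at least `L`, while `∑ M` and `∑ a ^ 2` are `O(θ / n + θ ^ 2 / (n (1 - θ)))`.
The inequality `(1 - θ) L ≤ θ ^ 2` turns this into the stated rate (`rate_le`). The finitely many
pairs with small `n` are absorbed into the constant, and the variance is positive because radial
pieces have no atoms. -/

/-! ### Gaussian tails and Stein's equation for a half-line -/

/-- The upper tail of the unnormalised Gaussian weight. -/
noncomputable def gaussTail (w : ℝ) : ℝ := ∫ t in Set.Ioi w, Real.exp (-t ^ 2 / 2)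

theorem integrable_exp_neg_sq_half : Integrable fun t : ℝ => Real.exp (-t ^ 2 / 2) := by
  have := integrable_exp_neg_mul_sq (b := 1 / 2) (by norm_num)
  refine this.congr (Filter.Eventually.of_forall fun t => ?_)
  simp only; congr 1; ring

theorem gaussTail_nonneg (w : ℝ) : 0 ≤ gaussTail w :=
  setIntegral_nonneg measurableSet_Ioi fun _ _ => (Real.exp_pos _).le

theorem gaussTail_antitone : Antitone gaussTail := fun _ _ h =>
  setIntegral_mono_set integrable_exp_neg_sq_half.integrableOn
    (Filter.Eventually.of_forall fun _ => (Real.exp_pos _).le)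
    (Set.Ioi_subset_Ioi h).eventuallyLE

theorem integral_exp_neg_sq_half : ∫ t : ℝ, Real.exp (-t ^ 2 / 2) = √(2 * Real.pi) := by
  have := integral_gaussian (1 / 2)
  rw [show Real.pi / (1 / 2) = 2 * Real.pi by ring] at this
  rw [← this]
  congr 1; ext t; congr 1; ring

theorem gaussTail_neg (w : ℝ) : gaussTail (-w) = ∫ t in Set.Iic w, Real.exp (-t ^ 2 / 2) := by
  have := integral_comp_neg_Iic w fun t : ℝ => Real.exp (-t ^ 2 / 2)
  simp only [neg_sq] at this
  rw [gaussTail, ← this]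

theorem gaussTail_add_neg (w : ℝ) : gaussTail w + gaussTail (-w) = √(2 * Real.pi) := by
  rw [gaussTail_neg, add_comm, gaussTail, ← integral_exp_neg_sq_half,
    ← Set.compl_Iic, integral_add_compl measurableSet_Iic integrable_exp_neg_sq_half]

theorem hasDerivAt_gaussTail (w : ℝ) : HasDerivAt gaussTail (-Real.exp (-w ^ 2 / 2)) w := by
  have h1 : ∀ x, gaussTail x = gaussTail 0 - ∫ t in (0 : ℝ)..x, Real.exp (-t ^ 2 / 2) := by
    intro x
    have h0 := gaussTail_add_neg 0
    have hx := gaussTail_add_neg x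
    rw [neg_zero] at h0
    have := intervalIntegral.integral_Iic_sub_Iic
      (integrable_exp_neg_sq_half.integrableOn (s := Set.Iic 0))
      (integrable_exp_neg_sq_half.integrableOn (s := Set.Iic x))
    rw [← gaussTail_neg, ← gaussTail_neg, neg_zero] at this
    linarith
  have h2 : HasDerivAt (fun x => ∫ t in (0 : ℝ)..x, Real.exp (-t ^ 2 / 2))
      (Real.exp (-w ^ 2 / 2)) w := by
    have hc : Continuous fun t : ℝ => Real.exp (-t ^ 2 / 2) := by fun_prop
    exact hc.integral_hasStrictDerivAt 0 w |>.hasDerivAt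
  rw [funext h1]
  exact h2.const_sub _

theorem hasDerivAt_sq_half (w : ℝ) : HasDerivAt (fun t : ℝ => t ^ 2 / 2) w w :=
  ((hasDerivAt_pow 2 w).div_const 2).congr_deriv (by norm_num)

theorem integral_Ioi_mul_exp_neg_sq_half (w : ℝ) :
    IntegrableOn (fun t : ℝ => t * Real.exp (-t ^ 2 / 2)) (Set.Ioi w) ∧
    ∫ t in Set.Ioi w, t * Real.exp (-t ^ 2 / 2) = Real.exp (-w ^ 2 / 2) := by
  have hint : Integrable fun t : ℝ => t * Real.exp (-t ^ 2 / 2) := by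
    have := integrable_mul_exp_neg_mul_sq (b := 1 / 2) (by norm_num)
    refine this.congr (Filter.Eventually.of_forall fun t => ?_)
    simp only; congr 2; ring
  refine ⟨hint.integrableOn, ?_⟩
  have hd : ∀ x ∈ Set.Ici w, HasDerivAt (fun t : ℝ => -Real.exp (-t ^ 2 / 2))
      (x * Real.exp (-x ^ 2 / 2)) x := by
    intro x _
    have h : HasDerivAt (fun t : ℝ => -t ^ 2 / 2) (-x) x := by
      have h0 : (fun t : ℝ => -t ^ 2 / 2) = fun t => -(t ^ 2 / 2) := by ext; ring
      rw [h0]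
      exact (hasDerivAt_sq_half x).neg
    exact h.exp.neg.congr_deriv (by ring)
  have hlim : Filter.Tendsto (fun t : ℝ => -Real.exp (-t ^ 2 / 2)) Filter.atTop (nhds 0) := by
    rw [← neg_zero]
    refine (Real.tendsto_exp_atBot.comp ?_).neg
    have : Filter.Tendsto (fun t : ℝ => t ^ 2 / 2) Filter.atTop Filter.atTop :=
      (Filter.tendsto_pow_atTop two_ne_zero).atTop_div_const two_pos
    refine (Filter.tendsto_neg_atTop_atBot.comp this).congr fun t => ?_
    simp only [Function.comp]; ring
  rw [integral_Ioi_of_hasDerivAt_of_tendsto' hd hint.integrableOn hlim]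
  ring

/-- Mills' ratio: `w ≤ t` on the range of integration, and `t * exp (-t ^ 2 / 2)` has an explicit
primitive. -/
theorem mul_gaussTail_le {w : ℝ} (_hw : 0 ≤ w) : w * gaussTail w ≤ Real.exp (-w ^ 2 / 2) := by
  obtain ⟨hi, he⟩ := integral_Ioi_mul_exp_neg_sq_half w
  rw [← he, gaussTail, ← integral_const_mul]
  refine setIntegral_mono_on (integrable_exp_neg_sq_half.integrableOn.const_mul w) hi
    measurableSet_Ioi fun t ht => ?_
  exact mul_le_mul_of_nonneg_right (le_of_lt ht) (Real.exp_pos _).le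

theorem sqrt_two_pi_le : √(2 * Real.pi) ≤ 2.6 := by
  rw [Real.sqrt_le_left (by norm_num)]
  nlinarith [Real.pi_lt_d2]

theorem exp_mul_gaussTail_le {w : ℝ} (hw : 0 ≤ w) :
    Real.exp (w ^ 2 / 2) * gaussTail w ≤ 5 ∧ w * (Real.exp (w ^ 2 / 2) * gaussTail w) ≤ 1 := by
  have h2 : w * (Real.exp (w ^ 2 / 2) * gaussTail w) ≤ 1 := by
    have := mul_le_mul_of_nonneg_left (mul_gaussTail_le hw) (Real.exp_pos (w ^ 2 / 2)).le
    rw [← Real.exp_add, show w ^ 2 / 2 + -w ^ 2 / 2 = 0 by ring, Real.exp_zero] at this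
    linarith
  refine ⟨?_, h2⟩
  have hnn : 0 ≤ Real.exp (w ^ 2 / 2) * gaussTail w :=
    mul_nonneg (Real.exp_pos _).le (gaussTail_nonneg w)
  rcases le_total 1 w with h | h
  · nlinarith
  -- For `w ≤ 1` crude values are enough, since `1.65 * 2.6 < 5`.
  · have h3 : Real.exp (w ^ 2 / 2) ≤ 1.65 := by
      have h4 : Real.exp (w ^ 2 / 2) ≤ Real.exp (1 / 2) := Real.exp_le_exp.2 (by nlinarith)
      have h5 : Real.exp (1 / 2) ^ 2 = Real.exp 1 := by
        rw [← Real.exp_nat_mul]; norm_num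
      have h6 := Real.exp_one_lt_d9
      nlinarith [Real.exp_pos (1 / 2)]
    have h4 : gaussTail w ≤ 2.6 := by
      have := gaussTail_add_neg w
      have := gaussTail_nonneg (-w)
      have := sqrt_two_pi_le
      linarith
    have := mul_le_mul h3 h4 (gaussTail_nonneg w) (by norm_num)
    linarith

/-- The bounded solution of Stein's equation for the indicator of `(-∞, r)`. -/
noncomputable def steinSol (r w : ℝ) : ℝ :=
  Real.exp (w ^ 2 / 2) * gaussTail (-min w r) * gaussTail (max w r) / √(2 * Real.pi)

/-- The almost everywhere derivative of `steinSol r`, as prescribed by Stein's equation. -/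
noncomputable def steinSolDeriv (r w : ℝ) : ℝ :=
  w * steinSol r w + ((Set.Iio r).indicator 1 w - gaussTail (-r) / √(2 * Real.pi))

theorem sqrt_two_pi_pos : 0 < √(2 * Real.pi) := Real.sqrt_pos.2 (by positivity)

theorem gaussTail_le (w : ℝ) : gaussTail w ≤ √(2 * Real.pi) := by
  rw [← gaussTail_add_neg w]; linarith [gaussTail_nonneg (-w)]

theorem steinSol_nonneg (r w : ℝ) : 0 ≤ steinSol r w := by
  have := gaussTail_nonneg (-min w r)
  have := gaussTail_nonneg (max w r)
  have := sqrt_two_pi_pos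
  unfold steinSol
  positivity

/-- Of the two tail factors, the one on the side of the sign of `w` is at most `gaussTail |w|`; the
other is at most the full mass and cancels the normalisation. The bound no longer depends on `r`. -/
theorem steinSol_le (r w : ℝ) :
    steinSol r w ≤ Real.exp (|w| ^ 2 / 2) * gaussTail |w| := by
  have hZ := sqrt_two_pi_pos
  unfold steinSol
  rw [div_le_iff₀ hZ, sq_abs, mul_assoc, mul_assoc]
  refine mul_le_mul_of_nonneg_left ?_ (Real.exp_pos _).le
  rcases le_total 0 w with h | h
  · rw [abs_of_nonneg h, mul_comm]
    exact mul_le_mul (gaussTail_antitone (le_max_left _ _)) (gaussTail_le _) (gaussTail_nonneg _)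
      (gaussTail_nonneg _)
  · rw [abs_of_nonpos h]
    exact mul_le_mul (gaussTail_antitone (neg_le_neg (min_le_left _ _))) (gaussTail_le _)
      (gaussTail_nonneg _) (gaussTail_nonneg _)

theorem abs_steinSol_le (r w : ℝ) : |steinSol r w| ≤ 5 := by
  rw [abs_of_nonneg (steinSol_nonneg r w)]
  exact (steinSol_le r w).trans (exp_mul_gaussTail_le (abs_nonneg w)).1

theorem abs_mul_steinSol_le (r w : ℝ) : |w * steinSol r w| ≤ 1 := by
  rw [abs_mul, abs_of_nonneg (steinSol_nonneg r w)]
  exact (mul_le_mul_of_nonneg_left (steinSol_le r w) (abs_nonneg w)).trans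
    (exp_mul_gaussTail_le (abs_nonneg w)).2

theorem abs_steinSolDeriv_le (r w : ℝ) : |steinSolDeriv r w| ≤ 2 := by
  have h1 := abs_mul_steinSol_le r w
  have h2 : 0 ≤ gaussTail (-r) / √(2 * Real.pi) :=
    div_nonneg (gaussTail_nonneg _) sqrt_two_pi_pos.le
  have h3 : gaussTail (-r) / √(2 * Real.pi) ≤ 1 :=
    (div_le_one sqrt_two_pi_pos).2 (gaussTail_le _)
  have h4 : |(Set.Iio r).indicator (1 : ℝ → ℝ) w - gaussTail (-r) / √(2 * Real.pi)| ≤ 1 := by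
    rw [abs_le]
    by_cases h : w ∈ Set.Iio r <;> simp only [h, Set.indicator_of_mem, Set.indicator_of_notMem,
      not_false_eq_true, Pi.one_apply] <;> constructor <;> linarith
  unfold steinSolDeriv
  exact (abs_add_le _ _).trans (by linarith)

/-- Away from `r` the minimum and maximum are locally resolved. Differentiating the exponential
gives the term `w * steinSol r w`; differentiating a tail gives a constant, which for `w < r` is
matched by `gaussTail r + gaussTail (-r) = √(2π)`. -/
theorem hasDerivAt_steinSol {r w : ℝ} (h : w ≠ r) :
    HasDerivAt (steinSol r) (steinSolDeriv r w) w := by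
  have hZ := sqrt_two_pi_pos
  have he : HasDerivAt (fun t : ℝ => Real.exp (t ^ 2 / 2)) (w * Real.exp (w ^ 2 / 2)) w :=
    (hasDerivAt_sq_half w).exp.congr_deriv (by ring)
  have hee : Real.exp (w ^ 2 / 2) * Real.exp (-w ^ 2 / 2) = 1 := by
    rw [← Real.exp_add, show w ^ 2 / 2 + -w ^ 2 / 2 = 0 by ring, Real.exp_zero]
  rcases lt_or_gt_of_ne h with h | h
  · have hn : HasDerivAt (fun t => gaussTail (-t)) (Real.exp (-w ^ 2 / 2)) w := by
      exact ((hasDerivAt_gaussTail (-w)).comp w (hasDerivAt_neg w)).congr_deriv (by simp)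
    have hd := ((he.mul hn).mul_const (gaussTail r)).div_const (√(2 * Real.pi))
    have hev : steinSol r =ᶠ[nhds w] fun t =>
        Real.exp (t ^ 2 / 2) * gaussTail (-t) * gaussTail r / √(2 * Real.pi) := by
      filter_upwards [Iio_mem_nhds h] with t ht
      rw [Set.mem_Iio] at ht
      simp only [steinSol, min_eq_left (le_of_lt ht), max_eq_right (le_of_lt ht)]
    refine (hd.congr_of_eventuallyEq hev).congr_deriv ?_
    have hr := gaussTail_add_neg r
    rw [steinSolDeriv, steinSol, min_eq_left h.le, max_eq_right h.le,
      Set.indicator_of_mem (Set.mem_Iio.2 h), hee]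
    field_simp
    simp only [Pi.one_apply]
    linear_combination hr
  · have hd := (((he.mul_const (gaussTail (-r))).mul
      (hasDerivAt_gaussTail w))).div_const (√(2 * Real.pi))
    have hev : steinSol r =ᶠ[nhds w] fun t =>
        Real.exp (t ^ 2 / 2) * gaussTail (-r) * gaussTail t / √(2 * Real.pi) := by
      filter_upwards [Ioi_mem_nhds h] with t ht
      simp only [steinSol, min_eq_right (le_of_lt (Set.mem_Ioi.1 ht)),
        max_eq_left (le_of_lt (Set.mem_Ioi.1 ht))]
    refine (hd.congr_of_eventuallyEq hev).congr_deriv ?_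
    rw [steinSolDeriv, steinSol, min_eq_right h.le, max_eq_left h.le,
      Set.indicator_of_notMem (by simpa using h.le)]
    have h0 : ∀ a b c d e Z : ℝ, a * b = 1 → 0 < Z →
        (w * a * c * d + a * c * -b) / Z = w * (a * c * d / Z) + (0 - c / Z) := by
      intro a b c d e Z hab hZ
      field_simp
      linear_combination (-c) * hab
    exact h0 _ _ _ _ 0 _ hee hZ

theorem continuous_gaussTail : Continuous gaussTail :=
  continuous_iff_continuousAt.2 fun w => (hasDerivAt_gaussTail w).continuousAt

theorem continuous_steinSol (r : ℝ) : Continuous (steinSol r) := by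
  have := continuous_gaussTail
  unfold steinSol
  fun_prop

theorem measurable_steinSolDeriv (r : ℝ) : Measurable (steinSolDeriv r) := by
  unfold steinSolDeriv
  refine (measurable_id.mul (continuous_steinSol r).measurable).add (Measurable.sub_const ?_ _)
  exact measurable_one.indicator measurableSet_Iio

theorem intervalIntegrable_of_bounded {f : ℝ → ℝ} (hf : Measurable f) {C : ℝ}
    (hC : ∀ x, |f x| ≤ C) (a b : ℝ) : IntervalIntegrable f volume a b :=
  (intervalIntegrable_const (c := C)).mono_fun' hf.aestronglyMeasurable
    (Filter.Eventually.of_forall hC)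

/-- The solution has a corner at `r`, so the fundamental theorem is used with one exceptional point.
-/
theorem steinSol_sub (r a b : ℝ) :
    steinSol r b - steinSol r a = ∫ t in a..b, steinSolDeriv r t := by
  refine (integral_eq_of_hasDerivAt_off_countable _ _
    (Set.countable_singleton r) (continuous_steinSol r).continuousOn
    (fun x hx => hasDerivAt_steinSol ?_)
    (intervalIntegrable_of_bounded (measurable_steinSolDeriv r) (abs_steinSolDeriv_le r) _ _)).symm
  simpa using hx.2

theorem abs_steinSol_sub_le (r a b : ℝ) : |steinSol r b - steinSol r a| ≤ 2 * |b - a| := by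
  rw [steinSol_sub]
  rw [← Real.norm_eq_abs]
  exact intervalIntegral.norm_integral_le_of_norm_le_const fun x _ =>
    (Real.norm_eq_abs _).trans_le (abs_steinSolDeriv_le r x)

theorem gaussianReal_real_Iio (r : ℝ) :
    (gaussianReal 0 1).real (Set.Iio r) = gaussTail (-r) / √(2 * Real.pi) := by
  rw [gaussTail_neg, integral_Iic_eq_integral_Iio, Measure.real,
    gaussianReal_apply_eq_integral 0 one_ne_zero, ENNReal.toReal_ofReal
      (setIntegral_nonneg measurableSet_Iio fun _ _ => gaussianPDFReal_nonneg _ _ _), div_eq_inv_mul,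
    ← integral_const_mul]
  refine setIntegral_congr_fun measurableSet_Iio fun t _ => ?_
  simp [gaussianPDFReal]

/-! ### The condition on one summand, and concentration of sums -/

/-- Quantitative conditions on a centred law of variance comparable to `a`: a bound `M` for the
defect in Stein's identity, and an integration by parts formula with a nonnegative weight. -/
structure SteinRegular (κ a M : ℝ) (μ : Measure ℝ) : Prop where
  scale_nonneg : 0 ≤ a
  mean_eq_zero : ∫ x, x ∂μ = 0
  memLp_two : MemLp (fun x : ℝ => x) 2 μ
  variance_le : ∫ x, x ^ 2 ∂μ ≤ κ * a
  le_variance : a ≤ κ * ∫ x, x ^ 2 ∂μ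
  stein_defect : ∀ (A : ℝ → ℝ) (α β : ℝ), Measurable A → 0 ≤ α → 0 ≤ β →
    (∀ t, |A t| ≤ α * |t| + β) →
    |(∫ x, x * (∫ t in (0 : ℝ)..x, A t) ∂μ) - (∫ x, x ^ 2 ∂μ) * ∫ x, A x ∂μ|
      ≤ α * M + β * (κ * a)
  integration_by_parts : ∃ η ψ : ℝ → ℝ, Measurable η ∧ Measurable ψ ∧ (∀ x, 0 ≤ η x) ∧
    MemLp η 2 μ ∧ MemLp ψ 2 μ ∧ a ≤ κ * ∫ x, η x ∂μ ∧ ∫ x, η x ^ 2 ∂μ ≤ κ * a ^ 2 ∧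
    ∫ x, ψ x ^ 2 ∂μ ≤ κ * a ∧
    ∀ F F' : ℝ → ℝ, (∀ x, HasDerivAt F (F' x) x) → Continuous F' →
      (∃ B, ∀ x, |F x| ≤ B) → (∃ B, ∀ x, |F' x| ≤ B) →
      ∫ x, ψ x * F x ∂μ = ∫ x, η x * F' x ∂μ

section Concentration

variable {Ω ι : Type*} [MeasurableSpace Ω] {P : Measure Ω} [IsProbabilityMeasure P]

theorem integral_comp_pair_of_indepFun {X V : Ω → ℝ} (hX : Measurable X) (hV : Measurable V)
    (hXV : IndepFun X V P) {g : ℝ × ℝ → ℝ} (hg : Measurable g)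
    (hi : Integrable (fun ω => g (X ω, V ω)) P) :
    ∫ ω, g (X ω, V ω) ∂P = ∫ ω, (∫ x, g (x, V ω) ∂(P.map X)) ∂P ∧
      Integrable g ((P.map X).prod (P.map V)) := by
  have hm := (indepFun_iff_map_prod_eq_prod_map_map hX.aemeasurable hV.aemeasurable).1 hXV
  have : IsProbabilityMeasure (P.map X) := Measure.isProbabilityMeasure_map hX.aemeasurable
  have : IsProbabilityMeasure (P.map V) := Measure.isProbabilityMeasure_map hV.aemeasurable
  have hi' : Integrable g ((P.map X).prod (P.map V)) := by
    rw [← hm]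
    exact (integrable_map_measure hg.aestronglyMeasurable (hX.prodMk hV).aemeasurable).2 hi
  refine ⟨?_, hi'⟩
  have h1 : ∫ ω, g (X ω, V ω) ∂P = ∫ z, g z ∂(P.map fun ω => (X ω, V ω)) :=
    (integral_map (hX.prodMk hV).aemeasurable hg.aestronglyMeasurable).symm
  rw [h1, hm, integral_prod_symm _ hi', integral_map hV.aemeasurable]
  exact hi'.swap.integral_prod_left.aestronglyMeasurable

/-- By independence `V` may be frozen at a value `v`, and the translate `F (· + v)` is again a
legitimate test function. -/
theorem integral_mul_comp_add_eq {X V : Ω → ℝ} (hX : Measurable X) (hV : Measurable V)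
    (hXV : IndepFun X V P) {η ψ F F' : ℝ → ℝ} (hη : Measurable η) (hψ : Measurable ψ)
    (hη2 : MemLp η 2 (P.map X)) (hψ2 : MemLp ψ 2 (P.map X))
    (hibp : ∀ F F' : ℝ → ℝ, (∀ x, HasDerivAt F (F' x) x) → Continuous F' →
      (∃ B, ∀ x, |F x| ≤ B) → (∃ B, ∀ x, |F' x| ≤ B) →
      ∫ x, ψ x * F x ∂(P.map X) = ∫ x, η x * F' x ∂(P.map X))
    (hF : ∀ x, HasDerivAt F (F' x) x) (hF' : Continuous F')
    {B : ℝ} (hB : ∀ x, |F x| ≤ B) (hB' : ∀ x, |F' x| ≤ B) :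
    ∫ ω, ψ (X ω) * F (X ω + V ω) ∂P = ∫ ω, η (X ω) * F' (X ω + V ω) ∂P := by
  have : IsProbabilityMeasure (P.map X) := Measure.isProbabilityMeasure_map hX.aemeasurable
  have hFc : Continuous F := continuous_iff_continuousAt.2 fun x => (hF x).continuousAt
  have hint : ∀ φ G : ℝ → ℝ, Measurable φ → MemLp φ 2 (P.map X) → Continuous G →
      (∀ x, |G x| ≤ B) → Integrable (fun ω => φ (X ω) * G (X ω + V ω)) P := by
    intro φ G hφ hφ2 hG hGB
    have h1 : Integrable (fun ω => φ (X ω)) P :=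
      (hφ2.comp_measurePreserving ⟨hX, rfl⟩).integrable (by norm_num)
    refine h1.mul_bdd (c := B) (by fun_prop) (Filter.Eventually.of_forall fun ω => ?_)
    exact hGB _
  have hi1 := hint ψ F hψ hψ2 hFc hB
  have hi2 := hint η F' hη hη2 hF' hB'
  have e1 := (integral_comp_pair_of_indepFun hX hV hXV (g := fun z => ψ z.1 * F (z.1 + z.2))
    (by fun_prop) hi1).1
  have e2 := (integral_comp_pair_of_indepFun hX hV hXV (g := fun z => η z.1 * F' (z.1 + z.2))
    (by fun_prop) hi2).1
  simp only at e1 e2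
  rw [e1, e2]
  refine integral_congr_ae (Filter.Eventually.of_forall fun ω => ?_)
  refine hibp (fun x => F (x + V ω)) (fun x => F' (x + V ω)) (fun x => ?_) (by fun_prop)
    ⟨B, fun x => hB _⟩ ⟨B, fun x => hB' _⟩
  exact (hF (x + V ω)).comp_add_const x (V ω)

/-- Put `T = ∑ η i (X i)` and `Ψ = ∑ ψ i (X i)`, so that `E[T F'(V)] = E[Ψ F(V)]`. A bounded `F`
whose slope is at least `1 / (2l)` on the interval shows that `T`, integrated over the event, is at
most of order `l` times the `L²` norm of `Ψ`, that is, `l √A`. Since `T` is nonnegative and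
concentrates around a mean of order `A`, dividing by `A` bounds the probability. The term `∑ a ^ 2 /
A ^ 2` is Chebyshev's price for `T` being small. No density of the sum is needed. -/
theorem concentration_of_sum [DecidableEq ι] {X : ι → Ω → ℝ} (hX : ∀ i, Measurable (X i))
    (hind : iIndepFun X P) {κ : ℝ} (hκ : 1 ≤ κ) {a M : ι → ℝ}
    (hreg : ∀ i, SteinRegular κ (a i) (M i) (P.map (X i))) (s : Finset ι)
    (hA : 0 < ∑ i ∈ s, a i) (c : ℝ) {l : ℝ} (hl : 0 < l) :
    P.real {ω | |∑ i ∈ s, X i ω - c| ≤ l} ≤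
      7 * κ ^ 3 * (l / √(∑ i ∈ s, a i) + (∑ i ∈ s, a i ^ 2) / (∑ i ∈ s, a i) ^ 2) := by
  choose η ψ hη hψ hη0 hη2 hψ2 hηa hηb hψb hibp using fun i => (hreg i).integration_by_parts
  have hprob : ∀ i, IsProbabilityMeasure (P.map (X i)) := fun i =>
    Measure.isProbabilityMeasure_map (hX i).aemeasurable
  set A := ∑ i ∈ s, a i with hAdef
  set V : Ω → ℝ := fun ω => ∑ i ∈ s, X i ω with hV
  have hVm : Measurable V := Finset.measurable_sum _ fun i _ => hX i
  have hηL : ∀ i, MemLp (fun ω => η i (X i ω)) 2 P := fun i =>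
    (hη2 i).comp_measurePreserving ⟨hX i, rfl⟩
  have hψL : ∀ i, MemLp (fun ω => ψ i (X i ω)) 2 P := fun i =>
    (hψ2 i).comp_measurePreserving ⟨hX i, rfl⟩
  have hmapη : ∀ i, ∫ x, η i x ∂(P.map (X i)) = ∫ ω, η i (X i ω) ∂P := fun i =>
    integral_map (hX i).aemeasurable (hη i).aestronglyMeasurable
  have hmapη2 : ∀ i, ∫ x, η i x ^ 2 ∂(P.map (X i)) = ∫ ω, η i (X i ω) ^ 2 ∂P := fun i =>
    integral_map (hX i).aemeasurable ((hη i).pow_const 2).aestronglyMeasurable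
  have hmapψ2 : ∀ i, ∫ x, ψ i x ^ 2 ∂(P.map (X i)) = ∫ ω, ψ i (X i ω) ^ 2 ∂P := fun i =>
    integral_map (hX i).aemeasurable ((hψ i).pow_const 2).aestronglyMeasurable
  -- The test function `1` shows that each `ψ i` is centred, so the second moment of `Ψ` is
  -- additive.
  have hψ0 : ∀ i, ∫ ω, ψ i (X i ω) ∂P = 0 := by
    intro i
    have h := hibp i (fun _ => 1) (fun _ => 0) (fun x => hasDerivAt_const x 1) continuous_const
      ⟨1, by simp⟩ ⟨0, by simp⟩
    simp only [mul_one, mul_zero, integral_zero] at h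
    rw [← h]
    exact (integral_map (hX i).aemeasurable (hψ i).aestronglyMeasurable).symm
  set T : Ω → ℝ := ∑ i ∈ s, fun ω => η i (X i ω) with hT
  set Ψ : Ω → ℝ := ∑ i ∈ s, fun ω => ψ i (X i ω) with hΨ
  have hTL : MemLp T 2 P := memLp_finsetSum' s fun i _ => hηL i
  have hΨL : MemLp Ψ 2 P := memLp_finsetSum' s fun i _ => hψL i
  have hTi := hTL.integrable (by norm_num)
  have hΨi := hΨL.integrable (by norm_num)
  have hT0 : ∀ ω, 0 ≤ T ω := fun ω => by
    rw [hT, Finset.sum_apply]; exact Finset.sum_nonneg fun i _ => hη0 i _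
  set τ := ∫ ω, T ω ∂P with hτ
  have hτA : A ≤ κ * τ := by
    have : τ = ∑ i ∈ s, ∫ ω, η i (X i ω) ∂P := by
      rw [hτ, hT]
      simp only [Finset.sum_apply]
      exact integral_finsetSum s fun i _ => (hηL i).integrable (by norm_num)
    rw [this, Finset.mul_sum]
    exact Finset.sum_le_sum fun i _ => (hηa i).trans_eq (by rw [hmapη])
  have hτpos : 0 < τ := by
    by_contra h
    push Not at h
    nlinarith
  have hvarT : ∫ ω, (T ω - τ) ^ 2 ∂P ≤ κ * ∑ i ∈ s, a i ^ 2 := by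
    rw [hτ, ← variance_eq_integral hTL.aestronglyMeasurable.aemeasurable, hT,
      IndepFun.variance_sum (fun i _ => hηL i)
        (fun i _ j _ hij => (hind.indepFun hij).comp (hη i) (hη j)), Finset.mul_sum]
    refine Finset.sum_le_sum fun i _ => ?_
    refine (variance_le_expectation_sq (hηL i).aestronglyMeasurable).trans ?_
    exact (hmapη2 i).symm.trans_le (hηb i)
  have hvarΨ : ∫ ω, Ψ ω ^ 2 ∂P ≤ κ * A := by
    have h0 : ∫ ω, Ψ ω ∂P = 0 := by
      rw [hΨ]
      simp only [Finset.sum_apply]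
      rw [integral_finsetSum s fun i _ => (hψL i).integrable (by norm_num)]
      exact Finset.sum_eq_zero fun i _ => hψ0 i
    have h1 : ∫ ω, Ψ ω ^ 2 ∂P = variance Ψ P := by
      rw [variance_eq_integral hΨL.aestronglyMeasurable.aemeasurable, h0]
      simp
    rw [h1, hΨ, IndepFun.variance_sum (fun i _ => hψL i)
        (fun i _ j _ hij => (hind.indepFun hij).comp (hψ i) (hψ j)), hAdef, Finset.mul_sum]
    refine Finset.sum_le_sum fun i _ => ?_
    refine (variance_le_expectation_sq (hψL i).aestronglyMeasurable).trans ?_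
    exact (hmapψ2 i).symm.trans_le (hψb i)
  -- the test function
  set F : ℝ → ℝ := fun x => Real.arctan ((x - c) / l) with hF
  set F' : ℝ → ℝ := fun x => (1 / (1 + ((x - c) / l) ^ 2)) * (1 / l) with hF'
  have hFd : ∀ x, HasDerivAt F (F' x) x := fun x =>
    (((hasDerivAt_id x).sub_const c).div_const l).arctan
  have hF'c : Continuous F' := by
    have : ∀ x : ℝ, 1 + ((x - c) / l) ^ 2 ≠ 0 := fun x => by positivity
    fun_prop (disch := exact this _)
  have hF'0 : ∀ x, 0 ≤ F' x := fun x => by positivity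
  have hF'le : ∀ x, F' x ≤ 1 / l := fun x => by
    have : 1 / (1 + ((x - c) / l) ^ 2) ≤ 1 := by
      rw [div_le_one (by positivity)]; nlinarith [sq_nonneg ((x - c) / l)]
    exact mul_le_of_le_one_left (by positivity) this
  have hFle : ∀ x, |F x| ≤ Real.pi / 2 := fun x =>
    abs_le.2 ⟨(Real.neg_pi_div_two_lt_arctan _).le, (Real.arctan_lt_pi_div_two _).le⟩
  have hTF : ∫ ω, T ω * F' (V ω) ∂P = ∫ ω, Ψ ω * F (V ω) ∂P := by
    have hFc : Continuous F := continuous_iff_continuousAt.2 fun x => (hFd x).continuousAt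
    have hint1 : ∀ i ∈ s, Integrable (fun ω => η i (X i ω) * F' (V ω)) P := fun i _ =>
      ((hηL i).integrable (by norm_num)).mul_bdd (c := 1 / l) (by fun_prop)
        (Filter.Eventually.of_forall fun ω => by
          rw [Real.norm_eq_abs, abs_of_nonneg (hF'0 _)]; exact hF'le _)
    have hint2 : ∀ i ∈ s, Integrable (fun ω => ψ i (X i ω) * F (V ω)) P := fun i _ =>
      ((hψL i).integrable (by norm_num)).mul_bdd (c := Real.pi / 2) (by fun_prop)
        (Filter.Eventually.of_forall fun ω => hFle _)
    simp only [hT, hΨ, Finset.sum_apply, Finset.sum_mul]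
    rw [integral_finsetSum s hint1, integral_finsetSum s hint2]
    refine Finset.sum_congr rfl fun i hi => ?_
    have hsplit : ∀ ω, V ω = X i ω + (∑ j ∈ s.erase i, X j) ω := fun ω => by
      rw [Finset.sum_apply]; exact (Finset.add_sum_erase s (fun j => X j ω) hi).symm
    -- For the `i`-th term only `X i` is integrated by parts; the rest of the sum is an independent
    -- shift.
    simp only [hsplit]
    have hind' : IndepFun (X i) (∑ j ∈ s.erase i, X j) P :=
      (hind.indepFun_finsetSum_of_notMem hX (Finset.notMem_erase i s)).symm
    refine (integral_mul_comp_add_eq (hX i) (by fun_prop) hind'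
      (hη i) (hψ i) (hη2 i) (hψ2 i) (hibp i) hFd hF'c (B := max (Real.pi / 2) (1 / l))
      (fun x => (hFle x).trans (le_max_left _ _)) (fun x => ?_)).symm
    rw [abs_of_nonneg (hF'0 x)]
    exact (hF'le x).trans (le_max_right _ _)
  set t := √(κ * A) with ht
  have hκA : 0 < κ * A := by positivity
  have htpos : 0 < t := Real.sqrt_pos.2 hκA
  have hΨF : ∫ ω, Ψ ω * F (V ω) ∂P ≤ Real.pi / 2 * t := by
    have hFc : Continuous F := continuous_iff_continuousAt.2 fun x => (hFd x).continuousAt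
    -- Cauchy-Schwarz in the form `2|Ψ| ≤ Ψ ^ 2 / t + t`, balanced by `t = √(κ A)`.
    have h1 : ∫ ω, Ψ ω * F (V ω) ∂P ≤ ∫ ω, Real.pi / 2 * ((Ψ ω ^ 2 / t + t) / 2) ∂P := by
      refine integral_mono (hΨi.mul_bdd (c := Real.pi / 2) (by fun_prop)
        (Filter.Eventually.of_forall fun ω => hFle _))
        ((((hΨL.integrable_sq.div_const t).add (integrable_const t)).div_const 2).const_mul _)
        fun ω => ?_
      have h2 : |Ψ ω| ≤ (Ψ ω ^ 2 / t + t) / 2 := by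
        rw [le_div_iff₀ two_pos, ← sub_nonneg]
        have : Ψ ω ^ 2 / t + t - |Ψ ω| * 2 = (|Ψ ω| - t) ^ 2 / t := by
          rw [← sq_abs (Ψ ω)]; field_simp; ring
        rw [this]; positivity
      calc Ψ ω * F (V ω) ≤ |Ψ ω| * |F (V ω)| := by rw [← abs_mul]; exact le_abs_self _
        _ ≤ (Ψ ω ^ 2 / t + t) / 2 * (Real.pi / 2) :=
          mul_le_mul h2 (hFle _) (abs_nonneg _) (by positivity)
        _ = _ := mul_comm _ _
    refine h1.trans ?_
    rw [integral_const_mul, integral_div, integral_add (hΨL.integrable_sq.div_const t)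
      (integrable_const t), integral_div, integral_const, probReal_univ, one_smul]
    refine mul_le_mul_of_nonneg_left ?_ (by positivity)
    have : (∫ ω, Ψ ω ^ 2 ∂P) / t ≤ t := by
      rw [div_le_iff₀ htpos, Real.mul_self_sqrt hκA.le]; exact hvarΨ
    linarith
  set I : Set Ω := {ω | |V ω - c| ≤ l} with hI
  have hIm : MeasurableSet I := measurableSet_le (hVm.sub_const c).abs measurable_const
  -- Pointwise version of the case split: where `T ≥ τ / 2` the first term is at least `1` on `I`,
  -- and elsewhere the second one is.
  have hpt : ∀ ω, I.indicator (1 : Ω → ℝ) ω ≤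
      (2 / τ) * (2 * l) * (T ω * F' (V ω)) + 4 / τ ^ 2 * (T ω - τ) ^ 2 := by
    intro ω
    by_cases h : ω ∈ I
    · rw [Set.indicator_of_mem h, Pi.one_apply]
      have h1 : 1 ≤ (2 * l) * F' (V ω) := by
        have h2 : ((V ω - c) / l) ^ 2 ≤ 1 := by
          rw [sq_le_one_iff_abs_le_one, abs_div, abs_of_pos hl, div_le_one hl]; exact h
        simp only [hF']
        rw [show 2 * l * (1 / (1 + ((V ω - c) / l) ^ 2) * (1 / l)) =
          2 / (1 + ((V ω - c) / l) ^ 2) by field_simp, le_div_iff₀ (by positivity)]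
        linarith
      have h3 : T ω ≤ (2 * l) * (T ω * F' (V ω)) := by nlinarith [hT0 ω]
      have h4 : 1 ≤ 2 / τ * T ω + 4 / τ ^ 2 * (T ω - τ) ^ 2 := by
        rw [show 2 / τ * T ω + 4 / τ ^ 2 * (T ω - τ) ^ 2 =
          (2 * τ * T ω + 4 * (T ω - τ) ^ 2) / τ ^ 2 by field_simp, le_div_iff₀ (by positivity)]
        nlinarith [sq_nonneg (2 * T ω - 3 / 2 * τ)]
      have h5 : 2 / τ * T ω ≤ 2 / τ * (2 * l) * (T ω * F' (V ω)) := by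
        rw [mul_assoc]; exact mul_le_mul_of_nonneg_left h3 (by positivity)
      linarith
    · rw [Set.indicator_of_notMem h]
      have := hT0 ω
      have := hF'0 (V ω)
      positivity
  have hTF'i : Integrable (fun ω => T ω * F' (V ω)) P :=
    hTi.mul_bdd (c := 1 / l) (by fun_prop) (Filter.Eventually.of_forall fun ω => by
          rw [Real.norm_eq_abs, abs_of_nonneg (hF'0 _)]; exact hF'le _)
  have hTsq : Integrable (fun ω => (T ω - τ) ^ 2) P :=
    (hTL.sub (memLp_const τ)).integrable_sq
  have hfin : P.real I ≤ (2 / τ) * (2 * l) * (Real.pi / 2 * t) +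
      4 / τ ^ 2 * (κ * ∑ i ∈ s, a i ^ 2) := by
    calc P.real I = ∫ ω, I.indicator (1 : Ω → ℝ) ω ∂P := (integral_indicator_one hIm).symm
      _ ≤ ∫ ω, ((2 / τ) * (2 * l) * (T ω * F' (V ω)) + 4 / τ ^ 2 * (T ω - τ) ^ 2) ∂P :=
        integral_mono ((integrable_const (1 : ℝ)).indicator hIm)
          ((hTF'i.const_mul _).add (hTsq.const_mul _)) hpt
      _ = (2 / τ) * (2 * l) * (∫ ω, T ω * F' (V ω) ∂P) +
          4 / τ ^ 2 * ∫ ω, (T ω - τ) ^ 2 ∂P := by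
        rw [integral_add (hTF'i.const_mul _) (hTsq.const_mul _), integral_const_mul,
          integral_const_mul]
      _ ≤ _ := by
        rw [hTF]
        exact add_le_add (mul_le_mul_of_nonneg_left hΨF (by positivity))
          (mul_le_mul_of_nonneg_left hvarT (by positivity))
  refine hfin.trans ?_
  have hinv : 1 / τ ≤ κ / A := by rw [div_le_div_iff₀ hτpos hA]; linarith
  have hS : 0 ≤ ∑ i ∈ s, a i ^ 2 := Finset.sum_nonneg fun i _ => sq_nonneg _
  have hsA : 0 < √A := Real.sqrt_pos.2 hA
  have htle : t ≤ κ * √A := by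
    rw [ht, Real.sqrt_mul (by linarith)]
    refine mul_le_mul_of_nonneg_right ?_ hsA.le
    rw [Real.sqrt_le_left (by linarith)]
    nlinarith
  have hκ23 : κ ^ 2 ≤ κ ^ 3 := pow_le_pow_right₀ hκ (by norm_num)
  -- The constant `7` is a bound for `2π`.
  have e1 : (2 / τ) * (2 * l) * (Real.pi / 2 * t) ≤ 7 * κ ^ 3 * (l / √A) := by
    calc (2 / τ) * (2 * l) * (Real.pi / 2 * t) = 2 * Real.pi * l * ((1 / τ) * t) := by ring
      _ ≤ 2 * Real.pi * l * ((κ / A) * (κ * √A)) := by gcongr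
      _ = 2 * Real.pi * κ ^ 2 * (l / √A) := by
        have : √A * √A = A := Real.mul_self_sqrt hA.le
        rw [show κ / A = κ / (√A * √A) by rw [this]]
        field_simp
      _ ≤ 7 * κ ^ 3 * (l / √A) := by
        refine mul_le_mul_of_nonneg_right ?_ (by positivity)
        have := Real.pi_lt_d2
        nlinarith [Real.pi_pos, sq_nonneg κ]
  have e2 : 4 / τ ^ 2 * (κ * ∑ i ∈ s, a i ^ 2) ≤
      7 * κ ^ 3 * ((∑ i ∈ s, a i ^ 2) / A ^ 2) := by
    calc 4 / τ ^ 2 * (κ * ∑ i ∈ s, a i ^ 2) = 4 * κ * (1 / τ) ^ 2 * ∑ i ∈ s, a i ^ 2 := by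
          ring
      _ ≤ 4 * κ * (κ / A) ^ 2 * ∑ i ∈ s, a i ^ 2 := by gcongr
      _ = 4 * κ ^ 3 * ((∑ i ∈ s, a i ^ 2) / A ^ 2) := by ring
      _ ≤ _ := by
        refine mul_le_mul_of_nonneg_right ?_ (by positivity)
        nlinarith [pow_pos (lt_of_lt_of_le one_pos hκ) 3]
  rw [mul_add]
  exact add_le_add e1 e2

end Concentration

/-! ### Berry-Esseen bound for Stein regular summands -/

theorem SteinRegular.defect_nonneg {κ a M : ℝ} {μ : Measure ℝ} (h : SteinRegular κ a M μ) :
    0 ≤ M := by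
  simpa using h.stein_defect (fun _ => 0) 1 0 measurable_const zero_le_one le_rfl (by simp)

/-- The part `w * steinSol r w` is Lipschitz in the shift, with a constant growing linearly in `w`.
The indicator changes only if `w` is within `|t|` of `r`; after averaging over `w` this becomes a
concentration probability. -/
theorem abs_steinSolDeriv_shift_le (r t w : ℝ) :
    |steinSolDeriv r (t + w) - steinSolDeriv r w| ≤
      (2 * |w| + 5) * |t| + {x | |x - r| ≤ |t|}.indicator 1 w := by
  have h1 : |(t + w) * steinSol r (t + w) - w * steinSol r w| ≤ (2 * |w| + 5) * |t| := by
    have e : (t + w) * steinSol r (t + w) - w * steinSol r w =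
      w * (steinSol r (t + w) - steinSol r w) + t * steinSol r (t + w) := by ring
    rw [e]
    refine (abs_add_le _ _).trans ?_
    rw [abs_mul, abs_mul]
    have h2 := abs_steinSol_sub_le r w (t + w)
    rw [add_sub_cancel_right] at h2
    have h3 := abs_steinSol_le r (t + w)
    nlinarith [mul_le_mul_of_nonneg_left h2 (abs_nonneg w),
      mul_le_mul_of_nonneg_left h3 (abs_nonneg t)]
  have h2 : |(Set.Iio r).indicator (1 : ℝ → ℝ) (t + w) - (Set.Iio r).indicator 1 w| ≤
      {x | |x - r| ≤ |t|}.indicator 1 w := by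
    by_cases hw : |w - r| ≤ |t|
    · rw [Set.indicator_of_mem (s := {x | |x - r| ≤ |t|}) hw]
      by_cases ha : t + w ∈ Set.Iio r <;> by_cases hb : w ∈ Set.Iio r <;> simp [ha, hb]
    · rw [Set.indicator_of_notMem (s := {x | |x - r| ≤ |t|}) hw]
      have : t + w ∈ Set.Iio r ↔ w ∈ Set.Iio r := by
        simp only [Set.mem_Iio]
        push Not at hw
        rcases abs_cases (w - r) with h | h <;> rcases abs_cases t with h' | h' <;>
          constructor <;> intro <;> linarith
      by_cases ha : t + w ∈ Set.Iio r
      · simp [ha, this.1 ha]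
      · simp [ha, mt this.2 ha]
  have e : steinSolDeriv r (t + w) - steinSolDeriv r w =
      ((t + w) * steinSol r (t + w) - w * steinSol r w) +
      ((Set.Iio r).indicator (1 : ℝ → ℝ) (t + w) - (Set.Iio r).indicator 1 w) := by
    unfold steinSolDeriv; ring
  rw [e]
  exact (abs_add_le _ _).trans (add_le_add h1 h2)

theorem integral_abs_le_one_of_sq {ν : Measure ℝ} [IsProbabilityMeasure ν]
    (h2 : MemLp (fun x : ℝ => x) 2 ν) (hv : ∫ x, x ^ 2 ∂ν ≤ 1) : ∫ x, |x| ∂ν ≤ 1 := by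
  have h1 : ∫ x, |x| ∂ν ≤ ∫ x, (x ^ 2 + 1) / 2 ∂ν := by
    refine integral_mono (h2.integrable (by norm_num)).abs
      ((h2.integrable_sq.add (integrable_const 1)).div_const 2) fun x => ?_
    have := sq_nonneg (|x| - 1)
    rw [sub_sq, sq_abs] at this
    simp only
    linarith
  refine h1.trans ?_
  rw [integral_div, integral_add h2.integrable_sq (integrable_const 1), integral_const,
    probReal_univ, one_smul]
  linarith

/-- Let `B t` be the average of `steinSolDeriv r (t + w)` over `w`. By the concentration hypothesis
`|B t - B 0|` grows at most linearly, with slope `7 + b` and offset `q`, so the defect condition of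
`μ` applies to `B - B 0`. The constant `B 0` has zero defect. -/
theorem stein_defect_prod {κ a M : ℝ} {μ ν : Measure ℝ} [IsProbabilityMeasure μ]
    [IsProbabilityMeasure ν] (hμ : SteinRegular κ a M μ) (h2 : MemLp (fun x : ℝ => x) 2 ν)
    (hv : ∫ x, x ^ 2 ∂ν ≤ 1) (r : ℝ) {b q : ℝ} (hb : 0 ≤ b) (hq : 0 ≤ q)
    (hconc : ∀ l, 0 < l → ν.real {x | |x - r| ≤ l} ≤ b * l + q) :
    |(∫ z, z.1 * steinSol r (z.1 + z.2) ∂(μ.prod ν)) -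
      (∫ x, x ^ 2 ∂μ) * ∫ z, steinSolDeriv r (z.1 + z.2) ∂(μ.prod ν)| ≤
      (7 + b) * M + q * (κ * a) := by
  have hfm := measurable_steinSolDeriv r
  have hfc := continuous_steinSol r
  have hbd : ∀ (ρ : Measure (ℝ × ℝ)) [IsFiniteMeasure ρ],
      Integrable (fun z : ℝ × ℝ => steinSolDeriv r (z.1 + z.2)) ρ := fun ρ _ =>
    (integrable_const (2 : ℝ)).mono' (hfm.comp (by fun_prop)).aestronglyMeasurable
      (Filter.Eventually.of_forall fun z => abs_steinSolDeriv_le r _)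
  have hbw : ∀ t, Integrable (fun w => steinSolDeriv r (t + w)) ν := fun t =>
    (integrable_const (2 : ℝ)).mono' (hfm.comp (by fun_prop)).aestronglyMeasurable
      (Filter.Eventually.of_forall fun z => abs_steinSolDeriv_le r _)
  have hfw : ∀ t, Integrable (fun w => steinSol r (t + w)) ν := fun t =>
    (integrable_const (5 : ℝ)).mono' (by fun_prop)
      (Filter.Eventually.of_forall fun z => abs_steinSol_le r _)
  set B : ℝ → ℝ := fun t => ∫ w, steinSolDeriv r (t + w) ∂ν with hB
  have hBm : Measurable B := by
    have : StronglyMeasurable (fun z : ℝ × ℝ => steinSolDeriv r (z.1 + z.2)) :=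
      Measurable.stronglyMeasurable (by fun_prop)
    exact this.integral_prod_right.measurable
  have hB2 : ∀ t, |B t| ≤ 2 := fun t => by
    have := norm_integral_le_of_norm_le_const (μ := ν) (f := fun w => steinSolDeriv r (t + w))
      (C := 2) (Filter.Eventually.of_forall fun z => abs_steinSolDeriv_le r _)
    simpa using this
  have hx1 : Integrable (fun x : ℝ => x) μ := hμ.memLp_two.integrable (by norm_num)
  have hx2 : Integrable (fun x : ℝ => x ^ 2) μ := hμ.memLp_two.integrable_sq
  have hBi : Integrable B μ := (integrable_const (2 : ℝ)).mono' hBm.aestronglyMeasurable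
    (Filter.Eventually.of_forall hB2)
  -- integrals of `B`
  have hBint : ∀ x, ∫ t in (0 : ℝ)..x, B t =
      (∫ w, steinSol r (x + w) ∂ν) - ∫ w, steinSol r (0 + w) ∂ν := by
    intro x
    rw [← integral_sub (hfw x) (hfw 0), hB]
    rw [intervalIntegral_integral_swap]
    · refine integral_congr_ae (Filter.Eventually.of_forall fun w => ?_)
      simp only
      rw [steinSol_sub, intervalIntegral.integral_comp_add_right]
    · have : IsFiniteMeasure (volume.restrict (Set.uIoc 0 x)) := ⟨by simp [Set.uIoc]⟩
      exact hbd _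
  set g0 := ∫ w, steinSol r (0 + w) ∂ν with hg0
  have hxf : Integrable (fun z : ℝ × ℝ => z.1 * steinSol r (z.1 + z.2)) (μ.prod ν) := by
    refine (hx1.comp_fst ν).mul_bdd (c := 5) (by fun_prop)
      (Filter.Eventually.of_forall fun z => abs_steinSol_le r _)
  have e1 : ∫ z, z.1 * steinSol r (z.1 + z.2) ∂(μ.prod ν) =
      ∫ x, x * (∫ t in (0 : ℝ)..x, B t) ∂μ := by
    rw [integral_prod _ hxf]
    simp only [integral_const_mul, hBint]
    have hi : Integrable (fun x => x * ∫ w, steinSol r (x + w) ∂ν) μ := by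
      have := hxf.integral_prod_left
      simpa only [integral_const_mul] using this
    simp only [mul_sub]
    rw [integral_sub hi (hx1.mul_const g0), integral_mul_const, hμ.mean_eq_zero, zero_mul, sub_zero]
  have e2 : ∫ z, steinSolDeriv r (z.1 + z.2) ∂(μ.prod ν) = ∫ x, B x ∂μ :=
    integral_prod _ (hbd _)
  set A : ℝ → ℝ := fun t => B t - B 0 with hA
  have hAm : Measurable A := hBm.sub_const _
  have hBii : ∀ x, IntervalIntegrable B volume 0 x := fun x =>
    intervalIntegrable_of_bounded hBm hB2 0 x
  have e3 : ∫ x, x * (∫ t in (0 : ℝ)..x, A t) ∂μ =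
      (∫ x, x * (∫ t in (0 : ℝ)..x, B t) ∂μ) - (∫ x, x ^ 2 ∂μ) * B 0 := by
    have : ∀ x, x * (∫ t in (0 : ℝ)..x, A t) = x * (∫ t in (0 : ℝ)..x, B t) - x ^ 2 * B 0 := by
      intro x
      rw [hA, intervalIntegral.integral_sub (hBii x) (by simp), intervalIntegral.integral_const]
      simp only [smul_eq_mul, sub_zero]; ring
    simp only [this]
    rw [integral_sub _ (hx2.mul_const _), integral_mul_const]
    have hc : Continuous fun x => ∫ t in (0 : ℝ)..x, B t :=
      intervalIntegral.continuous_primitive (intervalIntegrable_of_bounded hBm hB2) 0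
    refine (hx2.const_mul 2).mono' (by fun_prop) (Filter.Eventually.of_forall fun x => ?_)
    have := intervalIntegral.norm_integral_le_of_norm_le_const (a := 0) (b := x) (f := B) (C := 2)
      fun t _ => hB2 t
    rw [sub_zero] at this
    rw [norm_mul, Real.norm_eq_abs]
    calc |x| * ‖∫ t in (0 : ℝ)..x, B t‖ ≤ |x| * (2 * |x|) := by gcongr
      _ = 2 * x ^ 2 := by rw [← sq_abs x]; ring
  have e4 : ∫ x, A x ∂μ = (∫ x, B x ∂μ) - B 0 := by
    rw [hA, integral_sub hBi (integrable_const _)]; simp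
  have hAb : ∀ t, |A t| ≤ (7 + b) * |t| + q := by
    intro t
    rcases eq_or_ne t 0 with rfl | ht
    · simpa [hA] using hq
    have h0 : B 0 = ∫ w, steinSolDeriv r w ∂ν := by simp [hB]
    have hms : MeasurableSet {x : ℝ | |x - r| ≤ |t|} :=
      measurableSet_le (by fun_prop) measurable_const
    have hwi : Integrable (fun w : ℝ => w) ν := h2.integrable (by norm_num)
    have hind : Integrable ({x : ℝ | |x - r| ≤ |t|}.indicator (1 : ℝ → ℝ)) ν :=
      (integrable_const (1 : ℝ)).indicator hms
    have hlin : Integrable (fun w : ℝ => (2 * |w| + 5) * |t|) ν :=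
      ((hwi.abs.const_mul 2).add (integrable_const 5)).mul_const _
    have : A t = ∫ w, (steinSolDeriv r (t + w) - steinSolDeriv r w) ∂ν := by
      rw [integral_sub (hbw t) (by simpa using hbw 0), ← h0]
    rw [this]
    calc |∫ w, (steinSolDeriv r (t + w) - steinSolDeriv r w) ∂ν|
        ≤ ∫ w, |steinSolDeriv r (t + w) - steinSolDeriv r w| ∂ν := abs_integral_le_integral_abs
      _ ≤ ∫ w, ((2 * |w| + 5) * |t| + {x : ℝ | |x - r| ≤ |t|}.indicator 1 w) ∂ν :=
        integral_mono ((hbw t).sub (by simpa using hbw 0)).abs (hlin.add hind)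
          fun w => abs_steinSolDeriv_shift_le r t w
      _ = (2 * (∫ w, |w| ∂ν) + 5) * |t| + ν.real {x : ℝ | |x - r| ≤ |t|} := by
        rw [integral_add hlin hind, integral_mul_const,
          integral_add (hwi.abs.const_mul 2) (integrable_const 5), integral_const_mul,
          integral_const, probReal_univ, one_smul, integral_indicator_one hms]
      -- The unit variance bound gives `E|w| ≤ 1`; this is the origin of the `7`.
      _ ≤ (2 * 1 + 5) * |t| + (b * |t| + q) := by
        have := integral_abs_le_one_of_sq h2 hv
        have := hconc |t| (abs_pos.2 ht)
        gcongr
      _ = _ := by ring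
  have := hμ.stein_defect A (7 + b) q hAm (by linarith) hq hAb
  rw [e3, e4] at this
  rw [e1, e2]
  convert this using 2
  ring

/-- Since the variances sum to `1`, Stein's equation writes the error as a sum over `k` of the
defect of `X k` against the averaged derivative, with `V` the sum of the others. Each is controlled
by `stein_defect_prod`, whose concentration input comes from `V`. The hypothesis `hloo` keeps the
scale of `V` bounded below after one summand is removed. -/
theorem ks_le_of_steinRegular {Ω ι : Type*} [MeasurableSpace Ω] [Fintype ι] {P : Measure Ω}
    [IsProbabilityMeasure P] {X : ι → Ω → ℝ} (hX : ∀ i, Measurable (X i))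
    (hind : iIndepFun X P) {κ : ℝ} (hκ : 1 ≤ κ) {a M : ι → ℝ}
    (hreg : ∀ i, SteinRegular κ (a i) (M i) (P.map (X i)))
    (hvar : ∑ i, ∫ ω, X i ω ^ 2 ∂P = 1)
    (hloo : ∀ k, (1 + κ) * a k ≤ κ * ∑ i, a i) (r : ℝ) :
    |P.real {ω | ∑ i, X i ω < r} - (gaussianReal 0 1).real (Set.Iio r)| ≤
      28 * κ ^ 9 * (∑ i, M i + ∑ i, a i ^ 2) := by
  classical
  have hprob : ∀ i, IsProbabilityMeasure (P.map (X i)) := fun i =>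
    Measure.isProbabilityMeasure_map (hX i).aemeasurable
  have hfm := measurable_steinSolDeriv r
  have hfc := continuous_steinSol r
  set W : Ω → ℝ := fun ω => ∑ i, X i ω with hW
  have hWm : Measurable W := Finset.measurable_sum _ fun i _ => hX i
  have hXL : ∀ i, MemLp (X i) 2 P := fun i =>
    (hreg i).memLp_two.comp_measurePreserving ⟨hX i, rfl⟩
  have hmap2 : ∀ i, ∫ x, x ^ 2 ∂(P.map (X i)) = ∫ ω, X i ω ^ 2 ∂P := fun i =>
    integral_map (hX i).aemeasurable (by fun_prop)
  have hmean : ∀ i, ∫ ω, X i ω ∂P = 0 := fun i => by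
    rw [← (hreg i).mean_eq_zero]
    exact (integral_map (hX i).aemeasurable measurable_id.aestronglyMeasurable).symm
  have ha0 : ∀ i, 0 ≤ a i := fun i => (hreg i).scale_nonneg
  set S := ∑ i, a i with hS
  set S2 := ∑ i, a i ^ 2 with hS2
  have hS20 : 0 ≤ S2 := Finset.sum_nonneg fun i _ => sq_nonneg _
  have hSle : S ≤ κ := by
    rw [← mul_one κ, ← hvar, Finset.mul_sum]
    exact Finset.sum_le_sum fun i _ => by rw [← hmap2]; exact (hreg i).le_variance
  have hSge : 1 ≤ κ * S := by
    rw [← hvar, Finset.mul_sum]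
    exact Finset.sum_le_sum fun i _ => by rw [← hmap2]; exact (hreg i).variance_le
  set c := gaussTail (-r) / √(2 * Real.pi) with hc
  -- Stein's equation
  have hWfi : ∀ i, Integrable (fun ω => X i ω * steinSol r (W ω)) P := fun i =>
    ((hXL i).integrable (by norm_num)).mul_bdd (c := 5) (by fun_prop)
      (Filter.Eventually.of_forall fun ω => abs_steinSol_le r _)
  have hf'i : Integrable (fun ω => steinSolDeriv r (W ω)) P :=
    (integrable_const (2 : ℝ)).mono' (hfm.comp (by fun_prop)).aestronglyMeasurable
      (Filter.Eventually.of_forall fun z => abs_steinSolDeriv_le r _)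
  have hWset : MeasurableSet {ω | W ω < r} := measurableSet_lt hWm measurable_const
  have hstein : P.real {ω | W ω < r} - c =
      ∑ i, ((∫ ω, X i ω ^ 2 ∂P) * (∫ ω, steinSolDeriv r (W ω) ∂P) -
        ∫ ω, X i ω * steinSol r (W ω) ∂P) := by
    rw [Finset.sum_sub_distrib, ← Finset.sum_mul, hvar, one_mul, ← integral_finsetSum _
      (fun i _ => hWfi i)]
    have h1 : ∀ ω, steinSolDeriv r (W ω) - ∑ i, X i ω * steinSol r (W ω) =
        {ω | W ω < r}.indicator 1 ω - c := by
      intro ω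
      rw [← Finset.sum_mul]
      simp only [steinSolDeriv]
      have : (Set.Iio r).indicator (1 : ℝ → ℝ) (W ω) = {ω | W ω < r}.indicator 1 ω := rfl
      rw [this]
      ring
    rw [← integral_sub hf'i (integrable_finsetSum _ fun i _ => hWfi i)]
    simp only [h1]
    have hI : Integrable ({ω | W ω < r}.indicator (1 : Ω → ℝ)) P :=
      (integrable_const (1 : ℝ)).indicator hWset
    rw [integral_sub hI (integrable_const c),
      integral_indicator_one hWset]
    simp
  rw [gaussianReal_real_Iio, ← hc]
  change |P.real {ω | W ω < r} - c| ≤ _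
  rw [hstein]
  refine (Finset.abs_sum_le_sum_abs _ _).trans ?_
  have hκ0 : 0 < κ := by linarith
  have hterm : ∀ k, |(∫ ω, X k ω ^ 2 ∂P) * (∫ ω, steinSolDeriv r (W ω) ∂P) -
        ∫ ω, X k ω * steinSol r (W ω) ∂P| ≤
      (7 + 14 * κ ^ 4) * M k + (28 * κ ^ 7 * S2) * (κ * a k) := by
    intro k
    set s := Finset.univ.erase k with hs
    set V : Ω → ℝ := fun ω => ∑ i ∈ s, X i ω with hV
    have hVm : Measurable V := Finset.measurable_sum _ fun i _ => hX i
    have hVL : MemLp V 2 P := memLp_finsetSum s fun i _ => hXL i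
    have hVX : IndepFun (X k) V P := by
      have := (hind.indepFun_finsetSum_of_notMem hX (Finset.notMem_erase k Finset.univ)).symm
      convert this using 1
      ext ω; simp [hV, hs]
    have hprobV : IsProbabilityMeasure (P.map V) :=
      Measure.isProbabilityMeasure_map hVm.aemeasurable
    have hWV : ∀ ω, W ω = X k ω + V ω := fun ω =>
      (Finset.add_sum_erase _ (fun j => X j ω) (Finset.mem_univ k)).symm
    have hA : S = a k + ∑ i ∈ s, a i := (Finset.add_sum_erase _ a (Finset.mem_univ k)).symm
    -- `hloo` leaves at least `S / (1 + κ)`, and `S ≥ 1 / κ`; finally `κ (1 + κ) ≤ 2 κ ^ 2`.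
    have hAge : 1 ≤ 2 * κ ^ 2 * ∑ i ∈ s, a i := by
      have h1 := hloo k
      have h2 : S ≤ (1 + κ) * ∑ i ∈ s, a i := by nlinarith
      have h3 : κ * S ≤ κ * ((1 + κ) * ∑ i ∈ s, a i) := mul_le_mul_of_nonneg_left h2 hκ0.le
      have h4 : 0 ≤ ∑ i ∈ s, a i := Finset.sum_nonneg fun i _ => ha0 i
      nlinarith [mul_nonneg (mul_nonneg hκ0.le (sub_nonneg.2 hκ)) h4]
    have hApos : 0 < ∑ i ∈ s, a i := by
      by_contra h
      push Not at h
      nlinarith [sq_nonneg κ]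
    have hV2 : ∫ x, x ^ 2 ∂(P.map V) ≤ 1 := by
      rw [integral_map hVm.aemeasurable (by fun_prop)]
      have h0 : ∫ ω, V ω ∂P = 0 := by
        rw [hV, integral_finsetSum s fun i _ => (hXL i).integrable (by norm_num)]
        exact Finset.sum_eq_zero fun i _ => hmean i
      have h1 : ∫ ω, V ω ^ 2 ∂P = variance V P := by
        rw [variance_eq_integral hVm.aemeasurable, h0]; simp
      have h2 : V = ∑ i ∈ s, X i := by ext ω; simp [hV]
      rw [h1, h2, IndepFun.variance_sum (fun i _ => hXL i)
        (fun i _ j _ hij => hind.indepFun hij), ← hvar]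
      refine (Finset.sum_le_sum fun i _ => ?_).trans (Finset.sum_le_univ_sum_of_nonneg fun i =>
        integral_nonneg fun ω => sq_nonneg _)
      exact variance_le_expectation_sq (hXL i).aestronglyMeasurable
    have hconc : ∀ l, 0 < l → (P.map V).real {x | |x - r| ≤ l} ≤
        14 * κ ^ 4 * l + 28 * κ ^ 7 * S2 := by
      intro l hl
      have hms : MeasurableSet {x : ℝ | |x - r| ≤ l} :=
        measurableSet_le (by fun_prop) measurable_const
      rw [map_measureReal_apply hVm hms]
      refine (concentration_of_sum hX hind hκ hreg s hApos r hl).trans ?_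
      have hs1 : 1 ≤ 2 * κ * √(∑ i ∈ s, a i) := by
        have h1 := Real.sq_sqrt hApos.le
        have h2 : 0 < √(∑ i ∈ s, a i) := Real.sqrt_pos.2 hApos
        by_contra h
        push Not at h
        nlinarith [mul_pos hκ0 h2]
      have hl1 : l / √(∑ i ∈ s, a i) ≤ 2 * κ * l := by
        rw [div_le_iff₀ (Real.sqrt_pos.2 hApos)]; nlinarith
      have hl2 : (∑ i ∈ s, a i ^ 2) / (∑ i ∈ s, a i) ^ 2 ≤ 4 * κ ^ 4 * S2 := by
        rw [div_le_iff₀ (by positivity)]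
        have h1 : ∑ i ∈ s, a i ^ 2 ≤ S2 :=
          Finset.sum_le_univ_sum_of_nonneg fun i => sq_nonneg _
        have h2 : 1 ≤ (2 * κ ^ 2 * ∑ i ∈ s, a i) ^ 2 := one_le_pow₀ hAge
        nlinarith
      calc 7 * κ ^ 3 * (l / √(∑ i ∈ s, a i) + (∑ i ∈ s, a i ^ 2) / (∑ i ∈ s, a i) ^ 2)
          ≤ 7 * κ ^ 3 * (2 * κ * l + 4 * κ ^ 4 * S2) := by gcongr
        _ = _ := by ring
    have hdef := stein_defect_prod (hreg k) (ν := P.map V)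
      ((memLp_map_measure_iff (by fun_prop) hVm.aemeasurable).2 hVL) hV2 r
      (b := 14 * κ ^ 4) (q := 28 * κ ^ 7 * S2) (by positivity) (by positivity) hconc
    have hm := (indepFun_iff_map_prod_eq_prod_map_map (hX k).aemeasurable hVm.aemeasurable).1 hVX
    have hfm' : Measurable fun z : ℝ × ℝ => steinSolDeriv r (z.1 + z.2) := hfm.comp (by fun_prop)
    rw [← hm, hmap2, integral_map (by fun_prop) (by fun_prop), integral_map (by fun_prop)
      hfm'.aestronglyMeasurable] at hdef
    rw [abs_sub_comm]
    simpa only [hWV] using hdef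
  refine (Finset.sum_le_sum fun k _ => hterm k).trans ?_
  rw [Finset.sum_add_distrib, ← Finset.mul_sum, ← Finset.mul_sum, ← Finset.mul_sum, ← hS]
  have hM0 : 0 ≤ ∑ i, M i := Finset.sum_nonneg fun i _ => (hreg i).defect_nonneg
  have h49 : κ ^ 4 ≤ κ ^ 9 := pow_le_pow_right₀ hκ (by norm_num)
  have h19 : 1 ≤ κ ^ 9 := one_le_pow₀ hκ
  have e1 : (7 + 14 * κ ^ 4) * ∑ i, M i ≤ 28 * κ ^ 9 * ∑ i, M i :=
    mul_le_mul_of_nonneg_right (by linarith) hM0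
  -- The offset `q` is already of order `∑ a ^ 2`, and the total scale it multiplies is at most `κ`.
  have e2 : 28 * κ ^ 7 * S2 * (κ * S) ≤ 28 * κ ^ 9 * S2 := by
    calc 28 * κ ^ 7 * S2 * (κ * S) ≤ 28 * κ ^ 7 * S2 * (κ * κ) := by gcongr
      _ = _ := by ring
  rw [mul_add]
  exact add_le_add e1 e2

/-! ### Scaling of Stein regularity, and defects from third moments -/

/-- The defect is quadratic in the variable, and the slope of `t ↦ A (c * t)` brings a third factor
`c`, hence the cube on `M`. The weights transform as `c ^ 2 η` and `c ψ`. -/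
theorem SteinRegular.scale {κ a M : ℝ} {μ : Measure ℝ} (h : SteinRegular κ a M μ) {c : ℝ}
    (hc : 0 < c) : SteinRegular κ (c ^ 2 * a) (c ^ 3 * M) (μ.map (fun x => c * x)) := by
  have hmeas : Measurable fun x : ℝ => c * x := by fun_prop
  have hemb : MeasurableEmbedding fun x : ℝ => c * x :=
    (MeasurableEquiv.mulLeft₀ c hc.ne').measurableEmbedding
  have hint : ∀ f : ℝ → ℝ, ∫ x, f x ∂(μ.map fun x => c * x) = ∫ x, f (c * x) ∂μ :=
    fun f => hemb.integral_map f
  have hsq : ∫ x, x ^ 2 ∂(μ.map fun x => c * x) = c ^ 2 * ∫ x, x ^ 2 ∂μ := by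
    rw [hint]; simp only [mul_pow]; rw [integral_const_mul]
  refine ⟨mul_nonneg (sq_nonneg c) h.scale_nonneg, ?_, ?_, ?_, ?_, ?_, ?_⟩
  · rw [hint, integral_const_mul, h.mean_eq_zero, mul_zero]
  · exact (memLp_map_measure_iff (by fun_prop) hmeas.aemeasurable).2 (h.memLp_two.const_mul c)
  · rw [hsq]; nlinarith [h.variance_le, sq_nonneg c]
  · rw [hsq]; nlinarith [h.le_variance, sq_nonneg c]
  · intro A α β hA hα hβ hAb
    have := h.stein_defect (fun t => A (c * t)) (c * α) β (by fun_prop) (by positivity) hβ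
      fun t => (hAb _).trans_eq (by rw [abs_mul, abs_of_pos hc]; ring)
    rw [hsq, hint, hint]
    have e : ∀ x, c * x * (∫ t in (0 : ℝ)..c * x, A t) =
        c ^ 2 * (x * ∫ t in (0 : ℝ)..x, A (c * t)) := by
      intro x
      rw [intervalIntegral.integral_comp_mul_left _ hc.ne', mul_zero, smul_eq_mul]
      field_simp
    simp only [e]
    rw [integral_const_mul, mul_assoc, ← mul_sub, abs_mul, abs_of_pos (by positivity)]
    calc _ ≤ c ^ 2 * (c * α * M + β * (κ * a)) := mul_le_mul_of_nonneg_left this (by positivity)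
      _ = _ := by ring
  · obtain ⟨η, ψ, hη, hψ, h0, hη2, hψ2, h1, h2, h3, h4⟩ := h.integration_by_parts
    have hs : ∀ x : ℝ, c⁻¹ * (c * x) = x := fun x => by field_simp
    refine ⟨fun x => c ^ 2 * η (c⁻¹ * x), fun x => c * ψ (c⁻¹ * x), by fun_prop, by fun_prop,
      fun x => mul_nonneg (sq_nonneg c) (h0 _), ?_, ?_, ?_, ?_, ?_, ?_⟩
    · refine (memLp_map_measure_iff ?_ hmeas.aemeasurable).2 ?_
      · exact (Measurable.aestronglyMeasurable (by fun_prop))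
      simp only [Function.comp_def, hs]
      exact hη2.const_mul _
    · refine (memLp_map_measure_iff ?_ hmeas.aemeasurable).2 ?_
      · exact (Measurable.aestronglyMeasurable (by fun_prop))
      simp only [Function.comp_def, hs]
      exact hψ2.const_mul _
    · rw [hint]; simp only [hs]; rw [integral_const_mul]; nlinarith [sq_nonneg c]
    · rw [hint]; simp only [hs, mul_pow]; rw [integral_const_mul]
      nlinarith [sq_nonneg (c ^ 2)]
    · rw [hint]; simp only [hs, mul_pow]; rw [integral_const_mul]; nlinarith [sq_nonneg c]
    · rintro F F' hF hF' ⟨B, hB⟩ ⟨B', hB'⟩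
      have := h4 (fun x => F (c * x)) (fun x => F' (c * x) * c) (fun x => ?_) (by fun_prop)
        ⟨B, fun x => hB _⟩ ⟨B' * c, fun x => ?_⟩
      · rw [hint, hint]
        simp only [hs, mul_assoc]
        rw [integral_const_mul, this, ← integral_const_mul]
        congr 1; ext x; ring
      · exact ((hF (c * x)).comp x ((hasDerivAt_id x).const_mul c)).congr_deriv (by simp)
      · rw [abs_mul, abs_of_pos hc]; exact mul_le_mul_of_nonneg_right (hB' _) hc.le

theorem SteinRegular.mono {κ κ' a M M' : ℝ} {μ : Measure ℝ} (h : SteinRegular κ a M μ)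
    (hκ : κ ≤ κ') (hM : M ≤ M') : SteinRegular κ' a M' μ := by
  have ha := h.scale_nonneg
  have hv : 0 ≤ ∫ x, x ^ 2 ∂μ := integral_nonneg fun x => sq_nonneg x
  refine ⟨ha, h.mean_eq_zero, h.memLp_two, h.variance_le.trans (by gcongr),
    h.le_variance.trans (by gcongr), ?_, ?_⟩
  · intro A α β hA hα hβ hAb
    exact (h.stein_defect A α β hA hα hβ hAb).trans (by gcongr)
  · obtain ⟨η, ψ, hη, hψ, h0, hη2, hψ2, h1, h2, h3, h4⟩ := h.integration_by_parts
    have : 0 ≤ ∫ x, η x ∂μ := integral_nonneg h0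
    exact ⟨η, ψ, hη, hψ, h0, hη2, hψ2, h1.trans (by gcongr), h2.trans (by gcongr),
      h3.trans (by gcongr), h4⟩

section ThirdMoment

variable {Ω : Type*} [MeasurableSpace Ω] {P : Measure Ω} [IsProbabilityMeasure P]

theorem integrable_pow_of_integrable_abs_cube {X : Ω → ℝ} (hX : AEStronglyMeasurable X P)
    (h3 : Integrable (fun ω => |X ω| ^ 3) P) : Integrable X P ∧ MemLp X 2 P := by
  have h2 : MemLp X 2 P := by
    rw [memLp_two_iff_integrable_sq hX]
    refine ((integrable_const (1 : ℝ)).add h3).mono' (hX.pow 2)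
      (Filter.Eventually.of_forall fun ω => ?_)
    rw [Real.norm_eq_abs, abs_pow]
    simp only [Pi.add_apply]
    have := abs_nonneg (X ω)
    rcases le_total |X ω| 1 with h | h
    · nlinarith [pow_nonneg this 3, pow_le_one₀ this h (n := 2)]
    · nlinarith [sq_nonneg |X ω|]
  exact ⟨h2.integrable (by norm_num), h2⟩

theorem cube_integral_abs_le {X : Ω → ℝ} (hX : AEStronglyMeasurable X P)
    (h3 : Integrable (fun ω => |X ω| ^ 3) P) :
    (∫ ω, |X ω| ∂P) ^ 3 ≤ ∫ ω, |X ω| ^ 3 ∂P := by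
  have hi := (integrable_pow_of_integrable_abs_cube hX h3).1.abs
  set m := ∫ ω, |X ω| ∂P with hm
  have hm0 : 0 ≤ m := integral_nonneg fun _ => abs_nonneg _
  -- Jensen's inequality by the tangent line to the cube at the mean `m`.
  have h : ∫ ω, (3 * m ^ 2 * |X ω| - 2 * m ^ 3) ∂P ≤ ∫ ω, |X ω| ^ 3 ∂P := by
    refine integral_mono ((hi.const_mul _).sub (integrable_const _)) h3 fun ω => ?_
    have := abs_nonneg (X ω)
    simp only
    nlinarith [mul_nonneg (add_nonneg this (mul_nonneg zero_le_two hm0))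
      (sq_nonneg (|X ω| - m))]
  rw [integral_sub (hi.const_mul _) (integrable_const _), integral_const_mul, ← hm] at h
  simp at h
  nlinarith

theorem integral_sq_mul_integral_abs_le {X : Ω → ℝ} (hX : AEStronglyMeasurable X P)
    (h3 : Integrable (fun ω => |X ω| ^ 3) P) :
    (∫ ω, X ω ^ 2 ∂P) * (∫ ω, |X ω| ∂P) ≤ ∫ ω, |X ω| ^ 3 ∂P := by
  have hc := cube_integral_abs_le hX h3
  have h2 := (integrable_pow_of_integrable_abs_cube hX h3).2.integrable_sq
  set m := ∫ ω, |X ω| ∂P with hm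
  have hm0 : 0 ≤ m := integral_nonneg fun _ => abs_nonneg _
  -- Young's inequality with exponents `3/2` and `3`; the cube of `m` is then absorbed by Jensen.
  have h : ∫ ω, X ω ^ 2 * m ∂P ≤ ∫ ω, (2 / 3 * |X ω| ^ 3 + 1 / 3 * m ^ 3) ∂P := by
    refine integral_mono (h2.mul_const m) ((h3.const_mul _).add (integrable_const _)) fun ω => ?_
    have := abs_nonneg (X ω)
    simp only
    rw [← sq_abs]
    nlinarith [mul_nonneg (add_nonneg (mul_nonneg zero_le_two this) hm0)
      (sq_nonneg (|X ω| - m))]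
  rw [integral_add (h3.const_mul _) (integrable_const _), integral_const_mul,
    integral_mul_const] at h
  simp at h
  nlinarith

theorem integral_abs_sub_integral_cube_le {X : Ω → ℝ} (hX : AEStronglyMeasurable X P)
    (h3 : Integrable (fun ω => |X ω| ^ 3) P) :
    Integrable (fun ω => |X ω - ∫ ω', X ω' ∂P| ^ 3) P ∧
    ∫ ω, |X ω - ∫ ω', X ω' ∂P| ^ 3 ∂P ≤ 8 * ∫ ω, |X ω| ^ 3 ∂P := by
  set c := ∫ ω', X ω' ∂P with hc
  have hcl : |c| ^ 3 ≤ ∫ ω, |X ω| ^ 3 ∂P :=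
    (pow_le_pow_left₀ (abs_nonneg _) abs_integral_le_integral_abs 3).trans
      (cube_integral_abs_le hX h3)
  have hpt : ∀ ω, |X ω - c| ^ 3 ≤ 4 * |X ω| ^ 3 + 4 * |c| ^ 3 := by
    intro ω
    have h1 : |X ω - c| ≤ |X ω| + |c| := abs_sub _ _
    have h2 := pow_le_pow_left₀ (abs_nonneg _) h1 3
    have := abs_nonneg (X ω)
    have := abs_nonneg c
    nlinarith [mul_nonneg (add_nonneg (abs_nonneg (X ω)) (abs_nonneg c))
      (sq_nonneg (|X ω| - |c|))]
  have hi := (h3.const_mul 4).add (integrable_const (μ := P) (4 * |c| ^ 3))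
  have hI : Integrable (fun ω => |X ω - c| ^ 3) P := by
    refine hi.mono' ((hX.sub aestronglyMeasurable_const).norm.pow 3)
      (Filter.Eventually.of_forall fun ω => ?_)
    rw [Real.norm_eq_abs, abs_of_nonneg (by positivity)]
    exact hpt ω
  refine ⟨hI, (integral_mono hI hi hpt).trans ?_⟩
  simp only [Pi.add_apply]
  rw [integral_add (h3.const_mul 4) (integrable_const _), integral_const_mul]
  simp
  linarith

end ThirdMoment

/-- Both terms of the defect are bounded separately, without cancellation. This is enough for laws
whose third absolute moment has the order of the variance to the power `3/2` and whose scale is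
small, as for the angular pieces. -/
theorem stein_defect_of_third_moment {μ : Measure ℝ} [IsProbabilityMeasure μ]
    (h3 : Integrable (fun x : ℝ => |x| ^ 3) μ) (A : ℝ → ℝ) (α β : ℝ)
    (hα : 0 ≤ α) (hb : ∀ t, |A t| ≤ α * |t| + β) :
    |(∫ x, x * (∫ t in (0 : ℝ)..x, A t) ∂μ) - (∫ x, x ^ 2 ∂μ) * ∫ x, A x ∂μ|
      ≤ α * (2 * ∫ x, |x| ^ 3 ∂μ) + β * (2 * ∫ x, x ^ 2 ∂μ) := by
  obtain ⟨h1, h2⟩ := integrable_pow_of_integrable_abs_cube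
    measurable_id.aestronglyMeasurable h3
  have h1' : Integrable (fun x : ℝ => |x|) μ := h1.abs
  have h2' : Integrable (fun x : ℝ => x ^ 2) μ := h2.integrable_sq
  have hv0 : 0 ≤ ∫ x, x ^ 2 ∂μ := integral_nonneg fun x => sq_nonneg x
  have e1 : |∫ x, x * (∫ t in (0 : ℝ)..x, A t) ∂μ| ≤
      α * (∫ x, |x| ^ 3 ∂μ) + β * ∫ x, x ^ 2 ∂μ := by
    rw [← integral_const_mul, ← integral_const_mul,
      ← integral_add (h3.const_mul α) (h2'.const_mul β)]
    refine norm_integral_le_of_norm_le (f := fun x => x * ∫ t in (0 : ℝ)..x, A t)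
      ((h3.const_mul α).add (h2'.const_mul β))
      (Filter.Eventually.of_forall fun x => ?_)
    have hle : ‖∫ t in (0 : ℝ)..x, A t‖ ≤ (α * |x| + β) * |x - 0| := by
      refine intervalIntegral.norm_integral_le_of_norm_le_const fun t ht =>
        (Real.norm_eq_abs (A t)).trans_le ((hb t).trans ?_)
      have : |t| ≤ |x| := by
        rcases Set.mem_uIoc.1 ht with h | h
        · rw [abs_of_pos h.1]; exact h.2.trans (le_abs_self x)
        · rw [abs_of_nonpos h.2]; exact (neg_le_neg h.1.le).trans (neg_le_abs x)
      gcongr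
    rw [sub_zero] at hle
    rw [norm_mul, Real.norm_eq_abs]
    calc |x| * ‖∫ t in (0 : ℝ)..x, A t‖ ≤ |x| * ((α * |x| + β) * |x|) := by gcongr
      _ = α * |x| ^ 3 + β * x ^ 2 := by rw [← sq_abs x]; ring
  have e2 : |∫ x, A x ∂μ| ≤ α * (∫ x, |x| ∂μ) + β := by
    have : α * (∫ x, |x| ∂μ) + β = ∫ x, (α * |x| + β) ∂μ := by
      rw [integral_add (h1'.const_mul α) (integrable_const β), integral_const_mul]; simp
    rw [this]
    exact norm_integral_le_of_norm_le (f := A) ((h1'.const_mul α).add (integrable_const β))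
      (Filter.Eventually.of_forall fun x => hb x)
  have e3 := integral_sq_mul_integral_abs_le (P := μ) (X := fun x : ℝ => x)
    measurable_id.aestronglyMeasurable h3
  refine (abs_sub _ _).trans ?_
  rw [abs_mul, abs_of_nonneg hv0]
  have e4 := mul_le_mul_of_nonneg_left e2 hv0
  nlinarith [mul_le_mul_of_nonneg_left e3 hα]

/-! ### The angular pieces `2 log sin φ` -/

/-- The integral of `sin ^ k` over `[0, π]`. -/
noncomputable def sinPowIntegral (k : ℕ) : ℝ := ∫ x in (0 : ℝ)..Real.pi, Real.sin x ^ k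

/-- The law on `(0, π)` with density proportional to `sin ^ k`. -/
noncomputable def sinPowLaw (k : ℕ) : Measure ℝ :=
  (volume.restrict (Set.Ioo 0 Real.pi)).withDensity
    (fun x => ENNReal.ofReal ((sinPowIntegral k)⁻¹ * Real.sin x ^ k))

theorem sinPowIntegral_pos (k : ℕ) : 0 < sinPowIntegral k := integral_sin_pow_pos k

theorem sinPowIntegral_add_two (k : ℕ) :
    sinPowIntegral (k + 2) = (k + 1) / (k + 2) * sinPowIntegral k := by
  have := integral_sin_pow (a := 0) (b := Real.pi) k
  simpa [sinPowIntegral] using this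

theorem sinPowIntegral_succ_le (k : ℕ) : sinPowIntegral (k + 1) ≤ sinPowIntegral k :=
  integral_sin_pow_succ_le k

/-- Skip one exponent: `sinPowIntegral (k + 1)` is at least `sinPowIntegral (k + 2)`, which the
recursion compares with `sinPowIntegral k`. -/
theorem sinPowIntegral_le_two_mul (k : ℕ) : sinPowIntegral k ≤ 2 * sinPowIntegral (k + 1) := by
  have h1 := sinPowIntegral_add_two k
  have h2 := sinPowIntegral_succ_le (k + 1)
  have h3 := sinPowIntegral_pos k
  have h4 : (1 : ℝ) / 2 ≤ (k + 1) / (k + 2) := by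
    rw [div_le_div_iff₀ (by norm_num) (by positivity)]; linarith
  rw [h1] at h2
  nlinarith

theorem integral_sinPowLaw (k : ℕ) (f : ℝ → ℝ) :
    ∫ x, f x ∂(sinPowLaw k) =
      (sinPowIntegral k)⁻¹ * ∫ x in Set.Ioo 0 Real.pi, f x * Real.sin x ^ k := by
  have hk := sinPowIntegral_pos k
  rw [sinPowLaw, integral_withDensity_eq_integral_toReal_smul (by fun_prop)
    (Filter.Eventually.of_forall fun x => ENNReal.ofReal_lt_top), ← integral_const_mul]
  refine setIntegral_congr_fun measurableSet_Ioo fun x hx => ?_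
  have := Real.sin_pos_of_mem_Ioo hx
  rw [ENNReal.toReal_ofReal (by positivity), smul_eq_mul]; ring

theorem integrable_sinPowLaw_iff (k : ℕ) (f : ℝ → ℝ) :
    Integrable f (sinPowLaw k) ↔
      IntegrableOn (fun x => f x * Real.sin x ^ k) (Set.Ioo 0 Real.pi) := by
  have hk := sinPowIntegral_pos k
  rw [sinPowLaw, integrable_withDensity_iff_integrable_smul' (by fun_prop)
    (Filter.Eventually.of_forall fun x => ENNReal.ofReal_lt_top), IntegrableOn,
    ← integrable_const_mul_iff (isUnit_iff_ne_zero.2 (inv_ne_zero hk.ne'))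
      (fun x => f x * Real.sin x ^ k)]
  refine integrable_congr ?_
  filter_upwards [ae_restrict_mem measurableSet_Ioo] with x hx
  have := Real.sin_pos_of_mem_Ioo hx
  rw [ENNReal.toReal_ofReal (by positivity), smul_eq_mul]; ring

theorem setIntegral_sin_pow (k : ℕ) :
    ∫ x in Set.Ioo 0 Real.pi, Real.sin x ^ k = sinPowIntegral k := by
  rw [sinPowIntegral, intervalIntegral.integral_of_le Real.pi_pos.le, integral_Ioc_eq_integral_Ioo]

theorem integrableOn_Ioo_of_continuous {f : ℝ → ℝ} (hf : Continuous f) :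
    IntegrableOn f (Set.Ioo 0 Real.pi) :=
  (hf.continuousOn.integrableOn_Icc (μ := volume)).mono_set Set.Ioo_subset_Icc_self

instance isProbabilityMeasure_sinPowLaw (k : ℕ) : IsProbabilityMeasure (sinPowLaw k) := by
  have hk := sinPowIntegral_pos k
  refine ⟨?_⟩
  rw [sinPowLaw, withDensity_apply _ MeasurableSet.univ, Measure.restrict_univ,
    ← ofReal_integral_eq_lintegral_ofReal
      ((integrableOn_Ioo_of_continuous (by fun_prop)).const_mul _),
    integral_const_mul, setIntegral_sin_pow, inv_mul_cancel₀ hk.ne', ENNReal.ofReal_one]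
  filter_upwards [ae_restrict_mem measurableSet_Ioo] with x hx
  have := Real.sin_pos_of_mem_Ioo hx
  simp only [Pi.zero_apply]
  positivity

theorem integral_sin_pow_sinPowLaw (k j : ℕ) :
    ∫ x, Real.sin x ^ j ∂(sinPowLaw k) = sinPowIntegral (k + j) / sinPowIntegral k := by
  rw [integral_sinPowLaw, ← setIntegral_sin_pow (k + j), div_eq_inv_mul]
  simp only [← pow_add, add_comm j k]

theorem ae_sinPowLaw_mem (k : ℕ) : ∀ᵐ x ∂(sinPowLaw k), x ∈ Set.Ioo 0 Real.pi :=
  (withDensity_absolutelyContinuous _ _).ae_le (ae_restrict_mem measurableSet_Ioo)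

theorem integrable_sin_pow_sinPowLaw (k j : ℕ) :
    Integrable (fun x => Real.sin x ^ j) (sinPowLaw k) :=
  (integrable_sinPowLaw_iff k _).2 (integrableOn_Ioo_of_continuous (by fun_prop))

theorem integral_sin_sq_sinPowLaw (k : ℕ) :
    ∫ x, Real.sin x ^ 2 ∂(sinPowLaw k) = (k + 1) / (k + 2) := by
  have hk := sinPowIntegral_pos k
  rw [integral_sin_pow_sinPowLaw, sinPowIntegral_add_two]
  field_simp

theorem integral_sin_pow_four_sinPowLaw (k : ℕ) :
    ∫ x, Real.sin x ^ 4 ∂(sinPowLaw k) = (k + 1) * (k + 3) / ((k + 2) * (k + 4)) := by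
  have hk := sinPowIntegral_pos k
  rw [integral_sin_pow_sinPowLaw, show k + 4 = k + 2 + 2 by ring, sinPowIntegral_add_two,
    sinPowIntegral_add_two]
  push_cast
  have h1 : (k : ℝ) + 2 + 2 = k + 4 := by ring
  have h2 : (k : ℝ) + 2 + 1 = k + 3 := by ring
  rw [h1, h2]
  field_simp

/-- Using `-log t ≤ (1 - t) / t` at the cube root `t` of `s` makes the cube cost a single factor `1
/ s`, which one power of the sine weight absorbs. The factor `(1 - s ^ 2) ^ 3` is kept because it
produces the decay in `k`. -/
theorem abs_log_cube_le {s : ℝ} (h0 : 0 < s) (h1 : s ≤ 1) :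
    |2 * Real.log s| ^ 3 ≤ 216 * (1 - s ^ 2) ^ 3 / s := by
  set t := s ^ (1 / 3 : ℝ) with ht
  have ht0 : 0 < t := Real.rpow_pos_of_pos h0 _
  have hts : t ^ 3 = s := by
    rw [ht, ← Real.rpow_natCast, ← Real.rpow_mul h0.le]; norm_num
  have ht1 : t ≤ 1 := Real.rpow_le_one h0.le h1 (by norm_num)
  have hlog : Real.log s = 3 * Real.log t := by rw [← hts, Real.log_pow]; norm_num
  have h2 : -Real.log t ≤ (1 - t) / t := by
    have := Real.one_sub_inv_le_log_of_pos ht0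
    rw [sub_div, div_self ht0.ne']
    rw [one_div]; linarith
  have h3 : 1 - t ≤ 1 - s ^ 2 := by
    rw [← hts]
    have : t ^ 6 ≤ t := by
      calc t ^ 6 ≤ t ^ 1 := pow_le_pow_of_le_one ht0.le ht1 (by norm_num)
        _ = t := pow_one t
    nlinarith
  have h4 : |2 * Real.log s| ≤ 6 * (1 - s ^ 2) / t := by
    have : Real.log s ≤ 0 := Real.log_nonpos h0.le h1
    rw [abs_of_nonpos (by linarith), hlog]
    calc -(2 * (3 * Real.log t)) = 6 * -Real.log t := by ring
      _ ≤ 6 * ((1 - t) / t) := by linarith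
      _ = 6 * (1 - t) / t := by ring
      _ ≤ _ := by gcongr
  calc |2 * Real.log s| ^ 3 ≤ (6 * (1 - s ^ 2) / t) ^ 3 := pow_le_pow_left₀ (abs_nonneg _) h4 3
    _ = 216 * (1 - s ^ 2) ^ 3 / s := by rw [div_pow, hts]; ring

theorem third_moment_log_sin_succ (k : ℕ) :
    Integrable (fun x => |2 * Real.log (Real.sin x)| ^ 3) (sinPowLaw (k + 1)) ∧
    ∫ x, |2 * Real.log (Real.sin x)| ^ 3 ∂(sinPowLaw (k + 1)) ≤ 6480 / (k + 2 : ℝ) ^ 3 := by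
  have hW := sinPowIntegral_pos (k + 1)
  have hpt : ∀ x ∈ Set.Ioo 0 Real.pi, |2 * Real.log (Real.sin x)| ^ 3 * Real.sin x ^ (k + 1) ≤
      216 * (Real.sin x ^ k - 3 * Real.sin x ^ (k + 2) + 3 * Real.sin x ^ (k + 4) -
        Real.sin x ^ (k + 6)) := by
    intro x hx
    have h0 := Real.sin_pos_of_mem_Ioo hx
    calc _ ≤ 216 * (1 - Real.sin x ^ 2) ^ 3 / Real.sin x * Real.sin x ^ (k + 1) := by
          gcongr; exact abs_log_cube_le h0 (Real.sin_le_one x)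
      _ = _ := by rw [pow_succ]; field_simp; ring
  have hci : ∀ j, IntegrableOn (fun x => Real.sin x ^ j) (Set.Ioo 0 Real.pi) := fun j =>
    integrableOn_Ioo_of_continuous (by fun_prop)
  have hci' : IntegrableOn (fun x => 216 * (Real.sin x ^ k - 3 * Real.sin x ^ (k + 2) +
      3 * Real.sin x ^ (k + 4) - Real.sin x ^ (k + 6))) (Set.Ioo 0 Real.pi) :=
    integrableOn_Ioo_of_continuous (by fun_prop)
  have hI : IntegrableOn (fun x => |2 * Real.log (Real.sin x)| ^ 3 * Real.sin x ^ (k + 1))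
      (Set.Ioo 0 Real.pi) := by
    refine Integrable.mono' hci' (Measurable.aestronglyMeasurable (by fun_prop)) ?_
    filter_upwards [ae_restrict_mem measurableSet_Ioo] with x hx
    have h0 := Real.sin_pos_of_mem_Ioo hx
    rw [Real.norm_eq_abs, abs_of_nonneg (by positivity)]
    exact hpt x hx
  refine ⟨(integrable_sinPowLaw_iff _ _).2 hI, ?_⟩
  rw [integral_sinPowLaw]
  have h1 := setIntegral_mono_on hI hci' measurableSet_Ioo hpt
  -- The alternating sum is the integral of `cos ^ 6 * sin ^ k`, evaluated by the recursion. Later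
  -- `216 * 15 * 2 = 6480`.
  have h2 : ∫ x in Set.Ioo 0 Real.pi, 216 * (Real.sin x ^ k - 3 * Real.sin x ^ (k + 2) +
      3 * Real.sin x ^ (k + 4) - Real.sin x ^ (k + 6)) =
      216 * (15 / ((k + 2) * (k + 4) * (k + 6)) * sinPowIntegral k) := by
    rw [integral_const_mul, integral_sub, integral_add, integral_sub, integral_const_mul,
      integral_const_mul, setIntegral_sin_pow, setIntegral_sin_pow, setIntegral_sin_pow,
      setIntegral_sin_pow, show k + 6 = k + 2 + 2 + 2 by ring, show k + 4 = k + 2 + 2 by ring,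
      sinPowIntegral_add_two (k + 2 + 2), sinPowIntegral_add_two (k + 2),
      sinPowIntegral_add_two k]
    · push_cast
      field_simp
      ring
    · exact hci _
    · exact (hci _).const_mul _
    · exact (hci _).sub ((hci _).const_mul _)
    · exact (hci _).const_mul _
    · exact ((hci _).sub ((hci _).const_mul _)).add ((hci _).const_mul _)
    · exact hci _
  rw [h2] at h1
  have h3 := sinPowIntegral_le_two_mul k
  rw [inv_mul_le_iff₀ hW]
  refine h1.trans ?_
  have h4 : 15 / ((k + 2 : ℝ) * (k + 4) * (k + 6)) ≤ 15 / (k + 2 : ℝ) ^ 3 := by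
    have hk : (0 : ℝ) ≤ k := Nat.cast_nonneg k
    apply div_le_div_of_nonneg_left (by norm_num) (by positivity)
    nlinarith [mul_nonneg hk hk]
  calc 216 * (15 / ((k + 2 : ℝ) * (k + 4) * (k + 6)) * sinPowIntegral k)
      ≤ 216 * (15 / (k + 2 : ℝ) ^ 3 * (2 * sinPowIntegral (k + 1))) := by
        have := sinPowIntegral_pos k
        gcongr
    _ = _ := by ring

/-- With no sine weight to spare, the logarithm is bounded by `sin ^ (-1/6)`, so its cube by `sin ^
(-1/2)`. Jordan's inequality compares the sine with the distance to the nearer endpoint, where this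
power is integrable. -/
theorem integrable_log_sin_cube_zero :
    Integrable (fun x => |2 * Real.log (Real.sin x)| ^ 3) (sinPowLaw 0) := by
  rw [integrable_sinPowLaw_iff]
  simp only [pow_zero, mul_one]
  have hr : IntervalIntegrable (fun x : ℝ => x ^ (-(1 / 2) : ℝ)) volume 0 Real.pi :=
    intervalIntegral.intervalIntegrable_rpow' (by norm_num)
  have hr1 : IntegrableOn (fun x : ℝ => x ^ (-(1 / 2) : ℝ)) (Set.Ioo 0 Real.pi) :=
    ((intervalIntegrable_iff_integrableOn_Ioo_of_le Real.pi_pos.le).1 hr)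
  have hr2 : IntegrableOn (fun x : ℝ => (Real.pi - x) ^ (-(1 / 2) : ℝ)) (Set.Ioo 0 Real.pi) := by
    have := (hr.comp_sub_left Real.pi).symm
    simp only [sub_self, sub_zero] at this
    exact (intervalIntegrable_iff_integrableOn_Ioo_of_le Real.pi_pos.le).1 this
  refine Integrable.mono' ((hr1.add hr2).const_mul (1728 * (2 / Real.pi) ^ (-(1 / 2) : ℝ)))
    (Measurable.aestronglyMeasurable (by fun_prop)) ?_
  filter_upwards [ae_restrict_mem measurableSet_Ioo] with x hx
  have h0 := Real.sin_pos_of_mem_Ioo hx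
  rw [Real.norm_eq_abs, abs_of_nonneg (by positivity)]
  have hlog : |2 * Real.log (Real.sin x)| ^ 3 ≤ 1728 * Real.sin x ^ (-(1 / 2) : ℝ) := by
    set s := Real.sin x with hs
    set t := s ^ (-(1 / 6) : ℝ) with ht
    have ht0 : 0 < t := Real.rpow_pos_of_pos h0 _
    have ht3 : t ^ 3 = s ^ (-(1 / 2) : ℝ) := by
      rw [ht, ← Real.rpow_natCast, ← Real.rpow_mul h0.le]; norm_num
    have hlt : Real.log t = -(1 / 6) * Real.log s := Real.log_rpow h0 _
    have h1 := Real.log_le_sub_one_of_pos ht0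
    have h2 : |2 * Real.log s| ≤ 12 * t := by
      have : Real.log s ≤ 0 := Real.log_nonpos h0.le (Real.sin_le_one x)
      rw [abs_of_nonpos (by linarith)]
      linarith
    calc _ ≤ (12 * t) ^ 3 := pow_le_pow_left₀ (abs_nonneg _) h2 3
      _ = _ := by rw [mul_pow, ht3]; norm_num
  refine hlog.trans ?_
  rw [mul_assoc]
  refine mul_le_mul_of_nonneg_left ?_ (by norm_num)
  simp only [Pi.add_apply]
  have hp := Real.pi_pos
  have hpx : 0 < Real.pi - x := by linarith [hx.2]
  have hx0 : 0 < x := hx.1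
  have key : ∀ y : ℝ, 0 < y → 2 / Real.pi * y ≤ Real.sin x →
      Real.sin x ^ (-(1 / 2) : ℝ) ≤ (2 / Real.pi) ^ (-(1 / 2) : ℝ) * y ^ (-(1 / 2) : ℝ) := by
    intro y hy h
    rw [← Real.mul_rpow (by positivity) hy.le]
    exact Real.rpow_le_rpow_of_nonpos (by positivity) h (by norm_num)
  rw [mul_add]
  rcases le_total x (Real.pi / 2) with h | h
  · refine (key x hx.1 (Real.mul_le_sin hx.1.le h)).trans (le_add_of_nonneg_right ?_)
    positivity
  · refine (key (Real.pi - x) hpx ?_).trans (le_add_of_nonneg_left ?_)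
    · rw [← Real.sin_pi_sub]
      exact Real.mul_le_sin hpx.le (by linarith)
    · positivity

theorem exists_third_moment_log_sin : ∃ K : ℝ, 1 ≤ K ∧ ∀ k : ℕ,
    Integrable (fun x => |2 * Real.log (Real.sin x)| ^ 3) (sinPowLaw k) ∧
    ∫ x, |2 * Real.log (Real.sin x)| ^ 3 ∂(sinPowLaw k) ≤ K / (k + 1 : ℝ) ^ 3 := by
  refine ⟨max 6480 (∫ x, |2 * Real.log (Real.sin x)| ^ 3 ∂(sinPowLaw 0)),
    le_max_of_le_left (by norm_num), fun k => ?_⟩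
  cases k with
  | zero => exact ⟨integrable_log_sin_cube_zero, by simp⟩
  | succ k =>
    obtain ⟨h1, h2⟩ := third_moment_log_sin_succ k
    refine ⟨h1, h2.trans ?_⟩
    push_cast
    rw [show (k : ℝ) + 1 + 1 = k + 2 by ring]
    gcongr
    exact le_max_left _ _

/-- The law of `2 log sin φ`, where `φ` has density proportional to `sin ^ k` on `(0, π)`. -/
noncomputable def logSinLaw (k : ℕ) : Measure ℝ :=
  (sinPowLaw k).map fun x => 2 * Real.log (Real.sin x)

theorem measurable_two_mul_log_sin : Measurable fun x : ℝ => 2 * Real.log (Real.sin x) := by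
  fun_prop

instance isProbabilityMeasure_logSinLaw (k : ℕ) : IsProbabilityMeasure (logSinLaw k) :=
  Measure.isProbabilityMeasure_map measurable_two_mul_log_sin.aemeasurable

/-- The difference of the two weighted integrands is the derivative of `U`, a multiple of `cos * sin
^ (k + 1) * F`, which vanishes at both endpoints. -/
theorem integral_by_parts_log_sin (k : ℕ) (c : ℝ) {F F' : ℝ → ℝ}
    (hF : ∀ x, HasDerivAt F (F' x) x) (hF' : Continuous F') {B B' : ℝ} (hB : ∀ x, |F x| ≤ B)
    (hB' : ∀ x, |F' x| ≤ B') :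
    ∫ x, (Real.sin x ^ 2 * (1 + 1 / (k + 1 : ℝ)) - 1) * F (2 * Real.log (Real.sin x) - c)
        ∂(sinPowLaw k) =
      ∫ x, 2 / (k + 1 : ℝ) * (1 - Real.sin x ^ 2) * F' (2 * Real.log (Real.sin x) - c)
        ∂(sinPowLaw k) := by
  have hFc : Continuous F := continuous_iff_continuousAt.2 fun x => (hF x).continuousAt
  have hm : (0 : ℝ) < k + 1 := by positivity
  set U : ℝ → ℝ := fun x =>
    -(1 / (k + 1 : ℝ)) * (Real.cos x * Real.sin x ^ (k + 1)) *
      F (2 * Real.log (Real.sin x) - c) with hU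
  set u : ℝ → ℝ := fun x =>
    (Real.sin x ^ 2 * (1 + 1 / (k + 1 : ℝ)) - 1) * F (2 * Real.log (Real.sin x) - c) *
        Real.sin x ^ k -
      2 / (k + 1 : ℝ) * (1 - Real.sin x ^ 2) * F' (2 * Real.log (Real.sin x) - c) *
        Real.sin x ^ k with hu
  have hderiv : ∀ x ∈ Set.Ioo 0 Real.pi, HasDerivAt U (u x) x := by
    intro x hx
    have hs := Real.sin_pos_of_mem_Ioo hx
    have h1 : HasDerivAt (fun x => 2 * Real.log (Real.sin x) - c)
        (2 * (Real.cos x / Real.sin x)) x :=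
      (((Real.hasDerivAt_sin x).log hs.ne').const_mul 2).sub_const c
    have h2 : HasDerivAt (fun x => F (2 * Real.log (Real.sin x) - c))
        (F' (2 * Real.log (Real.sin x) - c) * (2 * (Real.cos x / Real.sin x))) x :=
      (hF _).comp x h1
    have h3 : HasDerivAt (fun x => Real.cos x * Real.sin x ^ (k + 1))
        (-Real.sin x * Real.sin x ^ (k + 1) +
          Real.cos x * (((k + 1 : ℕ) : ℝ) * Real.sin x ^ k * Real.cos x)) x :=
      (Real.hasDerivAt_cos x).mul ((Real.hasDerivAt_sin x).pow (k + 1))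
    refine ((h3.const_mul (-(1 / (k + 1 : ℝ)))).mul h2).congr_deriv ?_
    have hc : Real.cos x ^ 2 = 1 - Real.sin x ^ 2 := by
      rw [← Real.sin_sq_add_cos_sq x]; ring
    simp only [hu]
    push_cast
    rw [pow_succ]
    field_simp
    generalize F (2 * Real.log (Real.sin x) - c) = f
    generalize F' (2 * Real.log (Real.sin x) - c) = f'
    linear_combination (-(k + 1 : ℝ) * f - 2 * f') * hc
  -- At the endpoints `log (sin x)` tends to `-∞` while `Real.log 0 = 0`, so the `F` factor may
  -- jump; since `F` is bounded, the factor `sin ^ (k + 1)` forces `U` to `0`.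
  have hcont : ContinuousOn U (Set.Icc 0 Real.pi) := by
    intro x hx
    rcases eq_or_ne (Real.sin x) 0 with h | h
    · have hU0 : U x = 0 := by simp [hU, h]
      rw [ContinuousWithinAt, hU0]
      refine Filter.Tendsto.mono_left ?_ nhdsWithin_le_nhds
      have hlim : Filter.Tendsto (fun x => 1 / (k + 1 : ℝ) * |Real.sin x| ^ (k + 1) * B)
          (nhds x) (nhds 0) := by
        have : Continuous fun x => 1 / (k + 1 : ℝ) * |Real.sin x| ^ (k + 1) * B := by fun_prop
        have h2 := this.tendsto x
        simpa [h] using h2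
      refine squeeze_zero_norm (fun y => ?_) hlim
      simp only [hU]
      rw [norm_mul, norm_mul, norm_mul, norm_neg, Real.norm_of_nonneg (by positivity),
        Real.norm_eq_abs, Real.norm_eq_abs, Real.norm_eq_abs, abs_pow]
      have h1 : |Real.cos y| * |Real.sin y| ^ (k + 1) ≤ |Real.sin y| ^ (k + 1) :=
        mul_le_of_le_one_left (by positivity) (Real.abs_cos_le_one y)
      have h2 := hB (2 * Real.log (Real.sin y) - c)
      gcongr
    · refine ContinuousAt.continuousWithinAt ?_
      simp only [hU]
      have : ContinuousAt (fun x => Real.log (Real.sin x)) x :=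
        (Real.continuousAt_log h).comp Real.continuous_sin.continuousAt
      have h2 : ContinuousAt (fun x => F (2 * Real.log (Real.sin x) - c)) x :=
        hFc.continuousAt.comp ((this.const_mul 2).sub continuousAt_const)
      exact ContinuousAt.mul (by fun_prop) h2
  have hbdd : ∀ φ G : ℝ → ℝ, Continuous φ → Continuous G → (∃ C, ∀ x, |G x| ≤ C) →
      IntegrableOn (fun x => φ x * G (2 * Real.log (Real.sin x) - c) * Real.sin x ^ k)
        (Set.Ioo 0 Real.pi) := by
    rintro φ G hφ hG ⟨C, hC⟩
    have h1 : IntegrableOn (fun x => φ x * Real.sin x ^ k) (Set.Ioo 0 Real.pi) :=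
      integrableOn_Ioo_of_continuous (by fun_prop)
    have h2 := h1.mul_bdd (c := C) (g := fun x => G (2 * Real.log (Real.sin x) - c))
      (Measurable.aestronglyMeasurable (by fun_prop)) (Filter.Eventually.of_forall fun x => hC _)
    refine h2.congr (Filter.Eventually.of_forall fun x => ?_)
    simp only; ring
  have i1 := hbdd (fun x => Real.sin x ^ 2 * (1 + 1 / (k + 1 : ℝ)) - 1) F (by fun_prop) hFc
    ⟨B, hB⟩
  have i2 := hbdd (fun x => 2 / (k + 1 : ℝ) * (1 - Real.sin x ^ 2)) F' (by fun_prop) hF'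
    ⟨B', hB'⟩
  rw [integral_sinPowLaw, integral_sinPowLaw]
  congr 1
  rw [← sub_eq_zero, ← integral_sub i1 i2]
  have hui : IntervalIntegrable u volume 0 Real.pi :=
    (intervalIntegrable_iff_integrableOn_Ioo_of_le Real.pi_pos.le).2 (i1.sub i2)
  have := intervalIntegral.integral_eq_sub_of_hasDerivAt_of_le Real.pi_pos.le hcont hderiv hui
  rw [intervalIntegral.integral_of_le Real.pi_pos.le, integral_Ioc_eq_integral_Ioo] at this
  rw [this]
  simp [hU]

set_option maxHeartbeats 1000000 in
-- With `m = k + 1`, the third moment bound gives the defect and the upper variance bound, and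
-- explicit second and fourth moments of the sine give everything else. The weights are `η = (2 / m)
-- cos ^ 2` and `ψ = (1 + 1 / m) sin ^ 2 - 1`, read as functions of the centred variable.
theorem exists_steinRegular_logSin : ∃ κ : ℝ, 1 ≤ κ ∧ ∀ k : ℕ,
    MemLp (fun x : ℝ => x) 2 (logSinLaw k) ∧
    SteinRegular κ (1 / (k + 1 : ℝ) ^ 2) (κ / (k + 1 : ℝ) ^ 3)
      ((logSinLaw k).map fun x => x - ∫ y, y ∂(logSinLaw k)) := by
  obtain ⟨K, hK, hK3⟩ := exists_third_moment_log_sin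
  refine ⟨16 * K + 8, by linarith, fun k => ?_⟩
  obtain ⟨hi3, hle3⟩ := hK3 k
  set Q := sinPowLaw k with hQ
  set X : ℝ → ℝ := fun x => 2 * Real.log (Real.sin x) with hX
  have hXm : Measurable X := measurable_two_mul_log_sin
  set c := ∫ y, y ∂(logSinLaw k) with hc
  have hcX : c = ∫ x, X x ∂Q :=
    integral_map hXm.aemeasurable measurable_id.aestronglyMeasurable
  have hYm : Measurable fun x => X x - c := by fun_prop
  have hmap : (logSinLaw k).map (fun x => x - c) = Q.map fun x => X x - c := by
    rw [logSinLaw, Measure.map_map (by fun_prop) hXm]; rfl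
  have hmemX : MemLp (fun x : ℝ => x) 2 (logSinLaw k) :=
    (memLp_map_measure_iff measurable_id.aestronglyMeasurable hXm.aemeasurable).2
      (integrable_pow_of_integrable_abs_cube hXm.aestronglyMeasurable hi3).2
  refine ⟨hmemX, ?_⟩
  rw [hmap]
  have hm : (0 : ℝ) < k + 1 := by positivity
  set m : ℝ := k + 1 with hmdef
  have hm1 : 1 ≤ m := by rw [hmdef]; linarith [(Nat.cast_nonneg k : (0 : ℝ) ≤ k)]
  obtain ⟨hXi, hX2⟩ := integrable_pow_of_integrable_abs_cube hXm.aestronglyMeasurable hi3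
  obtain ⟨hY3, hY3le⟩ := integral_abs_sub_integral_cube_le hXm.aestronglyMeasurable hi3
  rw [← hcX] at hY3 hY3le
  have hYprob : IsProbabilityMeasure (Q.map fun x => X x - c) :=
    Measure.isProbabilityMeasure_map hYm.aemeasurable
  have hint : ∀ f : ℝ → ℝ, Measurable f →
      ∫ x, f x ∂(Q.map fun x => X x - c) = ∫ x, f (X x - c) ∂Q := fun f hf =>
    integral_map hYm.aemeasurable hf.aestronglyMeasurable
  clear_value c m
  have s2 : ∫ x, Real.sin x ^ 2 ∂Q = m / (m + 1) := by
    rw [hQ, integral_sin_sq_sinPowLaw, hmdef]; ring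
  have s4 : ∫ x, Real.sin x ^ 4 ∂Q = m * (m + 2) / ((m + 1) * (m + 3)) := by
    rw [hQ, integral_sin_pow_four_sinPowLaw, hmdef]; ring
  have is2 : Integrable (fun x => Real.sin x ^ 2) Q := integrable_sin_pow_sinPowLaw k 2
  have is4 : Integrable (fun x => Real.sin x ^ 4) Q := integrable_sin_pow_sinPowLaw k 4
  have hquad : ∀ a b d : ℝ, ∫ x, (a * Real.sin x ^ 4 + b * Real.sin x ^ 2 + d) ∂Q =
      a * (m * (m + 2) / ((m + 1) * (m + 3))) + b * (m / (m + 1)) + d := by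
    intro a b d
    have h : Integrable (fun x => a * Real.sin x ^ 4 + b * Real.sin x ^ 2) Q :=
      (is4.const_mul a).add (is2.const_mul b)
    rw [integral_add h (integrable_const d),
      integral_add (is4.const_mul a) (is2.const_mul b), integral_const_mul, integral_const_mul,
      s2, s4]
    simp
  have hae := ae_sinPowLaw_mem k
  have hXneg : ∀ x ∈ Set.Ioo 0 Real.pi, X x ≤ 0 := fun x hx => by
    have := Real.log_nonpos (Real.sin_pos_of_mem_Ioo hx).le (Real.sin_le_one x)
    simp only [hX]; linarith
  have hc0 : c ≤ 0 := by
    rw [hcX]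
    exact integral_nonpos_of_ae (by filter_upwards [hae] with x hx using hXneg x hx)
  have hexp : ∀ x ∈ Set.Ioo 0 Real.pi, Real.exp (X x - c + c) = Real.sin x ^ 2 := fun x hx => by
    have h0 := Real.sin_pos_of_mem_Ioo hx
    rw [sub_add_cancel, hX, ← Real.exp_log (pow_pos h0 2), Real.log_pow]; norm_num
  -- variance bounds
  have hvar : ∫ x, x ^ 2 ∂(Q.map fun x => X x - c) = ∫ x, (X x - c) ^ 2 ∂Q :=
    hint _ (by fun_prop)
  have hY2i : Integrable (fun x => (X x - c) ^ 2) Q := (hX2.sub (memLp_const c)).integrable_sq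
  have hvle : ∫ x, (X x - c) ^ 2 ∂Q ≤ (1 + K) * (1 / m ^ 2) := by
    have h1 : ∫ x, (X x - c) ^ 2 ∂Q ≤ ∫ x, X x ^ 2 ∂Q := by
      have h2 := variance_le_expectation_sq (μ := Q) hXm.aestronglyMeasurable
      rw [variance_eq_integral hXm.aemeasurable, ← hcX] at h2
      exact h2
    refine h1.trans ?_
    have h2 : ∫ x, X x ^ 2 ∂Q ≤ ∫ x, (1 / m ^ 2 + m * |X x| ^ 3) ∂Q := by
      refine integral_mono hX2.integrable_sq ((integrable_const _).add (hi3.const_mul m))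
        fun x => ?_
      -- Scaling by `m` before comparing the square with the cube gives the order `1 / m ^ 2`.
      have h3 : (m * |X x|) ^ 2 ≤ 1 + (m * |X x|) ^ 3 := by
        have h0 : 0 ≤ m * |X x| := by positivity
        rcases le_total (m * |X x|) 1 with h | h
        · nlinarith [pow_nonneg h0 3]
        · nlinarith [sq_nonneg (m * |X x|)]
      simp only
      rw [← sq_abs, div_add' _ _ _ (by positivity), le_div_iff₀ (by positivity)]
      nlinarith
    refine h2.trans ?_
    rw [integral_add (integrable_const _) (hi3.const_mul m), integral_const_mul, integral_const,
      probReal_univ, one_smul]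
    have h4 : m * ∫ x, |X x| ^ 3 ∂Q ≤ m * (K / m ^ 3) := by gcongr
    have h5 : m * (K / m ^ 3) = K * (1 / m ^ 2) := by field_simp
    linarith
  have hvge : 1 / m ^ 2 ≤ 8 * ∫ x, (X x - c) ^ 2 ∂Q := by
    have h1 : ∫ x, (1 * Real.sin x ^ 4 + (-2 * Real.exp c) * Real.sin x ^ 2 + Real.exp c ^ 2) ∂Q ≤
        ∫ x, (X x - c) ^ 2 ∂Q := by
      refine integral_mono_ae (((is4.const_mul _).add (is2.const_mul _)).add (integrable_const _))
        hY2i ?_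
      filter_upwards [hae] with x hx
      -- The exponential is a contraction on `(-∞, 0]`, where `X` and its mean lie. Hence the
      -- variance of `X` is at least that of `sin ^ 2`, which is explicit.
      have h2 : |Real.exp (X x) - Real.exp c| ≤ |X x - c| := by
        have : ∀ u v : ℝ, u ≤ v → v ≤ 0 → |Real.exp u - Real.exp v| ≤ |u - v| := by
          intro u v huv hv
          rw [abs_sub_comm, abs_sub_comm u v, abs_of_nonneg (sub_nonneg.2 (Real.exp_le_exp.2 huv)),
            abs_of_nonneg (sub_nonneg.2 huv)]
          have h3 : Real.exp v - Real.exp u = Real.exp v * (1 - Real.exp (u - v)) := by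
            rw [mul_sub, ← Real.exp_add]; ring_nf
          rw [h3]
          have h4 := Real.add_one_le_exp (u - v)
          have h5 := Real.exp_le_one_iff.2 hv
          have h6 := Real.exp_pos v
          nlinarith
        rcases le_total (X x) c with h | h
        · exact this _ _ h hc0
        · rw [abs_sub_comm, abs_sub_comm (X x)]; exact this _ _ h (hXneg x hx)
      have h3 := hexp x hx
      rw [sub_add_cancel] at h3
      rw [h3] at h2
      have h4 := sq_le_sq.2 h2
      nlinarith
    rw [hquad] at h1
    set e := Real.exp c
    have h2 : 2 * m / ((m + 1) ^ 2 * (m + 3)) ≤ ∫ x, (X x - c) ^ 2 ∂Q := by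
      refine le_trans ?_ h1
      have : 1 * (m * (m + 2) / ((m + 1) * (m + 3))) + -2 * e * (m / (m + 1)) + e ^ 2 =
          2 * m / ((m + 1) ^ 2 * (m + 3)) + (e - m / (m + 1)) ^ 2 := by
        field_simp; ring
      rw [this]; nlinarith [sq_nonneg (e - m / (m + 1))]
    have h3 : 1 / m ^ 2 ≤ 8 * (2 * m / ((m + 1) ^ 2 * (m + 3))) := by
      rw [← mul_div_assoc, div_le_div_iff₀ (by positivity) (by positivity)]
      have : (m + 1) ^ 2 * (m + 3) ≤ (2 * m) ^ 2 * (4 * m) := by gcongr <;> linarith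
      nlinarith
    linarith
  have hv0 : 0 ≤ ∫ x, (X x - c) ^ 2 ∂Q := integral_nonneg fun x => sq_nonneg _
  have ha0 : 0 < 1 / m ^ 2 := by positivity
  have hη1 : 0 * (m * (m + 2) / ((m + 1) * (m + 3))) + -(2 / m) * (m / (m + 1)) + 2 / m =
      2 / (m * (m + 1)) := by field_simp; ring
  have hη2 : 4 / m ^ 2 * (m * (m + 2) / ((m + 1) * (m + 3))) + -(8 / m ^ 2) * (m / (m + 1)) +
      4 / m ^ 2 = 12 / (m ^ 2 * ((m + 1) * (m + 3))) := by field_simp; ring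
  have hψ2 : (1 + 1 / m) ^ 2 * (m * (m + 2) / ((m + 1) * (m + 3))) +
      -2 * (1 + 1 / m) * (m / (m + 1)) + 1 = 2 / (m * (m + 3)) := by field_simp; ring
  -- On the support this is `sin ^ 2`; truncating at `1` keeps `η` nonnegative and both weights
  -- bounded on all of `ℝ`.
  set E : ℝ → ℝ := fun x => min 1 (Real.exp (x + c)) with hE
  have hEm : Measurable E := by fun_prop
  have hE01 : ∀ x, 0 ≤ E x ∧ E x ≤ 1 := fun x =>
    ⟨le_min zero_le_one (Real.exp_pos _).le, min_le_left _ _⟩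
  have hEX : ∀ x ∈ Set.Ioo 0 Real.pi, E (X x - c) = Real.sin x ^ 2 := fun x hx => by
    have h0 := Real.sin_pos_of_mem_Ioo hx
    simp only [hE]
    rw [hexp x hx]
    exact min_eq_right (pow_le_one₀ h0.le (Real.sin_le_one x))
  refine ⟨ha0.le, ?_, ?_, ?_, ?_, ?_, ?_⟩
  · rw [hint (fun x => x) measurable_id]
    rw [integral_sub hXi (integrable_const c), hcX]; simp
  · exact (memLp_map_measure_iff measurable_id.aestronglyMeasurable hYm.aemeasurable).2
      (hX2.sub (memLp_const c))
  · rw [hvar]; exact hvle.trans (mul_le_mul_of_nonneg_right (by linarith) ha0.le)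
  · rw [hvar]; exact hvge.trans (mul_le_mul_of_nonneg_right (by linarith) hv0)
  · intro A α β hA hα hβ hAb
    have h3' : Integrable (fun x : ℝ => |x| ^ 3) (Q.map fun x => X x - c) :=
      (integrable_map_measure (Measurable.aestronglyMeasurable (by fun_prop)) hYm.aemeasurable).2
        hY3
    refine (stein_defect_of_third_moment h3' A α β hα hAb).trans ?_
    rw [hvar, hint (fun x => |x| ^ 3) (by fun_prop)]
    have h4 : 2 * ∫ x, |X x - c| ^ 3 ∂Q ≤ (16 * K + 8) / m ^ 3 := by
      calc 2 * ∫ x, |X x - c| ^ 3 ∂Q ≤ 2 * (8 * (K / m ^ 3)) := by linarith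
        _ = 16 * K / m ^ 3 := by ring
        _ ≤ _ := by gcongr; linarith
    have h5 : 2 * ∫ x, (X x - c) ^ 2 ∂Q ≤ (16 * K + 8) * (1 / m ^ 2) := by
      nlinarith
    gcongr
  · refine ⟨fun x => 2 / m * (1 - E x), fun x => E x * (1 + 1 / m) - 1, by fun_prop, by fun_prop,
      fun x => mul_nonneg (by positivity) (by linarith [(hE01 x).2]), ?_, ?_, ?_, ?_, ?_, ?_⟩
    · refine MemLp.of_bound (Measurable.aestronglyMeasurable (by fun_prop)) (2 / m)
        (Filter.Eventually.of_forall fun x => ?_)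
      rw [Real.norm_eq_abs, abs_of_nonneg (mul_nonneg (by positivity) (by linarith [(hE01 x).2]))]
      exact mul_le_of_le_one_right (by positivity) (by linarith [(hE01 x).1])
    · refine MemLp.of_bound (Measurable.aestronglyMeasurable (by fun_prop)) (2 + 1 / m)
        (Filter.Eventually.of_forall fun x => ?_)
      have h1 : 0 ≤ 1 / m := by positivity
      rw [Real.norm_eq_abs, abs_le]
      constructor <;> nlinarith [(hE01 x).1, (hE01 x).2]
    · rw [hint _ (by fun_prop)]
      have h1 : ∫ x, 2 / m * (1 - E (X x - c)) ∂Q =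
          ∫ x, (0 * Real.sin x ^ 4 + (-(2 / m)) * Real.sin x ^ 2 + 2 / m) ∂Q := by
        refine integral_congr_ae ?_
        filter_upwards [hae] with x hx
        rw [hEX x hx]; ring
      rw [h1, hquad, hη1]
      have h3 : 1 / m ^ 2 ≤ 2 / (m * (m + 1)) := by
        rw [div_le_div_iff₀ (by positivity) (by positivity)]; nlinarith
      refine h3.trans (le_mul_of_one_le_left (by positivity) (by linarith))
    · rw [hint _ (by fun_prop)]
      have h1 : ∫ x, (2 / m * (1 - E (X x - c))) ^ 2 ∂Q =
          ∫ x, (4 / m ^ 2 * Real.sin x ^ 4 + (-(8 / m ^ 2)) * Real.sin x ^ 2 + 4 / m ^ 2) ∂Q := by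
        refine integral_congr_ae ?_
        filter_upwards [hae] with x hx
        rw [hEX x hx]; ring
      rw [h1, hquad, hη2]
      have h3 : 12 / (m ^ 2 * ((m + 1) * (m + 3))) ≤ 12 * (1 / m ^ 2) ^ 2 := by
        rw [div_pow, one_pow, mul_one_div]
        apply div_le_div_of_nonneg_left (by norm_num) (by positivity)
        nlinarith [sq_nonneg m]
      refine h3.trans ?_
      gcongr; linarith
    · rw [hint _ (by fun_prop)]
      have h1 : ∫ x, (E (X x - c) * (1 + 1 / m) - 1) ^ 2 ∂Q =
          ∫ x, ((1 + 1 / m) ^ 2 * Real.sin x ^ 4 + (-2 * (1 + 1 / m)) * Real.sin x ^ 2 + 1) ∂Q := by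
        refine integral_congr_ae ?_
        filter_upwards [hae] with x hx
        rw [hEX x hx]; ring
      rw [h1, hquad, hψ2]
      have h3 : 2 / (m * (m + 3)) ≤ 2 * (1 / m ^ 2) := by
        rw [mul_one_div]
        apply div_le_div_of_nonneg_left (by norm_num) (by positivity)
        nlinarith
      refine h3.trans ?_
      gcongr; linarith
    · rintro F F' hF hF' ⟨B, hB⟩ ⟨B', hB'⟩
      have hFc : Continuous F := continuous_iff_continuousAt.2 fun x => (hF x).continuousAt
      rw [hint _ (by fun_prop), hint _ (by fun_prop)]
      have := integral_by_parts_log_sin k c hF hF' hB hB'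
      refine Eq.trans (integral_congr_ae ?_) (this.trans (integral_congr_ae ?_))
      · filter_upwards [hae] with x hx
        rw [hEX x hx, hmdef]
      · filter_upwards [hae] with x hx
        rw [hEX x hx, hmdef]

/-! ### Laws close to the Gaussian -/

/-- The standard Gaussian density. -/
noncomputable def stdGaussianDensity (u : ℝ) : ℝ := Real.exp (-u ^ 2 / 2) / √(2 * Real.pi)

theorem continuous_stdGaussianDensity : Continuous stdGaussianDensity := by
  unfold stdGaussianDensity
  fun_prop

theorem stdGaussianDensity_pos (u : ℝ) : 0 < stdGaussianDensity u :=
  div_pos (Real.exp_pos _) sqrt_two_pi_pos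

theorem integrable_abs_pow_mul_stdGaussianDensity (j : ℕ) :
    Integrable fun u => |u| ^ j * stdGaussianDensity u := by
  have h := (integrable_rpow_mul_exp_neg_mul_sq (b := 1 / 2) (by norm_num) (s := (j : ℝ))
    (by have : (0 : ℝ) ≤ j := Nat.cast_nonneg j
        linarith)).norm
  refine (h.div_const (√(2 * Real.pi))).congr (Filter.Eventually.of_forall fun u => ?_)
  simp only [stdGaussianDensity]
  rw [norm_mul, Real.rpow_natCast, norm_pow, Real.norm_eq_abs, Real.norm_eq_abs, Real.abs_exp,
    mul_div_assoc]
  congr 3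
  ring

theorem integrable_stdGaussianDensity : Integrable stdGaussianDensity := by
  simpa using integrable_abs_pow_mul_stdGaussianDensity 0

theorem integral_stdGaussianDensity : ∫ u, stdGaussianDensity u = 1 := by
  unfold stdGaussianDensity
  rw [integral_div, integral_exp_neg_sq_half, div_self sqrt_two_pi_pos.ne']

theorem integral_Ioi_mul_stdGaussianDensity (t : ℝ) :
    ∫ u in Set.Ioi t, u * stdGaussianDensity u = stdGaussianDensity t := by
  have := (integral_Ioi_mul_exp_neg_sq_half t).2
  unfold stdGaussianDensity
  rw [← this, ← integral_div]
  congr 1; ext u; ring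

theorem integral_Iic_neg_mul_stdGaussianDensity (t : ℝ) :
    ∫ u in Set.Iic t, -u * stdGaussianDensity u = stdGaussianDensity t := by
  have h := integral_comp_neg_Iic t fun u => u * stdGaussianDensity u
  have he : ∀ u, stdGaussianDensity (-u) = stdGaussianDensity u := fun u => by
    simp [stdGaussianDensity]
  simp only [he] at h
  rw [h, integral_Ioi_mul_stdGaussianDensity, he]

theorem abs_le_one_add_cube (u : ℝ) : |u| ≤ 1 + |u| ^ 3 := by
  have := abs_nonneg u
  rcases le_total |u| 1 with h | h
  · nlinarith [pow_nonneg this 3]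
  · nlinarith [mul_nonneg this (sq_nonneg (|u| - 1)), sq_nonneg (|u|)]

theorem sq_le_one_add_cube (u : ℝ) : u ^ 2 ≤ 1 + |u| ^ 3 := by
  have := abs_nonneg u
  rw [← sq_abs]
  rcases le_total |u| 1 with h | h
  · nlinarith [pow_nonneg this 3]
  · nlinarith [mul_nonneg this (sq_nonneg (|u| - 1)), sq_nonneg (|u|)]

theorem abs_primitive_le {A : ℝ → ℝ} {α β : ℝ} (hα : 0 ≤ α) (hA : ∀ t, |A t| ≤ α * |t| + β)
    (u : ℝ) : |∫ t in (0 : ℝ)..u, A t| ≤ α * u ^ 2 + β * |u| := by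
  have hle : ‖∫ t in (0 : ℝ)..u, A t‖ ≤ (α * |u| + β) * |u - 0| := by
    refine intervalIntegral.norm_integral_le_of_norm_le_const fun t ht =>
      (Real.norm_eq_abs (A t)).trans_le ((hA t).trans ?_)
    have : |t| ≤ |u| := by
      rcases Set.mem_uIoc.1 ht with h | h
      · rw [abs_of_pos h.1]; exact h.2.trans (le_abs_self u)
      · rw [abs_of_nonpos h.2]; exact (neg_le_neg h.1.le).trans (neg_le_abs u)
    gcongr
  rw [sub_zero, Real.norm_eq_abs] at hle
  refine hle.trans_eq ?_
  rw [← sq_abs u]; ring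

theorem intervalIntegrable_of_linear_growth {A : ℝ → ℝ} (hAm : Measurable A) {α β : ℝ}
    (hA : ∀ t, |A t| ≤ α * |t| + β) (a b : ℝ) : IntervalIntegrable A volume a b := by
  have : Continuous fun t : ℝ => α * |t| + β := by fun_prop
  exact (this.intervalIntegrable a b).mono_fun' hAm.aestronglyMeasurable
    (Filter.Eventually.of_forall hA)

/-- Fubini in place of integration by parts, so that `A` need only be measurable: swapping the order
leaves `∫ |u| φ(u)` over the `u` beyond `t`, which equals `φ(t)`. Thus the Gaussian has zero defect.
-/
theorem stein_identity_gaussian {A : ℝ → ℝ} (hAm : Measurable A) {α β : ℝ} (hα : 0 ≤ α)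
    (hA : ∀ t, |A t| ≤ α * |t| + β) :
    ∫ u, u * (∫ t in (0 : ℝ)..u, A t) * stdGaussianDensity u =
      ∫ t, A t * stdGaussianDensity t := by
  have hφm := continuous_stdGaussianDensity.measurable
  -- The factor `|u|` instead of `u` accounts for the orientation of the interval integral when `u <
  -- 0`.
  set I : ℝ × ℝ → ℝ := fun z => ({z : ℝ × ℝ | z.2 ∈ Set.uIoc 0 z.1}).indicator
    (fun z => |z.1| * A z.2 * stdGaussianDensity z.1) z with hI
  have hset : MeasurableSet {z : ℝ × ℝ | z.2 ∈ Set.uIoc 0 z.1} := by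
    simp only [Set.mem_uIoc]
    exact ((measurableSet_lt measurable_const measurable_snd).inter
      (measurableSet_le measurable_snd measurable_fst)).union
      ((measurableSet_lt measurable_fst measurable_snd).inter
      (measurableSet_le measurable_snd measurable_const))
  have hIm : Measurable I := by
    refine Measurable.indicator ?_ hset
    fun_prop
  have hslice : ∀ u t, I (u, t) =
      (Set.uIoc 0 u).indicator (fun t => |u| * A t * stdGaussianDensity u) t := fun u t => by
    simp only [hI, Set.indicator, Set.mem_ofPred_eq]
  have hint1 : ∀ u, Integrable (fun t => I (u, t)) := fun u => by
    simp only [hslice]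
    rw [integrable_indicator_iff measurableSet_uIoc]
    exact ((intervalIntegrable_iff.1 (intervalIntegrable_of_linear_growth hAm hA 0 u)).const_mul
      _).mul_const _
  have hnorm : ∀ u, ∫ t, ‖I (u, t)‖ ≤
      α * (|u| ^ 3 * stdGaussianDensity u) + β * (|u| ^ 2 * stdGaussianDensity u) := fun u => by
    have hφ := stdGaussianDensity_pos u
    have h1 : ∀ t, ‖I (u, t)‖ =
        (Set.uIoc 0 u).indicator (fun t => |u| * stdGaussianDensity u * |A t|) t := fun t => by
      rw [hslice, norm_indicator_eq_indicator_norm]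
      congr 1; ext t
      rw [norm_mul, norm_mul, Real.norm_eq_abs, Real.norm_eq_abs, Real.norm_eq_abs, abs_abs,
        abs_of_pos hφ]; ring
    simp only [h1]
    rw [integral_indicator measurableSet_uIoc, integral_const_mul]
    have h2 := abs_primitive_le (A := fun t => |A t|) hα (fun t => by rw [abs_abs]; exact hA t) u
    have h3 : ∫ t in Set.uIoc 0 u, |A t| ≤ α * u ^ 2 + β * |u| := by
      refine le_trans ?_ h2
      rw [intervalIntegral.abs_intervalIntegral_eq]
      exact le_abs_self _
    calc |u| * stdGaussianDensity u * ∫ t in Set.uIoc 0 u, |A t|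
        ≤ |u| * stdGaussianDensity u * (α * u ^ 2 + β * |u|) := by gcongr
      _ = _ := by rw [← sq_abs u]; ring
  have hint : Integrable I (volume.prod volume) := by
    rw [integrable_prod_iff hIm.aestronglyMeasurable]
    refine ⟨Filter.Eventually.of_forall hint1, ?_⟩
    refine (((integrable_abs_pow_mul_stdGaussianDensity 3).const_mul α).add
      ((integrable_abs_pow_mul_stdGaussianDensity 2).const_mul β)).mono'
      hIm.norm.stronglyMeasurable.integral_prod_right.aestronglyMeasurable
      (Filter.Eventually.of_forall fun u => ?_)
    rw [Real.norm_eq_abs, abs_of_nonneg (integral_nonneg fun t => norm_nonneg _)]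
    exact hnorm u
  have hswap := integral_integral_swap (f := fun u t => I (u, t)) hint
  have hleft : ∀ u, ∫ t, I (u, t) = u * (∫ t in (0 : ℝ)..u, A t) * stdGaussianDensity u := by
    intro u
    simp only [hslice]
    rw [integral_indicator measurableSet_uIoc]
    simp only [mul_assoc]
    rw [integral_const_mul, integral_mul_const, intervalIntegral.intervalIntegral_eq_integral_uIoc,
      smul_eq_mul]
    rcases le_total 0 u with h | h
    · rw [if_pos h, abs_of_nonneg h]; ring
    · rcases h.lt_or_eq with h | rfl
      · rw [if_neg (not_le.2 h), abs_of_neg h]; ring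
      · simp
  have hright : ∀ t, t ≠ 0 → ∫ u, I (u, t) = A t * stdGaussianDensity t := by
    intro t ht
    rcases lt_or_gt_of_ne ht with h | h
    · have h1 : ∀ u, I (u, t) =
          (Set.Iio t).indicator (fun u => A t * (-u * stdGaussianDensity u)) u := by
        intro u
        have : t ∈ Set.uIoc 0 u ↔ u ∈ Set.Iio t := by
          rw [Set.mem_uIoc, Set.mem_Iio]
          constructor
          · rintro (h' | h')
            · linarith [h'.1]
            · exact h'.1
          · exact fun h' => Or.inr ⟨h', h.le⟩
        by_cases hu : u ∈ Set.Iio t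
        · simp only [hslice, Set.indicator, this, hu, if_true]
          rw [abs_of_neg (lt_trans hu h)]; ring
        · simp only [hslice, Set.indicator, this, hu, if_false]
      simp only [h1]
      rw [integral_indicator measurableSet_Iio, integral_const_mul, ← integral_Iic_eq_integral_Iio,
        integral_Iic_neg_mul_stdGaussianDensity]
    · have h1 : ∀ u, I (u, t) =
          (Set.Ici t).indicator (fun u => A t * (u * stdGaussianDensity u)) u := by
        intro u
        have : t ∈ Set.uIoc 0 u ↔ u ∈ Set.Ici t := by
          rw [Set.mem_uIoc, Set.mem_Ici]
          constructor
          · rintro (h' | h')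
            · exact h'.2
            · linarith [h'.2]
          · exact fun h' => Or.inl ⟨h, h'⟩
        by_cases hu : u ∈ Set.Ici t
        · simp only [hslice, Set.indicator, this, hu, if_true]
          rw [abs_of_pos (lt_of_lt_of_le h hu)]; ring
        · simp only [hslice, Set.indicator, this, hu, if_false]
      simp only [h1]
      rw [integral_indicator measurableSet_Ici, integral_const_mul, integral_Ici_eq_integral_Ioi,
        integral_Ioi_mul_stdGaussianDensity]
  simp only [hleft] at hswap
  rw [hswap]
  refine integral_congr_ae ?_
  filter_upwards [compl_mem_ae_iff.2 (measure_singleton (0 : ℝ))] with t ht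
  exact hright t (by simpa using ht)

theorem gaussian_first_moments :
    ∫ u, u * stdGaussianDensity u = 0 ∧ ∫ u, u ^ 2 * stdGaussianDensity u = 1 ∧
    ∫ u, |u| * stdGaussianDensity u ≤ 1 := by
  have h2 : ∫ u, u ^ 2 * stdGaussianDensity u = 1 := by
    have h := stein_identity_gaussian (A := fun _ => 1) measurable_const (α := 0) (β := 1) le_rfl
      (by simp)
    simp only [intervalIntegral.integral_const, sub_zero, smul_eq_mul, mul_one, one_mul] at h
    rw [integral_stdGaussianDensity] at h
    rw [← h]; congr 1; ext u; ring
  refine ⟨?_, h2, ?_⟩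
  · have h := integral_neg_eq_self (fun u => u * stdGaussianDensity u) volume
    have he : ∀ u, stdGaussianDensity (-u) = stdGaussianDensity u := fun u => by
      simp [stdGaussianDensity]
    simp only [he, neg_mul] at h
    rw [integral_neg] at h
    linarith
  · have hi2 := integrable_abs_pow_mul_stdGaussianDensity 2
    simp only [sq_abs] at hi2
    have hi1 := integrable_abs_pow_mul_stdGaussianDensity 1
    simp only [pow_one] at hi1
    have : ∫ u, |u| * stdGaussianDensity u ≤
        ∫ u, (1 / 2 * stdGaussianDensity u + 1 / 2 * (u ^ 2 * stdGaussianDensity u)) := by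
      refine integral_mono hi1 ((integrable_stdGaussianDensity.const_mul _).add
        (hi2.const_mul _)) fun u => ?_
      have h1 := stdGaussianDensity_pos u
      simp only
      rw [← sq_abs]
      nlinarith [mul_nonneg h1.le (sq_nonneg (|u| - 1))]
    rw [integral_add (integrable_stdGaussianDensity.const_mul _) (hi2.const_mul _),
      integral_const_mul, integral_const_mul, h2, integral_stdGaussianDensity] at this
    linarith

set_option maxHeartbeats 1000000 in
-- The defect involves integrands of at most cubic growth, so the weighted `L¹` distance `ε`
-- compares each with its Gaussian counterpart. Since the Gaussian defect vanishes, what remains is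
-- linear in `ε`. The integration by parts formula needs no smoothness of `f`: it lives on `[-1,
-- 1]`, where `f` is bounded below and can be divided out.
theorem steinRegular_of_nearGaussian {f : ℝ → ℝ} (hf : Measurable f) (hf0 : ∀ u, 0 ≤ f u)
    (hfi : Integrable f) (hf1 : ∫ u, f u = 1) {ε c₀ : ℝ} (hε : ε ≤ 1 / 4) (hc0 : 0 < c₀)
    (hc : ∀ u ∈ Set.Icc (-1 : ℝ) 1, c₀ ≤ f u)
    (hDi : Integrable fun u => (1 + |u| ^ 3) * |f u - stdGaussianDensity u|)
    (hD : ∫ u, (1 + |u| ^ 3) * |f u - stdGaussianDensity u| ≤ ε) :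
    MemLp (fun x : ℝ => x) 2 (volume.withDensity fun u => ENNReal.ofReal (f u)) ∧
    SteinRegular (14 + 8 / c₀) 1 (14 * ε) ((volume.withDensity fun u => ENNReal.ofReal (f u)).map
      fun x => x - ∫ y, y ∂(volume.withDensity fun u => ENNReal.ofReal (f u))) := by
  set φ := stdGaussianDensity with hφ
  have hφm : Measurable φ := continuous_stdGaussianDensity.measurable
  have hφ0 : ∀ u, 0 < φ u := stdGaussianDensity_pos
  set Q := volume.withDensity fun u => ENNReal.ofReal (f u) with hQ
  have hQint : ∀ g : ℝ → ℝ, ∫ u, g u ∂Q = ∫ u, g u * f u := fun g => by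
    rw [hQ, integral_withDensity_eq_integral_toReal_smul (by fun_prop)
      (Filter.Eventually.of_forall fun x => ENNReal.ofReal_lt_top)]
    congr 1; ext u
    rw [ENNReal.toReal_ofReal (hf0 u), smul_eq_mul, mul_comm]
  have hQi : ∀ g : ℝ → ℝ, Integrable g Q ↔ Integrable fun u => g u * f u := fun g => by
    rw [hQ, integrable_withDensity_iff_integrable_smul' (by fun_prop)
      (Filter.Eventually.of_forall fun x => ENNReal.ofReal_lt_top)]
    refine integrable_congr (Filter.Eventually.of_forall fun u => ?_)
    simp only
    rw [ENNReal.toReal_ofReal (hf0 u), smul_eq_mul, mul_comm]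
  have hQprob : IsProbabilityMeasure Q := ⟨by
    rw [hQ, withDensity_apply _ MeasurableSet.univ, Measure.restrict_univ,
      ← ofReal_integral_eq_lintegral_ofReal hfi (Filter.Eventually.of_forall hf0), hf1,
      ENNReal.ofReal_one]⟩
  have hε0 : 0 ≤ ε := le_trans (integral_nonneg fun u => by positivity) hD
  -- comparison of integrals with the Gaussian ones
  have hcmp : ∀ (g : ℝ → ℝ) (L : ℝ), Measurable g → (∀ u, |g u| ≤ L * (1 + |u| ^ 3)) →
      Integrable (fun u => g u * φ u) ∧ Integrable (fun u => g u * f u) ∧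
      |(∫ u, g u * f u) - ∫ u, g u * φ u| ≤ L * ε := by
    intro g L hg hgL
    have hL0 : 0 ≤ L := by
      have h1 := hgL 0
      have h2 := abs_nonneg (g 0)
      norm_num at h1
      linarith
    have i1 : Integrable fun u => g u * φ u := by
      have h1 : Integrable fun u => L * (φ u + |u| ^ 3 * φ u) :=
        (integrable_stdGaussianDensity.add (integrable_abs_pow_mul_stdGaussianDensity 3)).const_mul L
      refine h1.mono' (hg.mul hφm).aestronglyMeasurable (Filter.Eventually.of_forall fun u => ?_)
      rw [norm_mul, Real.norm_eq_abs, Real.norm_eq_abs, abs_of_pos (hφ0 u)]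
      calc |g u| * φ u ≤ L * (1 + |u| ^ 3) * φ u :=
            mul_le_mul_of_nonneg_right (hgL u) (hφ0 u).le
        _ = _ := by ring
    have hpt : ∀ u, |g u * (f u - φ u)| ≤ L * ((1 + |u| ^ 3) * |f u - φ u|) := fun u => by
      rw [abs_mul, ← mul_assoc]
      exact mul_le_mul_of_nonneg_right (hgL u) (abs_nonneg _)
    have i2 : Integrable fun u => g u * (f u - φ u) :=
      (hDi.const_mul L).mono' (hg.mul (hf.sub hφm)).aestronglyMeasurable
        (Filter.Eventually.of_forall hpt)
    have i3 : Integrable fun u => g u * f u := by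
      refine (i1.add i2).congr (Filter.Eventually.of_forall fun u => ?_)
      simp only [Pi.add_apply]; ring
    refine ⟨i1, i3, ?_⟩
    rw [← integral_sub i3 i1]
    have h1 : ∫ u, (g u * f u - g u * φ u) = ∫ u, g u * (f u - φ u) := by
      congr 1; ext u; ring
    rw [h1]
    calc |∫ u, g u * (f u - φ u)| ≤ ∫ u, |g u * (f u - φ u)| := abs_integral_le_integral_abs
      _ ≤ ∫ u, L * ((1 + |u| ^ 3) * |f u - φ u|) := integral_mono i2.abs (hDi.const_mul L) hpt
      _ ≤ L * ε := by rw [integral_const_mul]; exact mul_le_mul_of_nonneg_left hD hL0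
  obtain ⟨g1, g2, g3⟩ := gaussian_first_moments
  obtain ⟨-, iu1, cu1⟩ := hcmp (fun u => u) 1 measurable_id
    fun u => by rw [one_mul]; exact abs_le_one_add_cube u
  obtain ⟨-, iu2, cu2⟩ := hcmp (fun u => u ^ 2) 1 (by fun_prop)
    fun u => by rw [one_mul, abs_of_nonneg (sq_nonneg u)]; exact sq_le_one_add_cube u
  obtain ⟨-, iua, cua⟩ := hcmp (fun u => |u|) 1 (by fun_prop)
    fun u => by rw [one_mul, abs_abs]; exact abs_le_one_add_cube u
  rw [g1, sub_zero, one_mul] at cu1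
  rw [g2, one_mul] at cu2
  rw [one_mul] at cua
  set m := ∫ y, y ∂Q with hm
  have hmf : m = ∫ u, u * f u := hQint _
  rw [← hmf] at cu1
  have hid2 : MemLp (fun x : ℝ => x) 2 Q :=
    (memLp_two_iff_integrable_sq measurable_id.aestronglyMeasurable).2 ((hQi _).2 iu2)
  have hidi : Integrable (fun x : ℝ => x) Q := hid2.integrable (by norm_num)
  refine ⟨hid2, ?_⟩
  have hYm : Measurable fun x : ℝ => x - m := by fun_prop
  have hemb : MeasurableEmbedding fun x : ℝ => x - m :=
    (MeasurableEquiv.subRight m).measurableEmbedding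
  have hint : ∀ g : ℝ → ℝ, ∫ x, g x ∂(Q.map fun x => x - m) = ∫ u, g (u - m) * f u := fun g => by
    rw [hemb.integral_map, hQint]
  have hYi : Integrable (fun x => x - m) Q := hidi.sub (integrable_const m)
  have hY0 : ∫ u, (u - m) * f u = 0 := by
    rw [← hQint, integral_sub hidi (integrable_const m)]; simp [hm]
  set v := ∫ x, x ^ 2 ∂(Q.map fun x => x - m) with hv
  have hv' : v = (∫ u, u ^ 2 * f u) - m ^ 2 := by
    have h1 := variance_eq_sub hid2
    rw [variance_eq_integral (X := fun x : ℝ => x) measurable_id.aemeasurable] at h1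
    simp only [Pi.pow_apply] at h1
    rw [hv, hint, ← hQint fun u => (u - m) ^ 2, ← hQint fun u => u ^ 2]
    exact h1
  have hmε := abs_le.1 cu1
  have hu2ε := abs_le.1 cu2
  have hm2 : m ^ 2 ≤ ε / 4 := by nlinarith [abs_le.1 cu1]
  have hv1 : |1 - v| ≤ 2 * ε := by rw [hv', abs_le]; constructor <;> nlinarith [sq_nonneg m]
  have hvb := abs_le.1 hv1
  have h8 : 0 < 8 / c₀ := by positivity
  refine ⟨zero_le_one, ?_, ?_, ?_, ?_, ?_, ?_⟩
  · rw [hint fun x => x, hY0]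
  · exact (memLp_map_measure_iff measurable_id.aestronglyMeasurable hYm.aemeasurable).2
      (hid2.sub (memLp_const m))
  · linarith
  · nlinarith
  · intro A α β hA hα hβ hAb
    rw [← hv, hint, hint]
    set B : ℝ → ℝ := fun t => A (t - m) with hB
    -- Moving the mean `m` of `f` into the test function costs only an increase of the offset.
    set β' := α * |m| + β with hβ'
    have hβ'0 : 0 ≤ β' := by positivity
    have hBm : Measurable B := by fun_prop
    have hBb : ∀ t, |B t| ≤ α * |t| + β' := fun t => by
      refine (hAb _).trans ?_
      have := abs_sub t m
      simp only [hβ']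
      nlinarith
    set G : ℝ → ℝ := fun u => ∫ t in (0 : ℝ)..u, B t with hG
    have hGc : Continuous G :=
      intervalIntegral.continuous_primitive (intervalIntegrable_of_linear_growth hBm hBb) 0
    have hGb : ∀ u, |G u| ≤ α * u ^ 2 + β' * |u| := fun u => abs_primitive_le hα hBb u
    have hAG : ∀ u, ∫ t in (0 : ℝ)..u - m, A t = G u - G m := fun u => by
      have h1 := intervalIntegral.integral_comp_sub_right (a := m) (b := u) A m
      rw [sub_self] at h1
      rw [← h1]
      exact (intervalIntegral.integral_interval_sub_left
        (intervalIntegrable_of_linear_growth hBm hBb _ _)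
        (intervalIntegrable_of_linear_growth hBm hBb _ _)).symm
    obtain ⟨i1, i2, c1⟩ := hcmp (fun u => u * G u) (α + β') (by fun_prop) fun u => by
      rw [abs_mul]
      have h1 := mul_le_mul_of_nonneg_left (hGb u) (abs_nonneg u)
      have h2 : |u| * (α * u ^ 2 + β' * |u|) = α * |u| ^ 3 + β' * u ^ 2 := by
        rw [← sq_abs u]; ring
      have h3 : α * |u| ^ 3 ≤ α * (1 + |u| ^ 3) := by gcongr; linarith
      have h4 : β' * u ^ 2 ≤ β' * (1 + |u| ^ 3) := by gcongr; exact sq_le_one_add_cube u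
      linarith
    obtain ⟨-, i3, c2⟩ := hcmp G (α + β') hGc.measurable fun u => by
      refine (hGb u).trans ?_
      have h3 : α * u ^ 2 ≤ α * (1 + |u| ^ 3) := by gcongr; exact sq_le_one_add_cube u
      have h4 : β' * |u| ≤ β' * (1 + |u| ^ 3) := by gcongr; exact abs_le_one_add_cube u
      linarith
    obtain ⟨j1, j2, c3⟩ := hcmp B (α + β') hBm fun u => by
      refine (hBb u).trans ?_
      have h3 : α * |u| ≤ α * (1 + |u| ^ 3) := by gcongr; exact abs_le_one_add_cube u
      have h4 : 0 ≤ β' * |u| ^ 3 := by positivity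
      linarith
    have hstein := stein_identity_gaussian hBm hα hBb
    have ja : Integrable fun u => |u| * φ u := by
      simpa using integrable_abs_pow_mul_stdGaussianDensity 1
    have bφ : |∫ u, B u * φ u| ≤ α + β' := by
      have h1 : ∀ u, |B u * φ u| ≤ α * (|u| * φ u) + β' * φ u := fun u => by
        rw [abs_mul, abs_of_pos (hφ0 u)]
        calc |B u| * φ u ≤ (α * |u| + β') * φ u := mul_le_mul_of_nonneg_right (hBb u) (hφ0 u).le
          _ = _ := by ring
      calc |∫ u, B u * φ u| ≤ ∫ u, |B u * φ u| := abs_integral_le_integral_abs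
        _ ≤ ∫ u, (α * (|u| * φ u) + β' * φ u) := integral_mono j1.abs
            ((ja.const_mul α).add (integrable_stdGaussianDensity.const_mul β')) h1
        _ = α * (∫ u, |u| * φ u) + β' * ∫ u, φ u := by
            rw [integral_add (ja.const_mul α) (integrable_stdGaussianDensity.const_mul β'),
              integral_const_mul, integral_const_mul]
        _ ≤ α + β' := by rw [hφ, integral_stdGaussianDensity]; nlinarith
    have bG : |∫ u, G u * f u| ≤ 2 * (α + β') := by
      have h1 : ∀ u, |G u * f u| ≤ α * (u ^ 2 * f u) + β' * (|u| * f u) := fun u => by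
        rw [abs_mul, abs_of_nonneg (hf0 u)]
        calc |G u| * f u ≤ (α * u ^ 2 + β' * |u|) * f u :=
              mul_le_mul_of_nonneg_right (hGb u) (hf0 u)
          _ = _ := by ring
      calc |∫ u, G u * f u| ≤ ∫ u, |G u * f u| := abs_integral_le_integral_abs
        _ ≤ ∫ u, (α * (u ^ 2 * f u) + β' * (|u| * f u)) := integral_mono i3.abs
            ((iu2.const_mul α).add (iua.const_mul β')) h1
        _ = α * (∫ u, u ^ 2 * f u) + β' * ∫ u, |u| * f u := by
            rw [integral_add (iu2.const_mul α) (iua.const_mul β'),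
              integral_const_mul, integral_const_mul]
        _ ≤ 2 * (α + β') := by
            have := (abs_le.1 cua).2
            nlinarith
    have e1 : ∫ u, (u - m) * (∫ t in (0 : ℝ)..u - m, A t) * f u =
        (∫ u, u * G u * f u) - m * ∫ u, G u * f u := by
      have h1 : ∀ u, (u - m) * (∫ t in (0 : ℝ)..u - m, A t) * f u =
          (u * G u * f u - m * (G u * f u)) - G m * ((u - m) * f u) := fun u => by
        rw [hAG]; ring
      have i4 : Integrable fun u => u * G u * f u - m * (G u * f u) := i2.sub (i3.const_mul m)
      simp only [h1]
      rw [integral_sub i4 (((hQi _).1 hYi).const_mul _),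
        integral_sub i2 (i3.const_mul m), integral_const_mul, integral_const_mul, hY0]
      ring
    rw [e1]
    change |_ - _ - v * ∫ u, B u * f u| ≤ _
    -- Stein's identity for the Gaussian cancels the main terms. The four differences are at most
    -- `1`, `2`, `2` and `2` times `ε (α + β')`.
    have e2 : (∫ u, u * G u * f u) - m * (∫ u, G u * f u) - v * ∫ u, B u * f u =
        ((∫ u, u * G u * f u) - ∫ u, u * G u * φ u) + (1 - v) * (∫ u, B u * φ u) -
          m * (∫ u, G u * f u) - v * ((∫ u, B u * f u) - ∫ u, B u * φ u) := by
      have : ∫ u, u * G u * φ u = ∫ u, B u * φ u := hstein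
      rw [this]; ring
    rw [e2]
    have hs : 0 ≤ α + β' := by positivity
    have b1 : |(1 - v) * (∫ u, B u * φ u)| ≤ 2 * ε * (α + β') := by
      rw [abs_mul]; exact mul_le_mul hv1 bφ (abs_nonneg _) (by positivity)
    have b2 : |m * (∫ u, G u * f u)| ≤ ε * (2 * (α + β')) := by
      rw [abs_mul]; exact mul_le_mul cu1 bG (abs_nonneg _) hε0
    have b3 : |v * ((∫ u, B u * f u) - ∫ u, B u * φ u)| ≤ 2 * ((α + β') * ε) := by
      rw [abs_mul]
      refine mul_le_mul ?_ c3 (abs_nonneg _) (by norm_num)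
      rw [abs_le]; constructor <;> linarith
    have hfin : 7 * ε * (α + β') ≤ α * (14 * ε) + β * ((14 + 8 / c₀) * 1) := by
      have h1 : |m| ≤ 1 := cu1.trans (by linarith)
      have h2 : α + β' ≤ 2 * α + β := by simp only [hβ']; nlinarith
      have h3 : 7 * ε * (α + β') ≤ 7 * ε * (2 * α + β) := by gcongr
      nlinarith [mul_nonneg hβ h8.le, mul_nonneg hβ (sub_nonneg.2 hε)]
    refine le_trans ?_ hfin
    have t1 := abs_sub ((∫ u, u * G u * f u) - (∫ u, u * G u * φ u) +
      (1 - v) * (∫ u, B u * φ u) - m * (∫ u, G u * f u))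
      (v * ((∫ u, B u * f u) - ∫ u, B u * φ u))
    have t2 := abs_sub ((∫ u, u * G u * f u) - (∫ u, u * G u * φ u) +
      (1 - v) * (∫ u, B u * φ u)) (m * (∫ u, G u * f u))
    have t3 := abs_add_le ((∫ u, u * G u * f u) - (∫ u, u * G u * φ u))
      ((1 - v) * (∫ u, B u * φ u))
    linarith
  -- Take `η = (1 - u ^ 2) / f` and `ψ = 2 u / f` on `J`: the density cancels, and the formula is
  -- ordinary integration by parts against `1 - u ^ 2`, which vanishes at `±1`.
  · set J := Set.Icc (-1 : ℝ) 1 with hJ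
    have hJm : MeasurableSet J := measurableSet_Icc
    have hquot : ∀ g : ℝ → ℝ, ∀ u,
        J.indicator (fun u => g u / f u) u * f u = J.indicator g u := by
      intro g u
      by_cases hu : u ∈ J
      · rw [Set.indicator_of_mem hu, Set.indicator_of_mem hu,
          div_mul_cancel₀ _ (lt_of_lt_of_le hc0 (hc u hu)).ne']
      · rw [Set.indicator_of_notMem hu, Set.indicator_of_notMem hu, zero_mul]
    have hJint : ∀ g : ℝ → ℝ, ∫ u, J.indicator g u = ∫ u in (-1 : ℝ)..1, g u := fun g => by
      rw [integral_indicator hJm, intervalIntegral.integral_of_le (by norm_num),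
        integral_Icc_eq_integral_Ioc]
    have hsq : ∀ g : ℝ → ℝ, Continuous g → ∀ L : ℝ, (∀ u ∈ J, |g u| ≤ L) →
        ∫ u, J.indicator (fun u => g u / f u) u ^ 2 * f u ≤ 2 * L ^ 2 / c₀ := by
      intro g hg L hL
      have h1 : ∀ u, J.indicator (fun u => g u / f u) u ^ 2 * f u ≤
          J.indicator (fun _ => L ^ 2 / c₀) u := fun u => by
        rw [sq, mul_assoc, hquot]
        by_cases hu : u ∈ J
        · rw [Set.indicator_of_mem hu, Set.indicator_of_mem hu, Set.indicator_of_mem hu,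
            div_mul_eq_mul_div, ← sq]
          have hfu := hc u hu
          have hL2 : g u ^ 2 ≤ L ^ 2 := by
            rw [← sq_abs]; exact pow_le_pow_left₀ (abs_nonneg _) (hL u hu) 2
          exact div_le_div₀ (sq_nonneg L) hL2 hc0 hfu
        · simp [Set.indicator_of_notMem hu]
      have h2 : ∫ u, J.indicator (fun _ => L ^ 2 / c₀) u = 2 * L ^ 2 / c₀ := by
        rw [hJint]; simp; ring
      rw [← h2]
      refine integral_mono_of_nonneg (Filter.Eventually.of_forall fun u =>
        mul_nonneg (sq_nonneg _) (hf0 u)) ?_ (Filter.Eventually.of_forall h1)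
      exact (integrable_indicator_iff hJm).2 (integrableOn_const (by simp [hJ]))
    have hbd : ∀ g : ℝ → ℝ, Continuous g → ∀ L : ℝ, 0 ≤ L → (∀ u ∈ J, |g u| ≤ L) →
        MemLp (fun x => J.indicator (fun u => g u / f u) (x + m)) 2 (Q.map fun x => x - m) := by
      intro g hg L hL0 hL
      have hmeas : Measurable (J.indicator fun u => g u / f u) :=
        (hg.measurable.div hf).indicator hJm
      have : IsProbabilityMeasure (Q.map fun x => x - m) :=
        Measure.isProbabilityMeasure_map hYm.aemeasurable
      refine MemLp.of_bound (hmeas.comp (by fun_prop)).aestronglyMeasurable (L / c₀)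
        (Filter.Eventually.of_forall fun x => ?_)
      by_cases hu : x + m ∈ J
      · rw [Set.indicator_of_mem hu, norm_div, Real.norm_eq_abs, Real.norm_eq_abs,
          abs_of_nonneg (hf0 _)]
        exact div_le_div₀ hL0 (hL _ hu) hc0 (hc _ hu)
      · rw [Set.indicator_of_notMem hu, norm_zero]; positivity
    have hb1 : ∀ u ∈ J, |1 - u ^ 2| ≤ 1 := fun u hu => by
      have h1 := hu.1
      have h2 := hu.2
      rw [abs_le]; constructor <;> nlinarith
    have hb2 : ∀ u ∈ J, |2 * u| ≤ 2 := fun u hu => by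
      have h1 := hu.1
      have h2 := hu.2
      rw [abs_le]; constructor <;> linarith
    have hm1 : Measurable (J.indicator fun u => (1 - u ^ 2) / f u) := by
      refine Measurable.indicator (by fun_prop) hJm
    have hm2 : Measurable (J.indicator fun u => (2 * u) / f u) := by
      refine Measurable.indicator (by fun_prop) hJm
    refine ⟨fun x => J.indicator (fun u => (1 - u ^ 2) / f u) (x + m),
      fun x => J.indicator (fun u => (2 * u) / f u) (x + m), hm1.comp (by fun_prop),
      hm2.comp (by fun_prop), fun x => ?_, hbd _ (by fun_prop) 1 (by norm_num) hb1,
      hbd _ (by fun_prop) 2 (by norm_num) hb2, ?_, ?_, ?_, ?_⟩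
    · refine Set.indicator_nonneg (fun u hu => div_nonneg ?_ (hf0 u)) _
      have := (abs_le.1 (hb1 u hu))
      nlinarith [hu.1, hu.2]
    · rw [hint]
      simp only [sub_add_cancel, hquot]
      rw [hJint, intervalIntegral.integral_sub (by simp) (by simp), integral_pow]
      norm_num
      nlinarith
    · rw [hint fun x => J.indicator (fun u => (1 - u ^ 2) / f u) (x + m) ^ 2]
      simp only [sub_add_cancel]
      refine (hsq _ (by fun_prop) 1 hb1).trans ?_
      have : 2 * (1 : ℝ) ^ 2 / c₀ = 8 / c₀ / 4 := by ring
      rw [this]; linarith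
    · rw [hint fun x => J.indicator (fun u => (2 * u) / f u) (x + m) ^ 2]
      simp only [sub_add_cancel]
      refine (hsq _ (by fun_prop) 2 hb2).trans ?_
      have : 2 * (2 : ℝ) ^ 2 / c₀ = 8 / c₀ := by ring
      rw [this]; linarith
    · rintro F F' hF hF' - -
      rw [hint, hint]
      simp only [sub_add_cancel]
      have hFc : Continuous F := continuous_iff_continuousAt.2 fun x => (hF x).continuousAt
      have h1 : ∀ g H : ℝ → ℝ, ∀ u, J.indicator (fun u => g u / f u) u * H (u - m) * f u =
          J.indicator (fun u => g u * H (u - m)) u := by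
        intro g H u
        rw [mul_right_comm, hquot]
        by_cases hu : u ∈ J
        · simp [Set.indicator_of_mem hu]
        · simp [Set.indicator_of_notMem hu]
      simp only [h1 (fun u => 2 * u) F, h1 (fun u => 1 - u ^ 2) F']
      rw [hJint, hJint]
      have h2 : ∀ u ∈ Set.uIcc (-1 : ℝ) 1, HasDerivAt (fun u => 1 - u ^ 2) (-(2 * u)) u :=
        fun u _ => ((hasDerivAt_pow 2 u).const_sub 1).congr_deriv (by norm_num)
      have h3 : ∀ u ∈ Set.uIcc (-1 : ℝ) 1, HasDerivAt (fun u => F (u - m)) (F' (u - m)) u :=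
        fun u _ => (hF (u - m)).comp_sub_const u m
      have h4 := intervalIntegral.integral_mul_deriv_eq_deriv_mul h2 h3
        (Continuous.intervalIntegrable (by fun_prop) _ _)
        (Continuous.intervalIntegrable (by fun_prop) _ _)
      rw [h4]
      simp only [neg_mul, intervalIntegral.integral_neg]
      norm_num

/-! ### Splitting the Gram determinant of radial columns -/

/-- The measure on `ℝ^d` with the rotationally invariant Lebesgue density `x ↦ w ‖x‖`. -/
noncomputable def radialLaw (w : ℝ → ENNReal) (d : ℕ) : Measure (EuclideanSpace ℝ (Fin d)) :=
  volume.withDensity fun x => w ‖x‖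

/-- The Gram determinant of a family of vectors. -/
noncomputable def gramDet {d p : ℕ} (c : Fin p → EuclideanSpace ℝ (Fin d)) : ℝ :=
  (Matrix.of fun i j => inner ℝ (c i) (c j)).det

/-- The vector of all coordinates but the first. -/
noncomputable def euclideanTail {d : ℕ} (x : EuclideanSpace ℝ (Fin (d + 1))) :
    EuclideanSpace ℝ (Fin d) :=
  WithLp.toLp 2 fun i => x i.succ

/-- The radial profile of the image of a radial density under `euclideanTail`. -/
noncomputable def tailProfile (w : ℝ → ENNReal) (r : ℝ) : ENNReal :=
  ∫⁻ t, w (Real.sqrt (t ^ 2 + r ^ 2))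

/-- The reflection in the hyperplane orthogonal to `‖u‖ e₀ - u`; it maps `u` to `‖u‖ e₀`. -/
noncomputable def alignFirst {d : ℕ} (u x : EuclideanSpace ℝ (Fin (d + 1))) :
    EuclideanSpace ℝ (Fin (d + 1)) :=
  x - (2 * (inner ℝ (u - EuclideanSpace.single 0 ‖u‖) x /
    ‖u - EuclideanSpace.single 0 ‖u‖‖ ^ 2)) • (u - EuclideanSpace.single 0 ‖u‖)

/-- The explicit formula gives joint measurability in `u` and `x`; the reflection gives isometry and
invariance of volume. If `u` already lies on the positive axis, the quotient is `0 / 0 = 0` and the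
map is the identity. -/
theorem alignFirst_eq_reflection {d : ℕ} (u x : EuclideanSpace ℝ (Fin (d + 1))) :
    alignFirst u x =
      (Submodule.span ℝ {u - EuclideanSpace.single 0 ‖u‖})ᗮ.reflection x := by
  rw [Submodule.reflection_orthogonal_apply, Submodule.reflection_singleton_apply, alignFirst]
  simp only [RCLike.ofReal_real_eq_id, id_eq, neg_sub]
  rw [mul_smul, two_smul ℝ, two_smul ℕ]

theorem alignFirst_self {d : ℕ} (u : EuclideanSpace ℝ (Fin (d + 1))) :
    alignFirst u u = EuclideanSpace.single 0 ‖u‖ := by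
  rw [alignFirst_eq_reflection]
  exact Submodule.reflection_sub (by simp)

theorem inner_alignFirst {d : ℕ} (u x y : EuclideanSpace ℝ (Fin (d + 1))) :
    inner ℝ (alignFirst u x) (alignFirst u y) = inner ℝ x y := by
  rw [alignFirst_eq_reflection, alignFirst_eq_reflection, LinearIsometryEquiv.inner_map_map]

theorem measurable_euclideanTail {d : ℕ} : Measurable (euclideanTail (d := d)) := by
  unfold euclideanTail
  fun_prop

theorem measurable_alignFirst {d : ℕ} :
    Measurable (Function.uncurry (alignFirst (d := d))) := by
  have h : Measurable fun u : EuclideanSpace ℝ (Fin (d + 1)) =>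
      (EuclideanSpace.single 0 ‖u‖ : EuclideanSpace ℝ (Fin (d + 1))) := by
    have : Continuous fun r : ℝ => (EuclideanSpace.single 0 r : EuclideanSpace ℝ (Fin (d + 1))) :=
      (PiLp.continuous_toLp 2 _).comp (continuous_single (A := fun _ : Fin (d + 1) => ℝ) 0)
    exact this.measurable.comp measurable_norm
  have h' : Measurable fun z : EuclideanSpace ℝ (Fin (d + 1)) × EuclideanSpace ℝ (Fin (d + 1)) =>
      z.1 - EuclideanSpace.single 0 ‖z.1‖ := measurable_fst.sub (h.comp measurable_fst)
  exact measurable_snd.sub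
    (((measurable_const.mul ((h'.inner measurable_snd).div (h'.norm.pow_const 2)))).smul h')

theorem inner_eq_add_inner_tail {d : ℕ} (x y : EuclideanSpace ℝ (Fin (d + 1))) :
    inner ℝ x y = x 0 * y 0 + inner ℝ (euclideanTail x) (euclideanTail y) := by
  simp only [PiLp.inner_apply, Fin.sum_univ_succ, euclideanTail, RCLike.inner_apply, conj_trivial]
  ring

theorem gramDet_eq_mul_gramDet_tail {d q : ℕ} (c : Fin (q + 1) → EuclideanSpace ℝ (Fin (d + 1)))
    (h : c 0 ≠ 0) :
    gramDet c = ‖c 0‖ ^ 2 * gramDet fun j : Fin q => euclideanTail (alignFirst (c 0) (c j.succ)) := by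
  set u := c 0 with hu
  set x := fun j => alignFirst u (c j) with hx
  have hr : ‖u‖ ≠ 0 := norm_ne_zero_iff.2 h
  have hx0 : x 0 = EuclideanSpace.single 0 ‖u‖ := alignFirst_self u
  have hx00 : x 0 0 = ‖u‖ := by simp [hx0]
  have ht0 : euclideanTail (x 0) = 0 := by
    ext i; simp [hx0, euclideanTail]
  have hG : gramDet c = (Matrix.of fun i j => inner ℝ (x i) (x j)).det := by
    simp only [gramDet, hx, inner_alignFirst]
  -- The matrix after subtracting `x i 0 / ‖u‖` times row zero from row `i`; its zeroth column has a
  -- single nonzero entry.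
  set B : Matrix (Fin (q + 1)) (Fin (q + 1)) ℝ := Matrix.of fun i j =>
    if i = 0 then ‖u‖ * x j 0 else inner ℝ (euclideanTail (x i)) (euclideanTail (x j)) with hB
  have hAB : (Matrix.of fun i j => inner ℝ (x i) (x j)).det = B.det := by
    refine Matrix.det_eq_of_forall_row_eq_smul_add_const
      (fun i => if i = 0 then 0 else x i 0 / ‖u‖) 0 (by simp) fun i j => ?_
    by_cases hi : i = 0
    · subst hi
      simp only [Matrix.of_apply, hB, if_true, inner_eq_add_inner_tail, ht0, hx00, inner_zero_left]
      ring
    · simp only [Matrix.of_apply, hB, if_neg hi, if_true, inner_eq_add_inner_tail (x i) (x j)]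
      field_simp
      ring
  rw [hG, hAB, Matrix.det_succ_column_zero, Fin.sum_univ_succ, Finset.sum_eq_zero]
  · simp only [hB, Matrix.of_apply, if_true, hx00, Fin.val_zero, pow_zero, one_mul, add_zero]
    rw [gramDet, sq]
    congr 2
  · intro i _
    simp [hB, ht0]

theorem measurable_gramDet {d p : ℕ} : Measurable (gramDet (d := d) (p := p)) := by
  have : Continuous (gramDet (d := d) (p := p)) := by
    unfold gramDet
    refine Continuous.matrix_det (continuous_matrix fun i j => ?_)
    simp only [Matrix.of_apply]
    fun_prop
  exact this.measurable

theorem lintegral_radialLaw {w : ℝ → ENNReal} (hw : Measurable w) (d : ℕ)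
    {f : EuclideanSpace ℝ (Fin d) → ENNReal} (hf : Measurable f) :
    ∫⁻ x, f x ∂(radialLaw w d) = ∫⁻ x, w ‖x‖ * f x := by
  rw [radialLaw, lintegral_withDensity_eq_lintegral_mul _ (by fun_prop) hf]
  rfl

theorem measurable_tailProfile {w : ℝ → ENNReal} (hw : Measurable w) : Measurable (tailProfile w) := by
  unfold tailProfile
  refine Measurable.lintegral_prod_right' (f := fun z : ℝ × ℝ => w (Real.sqrt (z.2 ^ 2 + z.1 ^ 2))) ?_
  fun_prop

theorem map_alignFirst_radialLaw {w : ℝ → ENNReal} (hw : Measurable w) {d : ℕ}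
    (u : EuclideanSpace ℝ (Fin (d + 1))) :
    (radialLaw w (d + 1)).map (alignFirst u) = radialLaw w (d + 1) := by
  have hU : Measurable (alignFirst u) := measurable_alignFirst.comp measurable_prodMk_left
  set R := (Submodule.span ℝ {u - EuclideanSpace.single 0 ‖u‖})ᗮ.reflection with hR
  have hUR : alignFirst u = R := funext fun x => alignFirst_eq_reflection u x
  refine Measure.ext_of_lintegral _ fun f hf => ?_
  rw [lintegral_map hf hU, lintegral_radialLaw hw _ (f := fun x => f (alignFirst u x)) (hf.comp hU), lintegral_radialLaw hw _ hf, hUR]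
  have h := (R.measurePreserving).lintegral_comp
    (f := fun x => w ‖x‖ * f x) (by fun_prop)
  simpa using h

/-- Splitting off the first coordinate. -/
theorem lintegral_euclidean_succ {d : ℕ} {f : EuclideanSpace ℝ (Fin (d + 1)) → ENNReal}
    {F : ℝ → EuclideanSpace ℝ (Fin d) → ENNReal} (hF : Measurable (Function.uncurry F))
    (h : ∀ x, f x = F (x 0) (euclideanTail x)) :
    ∫⁻ x, f x = ∫⁻ t, ∫⁻ y, F t y := by
  have h1 := EuclideanSpace.volume_preserving_symm_measurableEquiv_toLp (Fin (d + 1))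
  have h2 := volume_preserving_piFinSuccAbove (fun _ : Fin (d + 1) => ℝ) 0
  have h3 := (EuclideanSpace.volume_preserving_symm_measurableEquiv_toLp (Fin d)).symm
  have h4 := (MeasurePreserving.id (volume : Measure ℝ)).prod h3
  have h5 := (h4.comp (h2.comp h1)).lintegral_comp hF
  rw [lintegral_prod _ hF.aemeasurable] at h5
  simp only [Function.uncurry_apply_pair] at h5
  rw [← h5]
  refine lintegral_congr fun x => ?_
  rw [h x]
  rfl

theorem map_tail_radialLaw {w : ℝ → ENNReal} (hw : Measurable w) (d : ℕ) :
    (radialLaw w (d + 1)).map euclideanTail = radialLaw (tailProfile w) d := by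
  refine Measure.ext_of_lintegral _ fun f hf => ?_
  rw [lintegral_map hf measurable_euclideanTail,
    lintegral_radialLaw hw _ (f := fun x => f (euclideanTail x)) (hf.comp measurable_euclideanTail),
    lintegral_radialLaw (measurable_tailProfile hw) _ hf,
    lintegral_euclidean_succ (F := fun t y => w (Real.sqrt (t ^ 2 + ‖y‖ ^ 2)) * f y)]
  · rw [lintegral_lintegral_swap]
    · refine lintegral_congr fun y => ?_
      rw [lintegral_mul_const _ (by fun_prop)]
      rfl
    · unfold Function.uncurry; fun_prop
  · unfold Function.uncurry; fun_prop
  · intro x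
    congr 2
    rw [← Real.sqrt_sq (norm_nonneg x), ← real_inner_self_eq_norm_sq,
      ← real_inner_self_eq_norm_sq, inner_eq_add_inner_tail]
    ring_nf

/-- Polar coordinates. The sphere's area stays unspecified because every use is normalised
afterwards by a total mass. -/
theorem exists_lintegral_fun_norm (k : ℕ) : ∃ c : ENNReal, ∀ f : ℝ → ENNReal, Measurable f →
    ∫⁻ x : EuclideanSpace ℝ (Fin (k + 1)), f ‖x‖ =
      c * ∫⁻ r in Set.Ioi 0, ENNReal.ofReal (r ^ k) * f r := by
  set E := EuclideanSpace ℝ (Fin (k + 1))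
  have hdim : Module.finrank ℝ E - 1 = k := by simp [E]
  refine ⟨(volume : Measure E).toSphere Set.univ, fun f hf => ?_⟩
  calc ∫⁻ x : E, f ‖x‖
      = ∫⁻ x : ({(0)}ᶜ : Set E), f ‖x.1‖ ∂((volume : Measure E).comap Subtype.val) := by
        rw [lintegral_subtype_comap (measurableSet_singleton _).compl fun x => f ‖x‖,
          restrict_compl_singleton]
    _ = ∫⁻ x, f x.2 ∂(volume : Measure E).toSphere.prod
          (.volumeIoiPow (Module.finrank ℝ E - 1)) := by
        have h := (volume : Measure E).measurePreserving_homeomorphUnitSphereProd.lintegral_comp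
          (f := fun x => f x.2) (by fun_prop)
        simpa using h
    _ = (volume : Measure E).toSphere Set.univ *
          ∫⁻ x : Set.Ioi (0 : ℝ), f x ∂.volumeIoiPow (Module.finrank ℝ E - 1) := by
        rw [lintegral_prod _ (by fun_prop)]
        simp [mul_comm]
    _ = _ := by
        rw [Measure.volumeIoiPow, lintegral_withDensity_eq_lintegral_mul _ (by fun_prop)
          (by fun_prop), hdim]
        congr 1
        exact lintegral_subtype_comap measurableSet_Ioi fun a => ENNReal.ofReal (a ^ k) * f a

/-- The law of `log ‖x‖²` under a radial density. -/
noncomputable def logNormLaw (w : ℝ → ENNReal) (d : ℕ) : Measure ℝ :=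
  (radialLaw w d).map fun x => 2 * Real.log ‖x‖

theorem lintegral_sinPowLaw (k : ℕ) {f : ℝ → ENNReal} (hf : Measurable f) :
    ∫⁻ x, f x ∂(sinPowLaw k) = ENNReal.ofReal (sinPowIntegral k)⁻¹ *
      ∫⁻ x in Set.Ioo 0 Real.pi, ENNReal.ofReal (Real.sin x ^ k) * f x := by
  have hI : 0 ≤ (sinPowIntegral k)⁻¹ := inv_nonneg.2 (sinPowIntegral_pos k).le
  rw [sinPowLaw, lintegral_withDensity_eq_lintegral_mul _ (by fun_prop) hf,
    ← lintegral_const_mul _ (by fun_prop)]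
  refine lintegral_congr fun x => ?_
  simp only [Pi.mul_apply]
  rw [ENNReal.ofReal_mul hI, mul_assoc]

theorem lintegral_polar_upper {F : ℝ → ℝ → ENNReal} (hF : Measurable (Function.uncurry F)) :
    ∫⁻ ρ in Set.Ioi (0 : ℝ), ∫⁻ t, F t ρ =
      ∫⁻ r in Set.Ioi (0 : ℝ), ∫⁻ θ in Set.Ioo 0 Real.pi,
        ENNReal.ofReal r * F (r * Real.cos θ) (r * Real.sin θ) := by
  set K : ℝ × ℝ → ENNReal := fun z => (Set.Ioi (0 : ℝ)).indicator (fun ρ => F z.1 ρ) z.2 with hK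
  have hK' : K = (Prod.snd ⁻¹' Set.Ioi (0 : ℝ)).indicator (Function.uncurry F) := by
    ext z; simp only [hK, Set.indicator, Set.mem_preimage, Function.uncurry]
  have hKm : Measurable K := hK' ▸ hF.indicator (measurable_snd measurableSet_Ioi)
  have h1 : ∫⁻ ρ in Set.Ioi (0 : ℝ), ∫⁻ t, F t ρ = ∫⁻ z, K z := by
    rw [Measure.volume_eq_prod, lintegral_prod_symm _ hKm.aemeasurable,
      ← lintegral_indicator measurableSet_Ioi]
    refine lintegral_congr fun ρ => ?_
    by_cases hρ : ρ ∈ Set.Ioi (0 : ℝ)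
    · simp only [hK, Set.indicator_of_mem hρ]
    · simp only [hK, Set.indicator_of_notMem hρ, lintegral_zero]
  have hG : Measurable fun z : ℝ × ℝ =>
      ENNReal.ofReal z.1 * F (z.1 * Real.cos z.2) (z.1 * Real.sin z.2) := by
    refine Measurable.mul (by fun_prop) ?_
    exact hF.comp (f := fun z : ℝ × ℝ => (z.1 * Real.cos z.2, z.1 * Real.sin z.2)) (by fun_prop)
  have h2 : ∫⁻ z, K z = ∫⁻ z in Set.Ioi (0 : ℝ) ×ˢ Set.Ioo 0 Real.pi,
      ENNReal.ofReal z.1 * F (z.1 * Real.cos z.2) (z.1 * Real.sin z.2) := by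
    rw [← lintegral_comp_polarCoord_symm, polarCoord_target,
      ← lintegral_indicator (measurableSet_Ioi.prod measurableSet_Ioo),
      ← lintegral_indicator (measurableSet_Ioi.prod measurableSet_Ioo)]
    refine lintegral_congr fun z => ?_
    simp only [polarCoord_symm_apply, smul_eq_mul, hK]
    by_cases hr : 0 < z.1
    · by_cases hθ : z.2 ∈ Set.Ioo 0 Real.pi
      · have hs : 0 < z.1 * Real.sin z.2 := mul_pos hr (Real.sin_pos_of_mem_Ioo hθ)
        have hθ' : z.2 ∈ Set.Ioo (-Real.pi) Real.pi := ⟨by linarith [hθ.1, Real.pi_pos], hθ.2⟩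
        rw [Set.indicator_of_mem (show z ∈ Set.Ioi (0 : ℝ) ×ˢ Set.Ioo (-Real.pi) Real.pi from
          ⟨hr, hθ'⟩), Set.indicator_of_mem (show z ∈ Set.Ioi (0 : ℝ) ×ˢ Set.Ioo 0 Real.pi from
          ⟨hr, hθ⟩), Set.indicator_of_mem (show z.1 * Real.sin z.2 ∈ Set.Ioi (0 : ℝ) from hs)]
      · rw [Set.indicator_of_notMem (s := Set.Ioi (0 : ℝ) ×ˢ Set.Ioo 0 Real.pi) (fun h => hθ h.2)]
        by_cases hθ' : z.2 ∈ Set.Ioo (-Real.pi) Real.pi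
        · have : z.2 ≤ 0 := not_lt.1 fun h => hθ ⟨h, hθ'.2⟩
          have hs : Real.sin z.2 ≤ 0 := Real.sin_nonpos_of_nonpos_of_neg_pi_le this hθ'.1.le
          rw [Set.indicator_of_mem (show z ∈ Set.Ioi (0 : ℝ) ×ˢ Set.Ioo (-Real.pi) Real.pi from
            ⟨hr, hθ'⟩), Set.indicator_of_notMem, mul_zero]
          exact not_lt.2 (mul_nonpos_of_nonneg_of_nonpos hr.le hs)
        · rw [Set.indicator_of_notMem (fun h => hθ' h.2)]
    · rw [Set.indicator_of_notMem (fun h => hr h.1), Set.indicator_of_notMem (fun h => hr h.1)]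
  rw [h1, h2, Measure.volume_eq_prod, ← Measure.prod_restrict, lintegral_prod _ hG.aemeasurable]

/-- Write the deleted coordinate and the norm of the tail as `(r cos θ, r sin θ)`. The volume factor
becomes `r ^ (k + 1) * sin θ ^ k`, so the full norm `r` and the angle `θ` are independent, and the
tail has norm `r sin θ`. -/
theorem logNormLaw_tailProfile {w : ℝ → ENNReal} (hw : Measurable w) (k : ℕ)
    [hp : IsProbabilityMeasure (radialLaw w (k + 2))] :
    logNormLaw (tailProfile w) (k + 1) = (logNormLaw w (k + 2)).conv (logSinLaw k) := by
  have hlog : ∀ d, Measurable fun x : EuclideanSpace ℝ (Fin d) => 2 * Real.log ‖x‖ :=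
    fun d => by fun_prop
  have hp' : IsProbabilityMeasure (logNormLaw w (k + 2)) :=
    Measure.isProbabilityMeasure_map (hlog _).aemeasurable
  have hp1 : IsProbabilityMeasure (radialLaw (tailProfile w) (k + 1)) := by
    rw [← map_tail_radialLaw hw]
    exact Measure.isProbabilityMeasure_map measurable_euclideanTail.aemeasurable
  have hp1' : IsProbabilityMeasure (logNormLaw (tailProfile w) (k + 1)) :=
    Measure.isProbabilityMeasure_map (hlog _).aemeasurable
  obtain ⟨c₁, hc₁⟩ := exists_lintegral_fun_norm k
  obtain ⟨c₂, hc₂⟩ := exists_lintegral_fun_norm (k + 1)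
  have hw' := measurable_tailProfile hw
  set B : (ℝ → ENNReal) → ENNReal := fun f => ∫⁻ r in Set.Ioi (0 : ℝ), ∫⁻ θ in Set.Ioo 0 Real.pi,
    ENNReal.ofReal (r ^ (k + 1)) * w r * (ENNReal.ofReal (Real.sin θ ^ k) *
      f (2 * Real.log r + 2 * Real.log (Real.sin θ))) with hB
  have h1 : ∀ f : ℝ → ENNReal, Measurable f →
      ∫⁻ x, f x ∂(logNormLaw (tailProfile w) (k + 1)) = c₁ * B f := by
    intro f hf
    rw [logNormLaw, lintegral_map hf (hlog _), lintegral_radialLaw hw' _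
      (f := fun x => f (2 * Real.log ‖x‖)) (by fun_prop),
      hc₁ (fun r => tailProfile w r * f (2 * Real.log r)) (by fun_prop)]
    congr 1
    have : ∀ r, ENNReal.ofReal (r ^ k) * (tailProfile w r * f (2 * Real.log r)) =
        ∫⁻ t, ENNReal.ofReal (r ^ k) * (w (Real.sqrt (t ^ 2 + r ^ 2)) * f (2 * Real.log r)) := by
      intro r
      rw [lintegral_const_mul _ (by fun_prop), lintegral_mul_const _ (by fun_prop), tailProfile]
    simp only [this]
    rw [lintegral_polar_upper (F := fun t r => ENNReal.ofReal (r ^ k) *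
      (w (Real.sqrt (t ^ 2 + r ^ 2)) * f (2 * Real.log r)))
      (by unfold Function.uncurry; fun_prop)]
    refine setLIntegral_congr_fun measurableSet_Ioi fun r (hr : 0 < r) => ?_
    refine setLIntegral_congr_fun measurableSet_Ioo fun θ hθ => ?_
    have hs := Real.sin_pos_of_mem_Ioo hθ
    have e1 : Real.sqrt ((r * Real.cos θ) ^ 2 + (r * Real.sin θ) ^ 2) = r := by
      rw [show (r * Real.cos θ) ^ 2 + (r * Real.sin θ) ^ 2 = r ^ 2 by
        linear_combination r ^ 2 * Real.sin_sq_add_cos_sq θ, Real.sqrt_sq hr.le]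
    simp only [e1]
    rw [Real.log_mul hr.ne' hs.ne', mul_add, mul_pow, ENNReal.ofReal_mul (by positivity),
      pow_succ r, ENNReal.ofReal_mul (by positivity)]
    ring
  have h2 : ∀ f : ℝ → ENNReal, Measurable f →
      ∫⁻ x, f x ∂((logNormLaw w (k + 2)).conv (logSinLaw k)) =
        c₂ * ENNReal.ofReal (sinPowIntegral k)⁻¹ * B f := by
    intro f hf
    have hfm : Measurable fun x => ∫⁻ θ, f (x + 2 * Real.log (Real.sin θ)) ∂(sinPowLaw k) :=
      Measurable.lintegral_prod_right'
        (f := fun z : ℝ × ℝ => f (z.1 + 2 * Real.log (Real.sin z.2))) (by fun_prop)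
    rw [Measure.lintegral_conv hf, logSinLaw]
    have : ∀ x, ∫⁻ y, f (x + y) ∂((sinPowLaw k).map fun x => 2 * Real.log (Real.sin x)) =
        ∫⁻ θ, f (x + 2 * Real.log (Real.sin θ)) ∂(sinPowLaw k) := fun x =>
      lintegral_map (by fun_prop) measurable_two_mul_log_sin
    simp only [this]
    rw [logNormLaw, lintegral_map hfm (hlog _), lintegral_radialLaw hw _
      (f := fun x => ∫⁻ θ, f (2 * Real.log ‖x‖ + 2 * Real.log (Real.sin θ)) ∂(sinPowLaw k))
      (hfm.comp (hlog _)),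
      hc₂ (fun r => w r * ∫⁻ θ, f (2 * Real.log r + 2 * Real.log (Real.sin θ)) ∂(sinPowLaw k))
      (hw.mul (hfm.comp (by fun_prop : Measurable fun r : ℝ => 2 * Real.log r))), mul_assoc]
    congr 1
    rw [hB, ← lintegral_const_mul' _ _ ENNReal.ofReal_ne_top]
    refine lintegral_congr fun r => ?_
    rw [lintegral_sinPowLaw k (by fun_prop), lintegral_const_mul _ (by fun_prop)]
    ring
  -- Both sides are multiples of the same functional `B`, and both are probability measures; testing
  -- with `1` identifies the multiples.
  have e1 := h1 1 measurable_const
  have e2 := h2 1 measurable_const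
  simp only [Pi.one_apply, lintegral_one, measure_univ] at e1 e2
  have hB0 : B 1 ≠ 0 := fun h => by simp [h] at e1
  have hBt : B 1 ≠ ⊤ := fun h => by
    rw [h] at e1
    rcases eq_or_ne c₁ 0 with h0 | h0
    · simp [h0] at e1
    · simp [ENNReal.mul_top h0] at e1
  have hcc : c₁ = c₂ * ENNReal.ofReal (sinPowIntegral k)⁻¹ :=
    (ENNReal.mul_left_inj hB0 hBt).1 (e1.symm.trans e2)
  refine Measure.ext_of_lintegral _ fun f hf => ?_
  rw [h1 f hf, h2 f hf, hcc]

/-- Splitting the first column off a Gram matrix of independent rotationally invariant columns. -/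
theorem measurePreserving_splitFirst {w : ℝ → ENNReal} (hw : Measurable w) (d q : ℕ)
    [hp : IsProbabilityMeasure (radialLaw w (d + 1))] :
    MeasurePreserving (fun c : Fin (q + 1) → EuclideanSpace ℝ (Fin (d + 1)) =>
        (c 0, fun j : Fin q => euclideanTail (alignFirst (c 0) (c j.succ))))
      (Measure.pi fun _ => radialLaw w (d + 1))
      ((radialLaw w (d + 1)).prod (Measure.pi fun _ => radialLaw (tailProfile w) d)) := by
  have hp1 : IsProbabilityMeasure (radialLaw (tailProfile w) d) := by
    rw [← map_tail_radialLaw hw]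
    exact Measure.isProbabilityMeasure_map measurable_euclideanTail.aemeasurable
  have h1 := measurePreserving_piFinSuccAbove (α := fun _ : Fin (q + 1) =>
    EuclideanSpace ℝ (Fin (d + 1))) (fun _ => radialLaw w (d + 1)) 0
  have h2 : MeasurePreserving (fun z : EuclideanSpace ℝ (Fin (d + 1)) ×
      (Fin q → EuclideanSpace ℝ (Fin (d + 1))) =>
        (z.1, fun j => euclideanTail (alignFirst z.1 (z.2 j))))
      ((radialLaw w (d + 1)).prod (Measure.pi fun _ => radialLaw w (d + 1)))
      ((radialLaw w (d + 1)).prod (Measure.pi fun _ => radialLaw (tailProfile w) d)) := by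
    -- For each fixed `u` the reflection preserves the radial law, so the law of the shortened
    -- columns does not depend on `u`; this yields independence.
    refine (MeasurePreserving.id (radialLaw w (d + 1))).skew_product
      (g := fun (u : EuclideanSpace ℝ (Fin (d + 1)))
        (c : Fin q → EuclideanSpace ℝ (Fin (d + 1))) (j : Fin q) =>
          euclideanTail (alignFirst u (c j))) ?_
      (Filter.Eventually.of_forall fun u => ?_)
    · refine measurable_pi_lambda _ fun j => measurable_euclideanTail.comp ?_
      exact measurable_alignFirst.comp
        (measurable_fst.prodMk ((measurable_pi_apply j).comp measurable_snd))
    · have hU : Measurable (alignFirst u) := measurable_alignFirst.comp measurable_prodMk_left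
      refine (measurePreserving_pi (fun _ => radialLaw w (d + 1))
        (fun _ : Fin q => radialLaw (tailProfile w) d)
        (f := fun _ x => euclideanTail (alignFirst u x)) fun _ => ?_).map_eq
      exact (⟨measurable_euclideanTail, map_tail_radialLaw hw d⟩ : MeasurePreserving _ _ _).comp
        ⟨hU, map_alignFirst_radialLaw hw u⟩
  exact h2.comp h1

theorem radialLaw_ae_ne_zero (w : ℝ → ENNReal) (d : ℕ) : ∀ᵐ x ∂(radialLaw w (d + 1)), x ≠ 0 :=
  (withDensity_absolutelyContinuous _ _).ae_le (Measure.ae_ne volume 0)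

/-- The log-determinant of the Gram matrix of independent rotationally invariant columns is
distributed as a sum of independent radial and angular terms. -/
theorem charFun_log_gramDet (p : ℕ) : ∀ (d : ℕ) (w : ℝ → ENNReal), p ≤ d → Measurable w →
    IsProbabilityMeasure (radialLaw w d) →
    (∀ᵐ c ∂(Measure.pi fun _ : Fin p => radialLaw w d), gramDet c ≠ 0) ∧
    ∀ t, charFun ((Measure.pi fun _ : Fin p => radialLaw w d).map fun c => Real.log (gramDet c)) t =
      charFun (logNormLaw w d) t ^ p *
        ∏ i ∈ Finset.range (p - 1), charFun (logSinLaw (d - 2 - i)) t ^ (p - 1 - i) := by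
  induction p with
  | zero =>
    intro d w _ _ _
    have h : ∀ c : Fin 0 → EuclideanSpace ℝ (Fin d), gramDet c = 1 := fun c => by simp [gramDet]
    refine ⟨Filter.Eventually.of_forall fun c => by simp [h], fun t => ?_⟩
    simp [h, Measure.map_const]
  | succ q ih =>
    intro d w hqd hw hp
    obtain ⟨d, rfl⟩ : ∃ e, d = e + 1 := ⟨d - 1, by omega⟩
    have hp1 : IsProbabilityMeasure (radialLaw (tailProfile w) d) := by
      rw [← map_tail_radialLaw hw]
      exact Measure.isProbabilityMeasure_map measurable_euclideanTail.aemeasurable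
    obtain ⟨ih0, ih1⟩ := ih d (tailProfile w) (by omega) (measurable_tailProfile hw) hp1
    have hT := measurePreserving_splitFirst hw d q
    have hprod : ∀ᵐ z ∂((radialLaw w (d + 1)).prod
        (Measure.pi fun _ : Fin q => radialLaw (tailProfile w) d)), z.1 ≠ 0 ∧ gramDet z.2 ≠ 0 :=
      (Measure.quasiMeasurePreserving_fst.ae (radialLaw_ae_ne_zero w d)).and
        (Measure.quasiMeasurePreserving_snd.ae ih0)
    have hae := hT.quasiMeasurePreserving.ae hprod
    have hlog : Measurable fun x : EuclideanSpace ℝ (Fin (d + 1)) => 2 * Real.log ‖x‖ := by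
      fun_prop
    have hlg : Measurable fun c : Fin q → EuclideanSpace ℝ (Fin d) => Real.log (gramDet c) :=
      Real.measurable_log.comp measurable_gramDet
    refine ⟨hae.mono fun c hc => ?_, fun t => ?_⟩
    · rw [gramDet_eq_mul_gramDet_tail c hc.1]
      exact mul_ne_zero (pow_ne_zero _ (norm_ne_zero_iff.2 hc.1)) hc.2
    have hlaw : (Measure.pi fun _ : Fin (q + 1) => radialLaw w (d + 1)).map
        (fun c => Real.log (gramDet c)) = (logNormLaw w (d + 1)).conv
        ((Measure.pi fun _ : Fin q => radialLaw (tailProfile w) d).map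
          fun c => Real.log (gramDet c)) := by
      rw [logNormLaw, Measure.conv, Measure.map_prod_map _ _ hlog hlg,
        Measure.map_map measurable_add (hlog.prodMap hlg), ← hT.map_eq,
        Measure.map_map (measurable_add.comp (hlog.prodMap hlg)) hT.measurable]
      refine Measure.map_congr (hae.mono fun c hc => ?_)
      simp only [Function.comp_apply, Prod.map_apply]
      rw [gramDet_eq_mul_gramDet_tail c hc.1, Real.log_mul
        (pow_ne_zero _ (norm_ne_zero_iff.2 hc.1)) hc.2, Real.log_pow]
      norm_num
    have hpm : IsProbabilityMeasure (logNormLaw w (d + 1)) :=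
      Measure.isProbabilityMeasure_map hlog.aemeasurable
    have hpl : IsProbabilityMeasure ((Measure.pi fun _ : Fin q =>
        radialLaw (tailProfile w) d).map fun c => Real.log (gramDet c)) :=
      Measure.isProbabilityMeasure_map hlg.aemeasurable
    rw [hlaw, charFun_conv, ih1]
    rcases q with _ | q
    · simp
    obtain ⟨e, rfl⟩ : ∃ e, d = e + 1 := ⟨d - 1, by omega⟩
    -- Each of the `q + 1` remaining columns carries one new angular factor of exponent `e`; this is
    -- the `i = 0` term, and the inductive product is shifted by one.
    rw [logNormLaw_tailProfile hw e, charFun_conv, Nat.add_sub_cancel, Nat.add_sub_cancel,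
      Finset.prod_range_succ' _ q]
    have h1 : ∀ i, e + 1 + 1 - 2 - (i + 1) = e + 1 - 2 - i := fun i => by omega
    have h2 : ∀ i, q + 1 - (i + 1) = q - i := fun i => by omega
    have h3 : ∏ i ∈ Finset.range q,
        charFun (logSinLaw (e + 1 + 1 - 2 - (i + 1))) t ^ (q + 1 - (i + 1)) =
        ∏ i ∈ Finset.range q, charFun (logSinLaw (e + 1 - 2 - i)) t ^ (q - i) :=
      Finset.prod_congr rfl fun i _ => by rw [h1 i, h2 i]
    rw [h3]
    simp only [Nat.sub_zero, show e + 1 + 1 - 2 = e by omega]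
    ring

/-! ### From admissible pairs to laws on the line, and the law of `W` -/

/-- Admissibility does not assume `g` or `h` measurable; measurability of the weights is recovered
from monotonicity on both sides of the mode. -/
theorem measurable_of_unimodal {f : ℝ → ℝ} {x₀ : ℝ} (h1 : MonotoneOn f (Set.Iic x₀))
    (h2 : AntitoneOn f (Set.Ici x₀)) : Measurable f := by
  have m1 : Monotone fun x => f (min x x₀) := fun x y hxy =>
    h1 (Set.mem_Iic.2 (min_le_right _ _)) (Set.mem_Iic.2 (min_le_right _ _)) (min_le_min_right _ hxy)
  have m2 : Antitone fun x => f (max x x₀) := fun x y hxy =>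
    h2 (Set.mem_Ici.2 (le_max_right _ _)) (Set.mem_Ici.2 (le_max_right _ _)) (max_le_max_right _ hxy)
  have : f = fun x => if x ≤ x₀ then f (min x x₀) else f (max x x₀) := by
    ext x
    split_ifs with h
    · rw [min_eq_left h]
    · rw [max_eq_left (not_le.1 h).le]
  rw [this]
  exact Measurable.ite measurableSet_Iic m1.measurable m2.measurable

theorem Admissible.measurable_laplaceWeight {g h : ℝ → ℝ} (H : Admissible g h) {n : ℕ}
    (hn : 1 ≤ n) : Measurable (laplaceWeight g h n) := by
  obtain ⟨x₀, δ, _, _, ha, _⟩ := H.exists_center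
  exact measurable_of_unimodal (ha n hn).2.2.1 (ha n hn).2.2.2

theorem Admissible.laplaceWeight_nonneg {g h : ℝ → ℝ} (H : Admissible g h) (n : ℕ) (x : ℝ) :
    0 ≤ laplaceWeight g h n x :=
  mul_nonneg (H.g_nonneg x) (Real.exp_pos _).le

/-- The law with density proportional to `laplaceWeight g h n`. -/
noncomputable def laplaceLaw (g h : ℝ → ℝ) (n : ℕ) : Measure ℝ :=
  volume.withDensity fun s =>
    ENNReal.ofReal ((∫ y, laplaceWeight g h n y)⁻¹ * laplaceWeight g h n s)

theorem lintegral_comp_exp {f : ℝ → ENNReal} :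
    ∫⁻ r in Set.Ioi (0 : ℝ), f r = ∫⁻ s, ENNReal.ofReal (Real.exp s) * f (Real.exp s) := by
  have h := lintegral_image_eq_lintegral_abs_deriv_mul (s := Set.univ) (f := Real.exp)
    (f' := Real.exp) MeasurableSet.univ
    (fun x _ => (Real.hasDerivAt_exp x).hasDerivWithinAt) Real.exp_injective.injOn f
  simpa [Set.image_univ, Real.range_exp, abs_of_pos (Real.exp_pos _)] using h

/-- Substituting `r = exp s` in polar coordinates produces the Jacobian `exp (n s)`, which is what
the `-s` in `H (exp s) - s` absorbs. -/
theorem RadiallyAdmissible.exists_profile {G H : ℝ → ℝ} (hGH : RadiallyAdmissible G H) {n : ℕ}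
    (hn : 1 ≤ n) (hp : IsProbabilityMeasure (radialMeasure G H n)) :
    ∃ w : ℝ → ENNReal, Measurable w ∧ radialMeasure G H n = radialLaw w n ∧
      logNormLaw w n =
        (laplaceLaw (fun s => G (Real.exp s)) (fun s => H (Real.exp s) - s) n).map
          fun x => 2 * x := by
  obtain ⟨k, rfl⟩ : ∃ k, n = k + 1 := ⟨n - 1, by omega⟩
  have hA : Admissible (fun s => G (Real.exp s)) (fun s => H (Real.exp s) - s) := hGH
  set ρ := laplaceWeight (fun s => G (Real.exp s)) (fun s => H (Real.exp s) - s) (k + 1) with hρ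
  have hρm : Measurable ρ := hA.measurable_laplaceWeight hn
  have hρ0 : ∀ x, 0 ≤ ρ x := hA.laplaceWeight_nonneg _
  set Z := ∫⁻ s, radialWeight G H (k + 1) s with hZ
  have hZ0 : Z ≠ 0 := by
    intro h0
    have h1 : volume.withDensity (radialWeight G H (k + 1)) Set.univ = 0 := by
      rw [withDensity_apply _ MeasurableSet.univ, Measure.restrict_univ, ← hZ, h0]
    have h2 := hp.measure_univ
    rw [radialMeasure, Measure.smul_apply, h1, smul_zero] at h2
    exact zero_ne_one h2
  -- The profile is written through the weight on the line, whose measurability is known. It agrees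
  -- with the given density except possibly at the origin.
  set w : ℝ → ENNReal := fun r => if 0 < r then
    Z⁻¹ * ENNReal.ofReal (ρ (Real.log r) * Real.exp (-((k + 1 : ℕ) : ℝ) * Real.log r)) else 0 with hw
  have hwm : Measurable w := by
    refine Measurable.ite measurableSet_Ioi ?_ measurable_const
    exact measurable_const.mul (ENNReal.measurable_ofReal.comp
      ((hρm.comp Real.measurable_log).mul (by fun_prop)))
  have hlaw : radialMeasure G H (k + 1) = radialLaw w (k + 1) := by
    rw [radialMeasure, radialLaw, ← hZ, ← withDensity_smul' _ _ (ENNReal.inv_ne_top.2 hZ0)]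
    refine withDensity_congr_ae ((Measure.ae_ne volume 0).mono fun x hx => ?_)
    have hx' : 0 < ‖x‖ := norm_pos_iff.2 hx
    simp only [Pi.smul_apply, smul_eq_mul, hw, if_pos hx', radialWeight]
    congr 2
    rw [hρ, laplaceWeight, Real.exp_log hx', mul_assoc, ← Real.exp_add]
    congr 2
    ring
  rw [hlaw] at hp
  obtain ⟨c, hc⟩ := exists_lintegral_fun_norm k
  have hlog : Measurable fun x : EuclideanSpace ℝ (Fin (k + 1)) => 2 * Real.log ‖x‖ := by fun_prop
  have hlp : IsProbabilityMeasure (logNormLaw w (k + 1)) :=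
    Measure.isProbabilityMeasure_map hlog.aemeasurable
  have h1 : ∀ f : ℝ → ENNReal, Measurable f → ∫⁻ x, f x ∂(logNormLaw w (k + 1)) =
      c * Z⁻¹ * ∫⁻ s, ENNReal.ofReal (ρ s) * f (2 * s) := by
    intro f hf
    rw [logNormLaw, lintegral_map hf hlog, lintegral_radialLaw hwm _
      (f := fun x => f (2 * Real.log ‖x‖)) (by fun_prop),
      hc (fun r => w r * f (2 * Real.log r)) (by fun_prop), lintegral_comp_exp, mul_assoc,
      ← lintegral_const_mul Z⁻¹ (by fun_prop)]
    congr 1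
    refine lintegral_congr fun s => ?_
    simp only [hw, if_pos (Real.exp_pos s), Real.log_exp]
    have e1 : ENNReal.ofReal (Real.exp s) * ENNReal.ofReal (Real.exp s ^ k) *
        ENNReal.ofReal (ρ s * Real.exp (-((k + 1 : ℕ) : ℝ) * s)) = ENNReal.ofReal (ρ s) := by
      rw [← ENNReal.ofReal_mul (by positivity), ← ENNReal.ofReal_mul (by positivity)]
      congr 1
      rw [← pow_succ', ← Real.exp_nat_mul, mul_left_comm, ← Real.exp_add, neg_mul,
        add_neg_cancel, Real.exp_zero, mul_one]
    rw [← e1]; ring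
  have e1 := h1 1 measurable_const
  simp only [Pi.one_apply, lintegral_one, measure_univ, mul_one] at e1
  set J := ∫⁻ s, ENNReal.ofReal (ρ s) with hJ
  have hJ0 : J ≠ 0 := fun h => by simp [h] at e1
  have hJt : J ≠ ⊤ := fun h => by
    rw [h] at e1
    rcases eq_or_ne (c * Z⁻¹) 0 with h0 | h0
    · simp [h0] at e1
    · simp [ENNReal.mul_top h0] at e1
  have hint : Integrable ρ :=
    ⟨hρm.aestronglyMeasurable, by
      rw [hasFiniteIntegral_iff_ofReal (Filter.Eventually.of_forall hρ0)]
      exact hJt.lt_top⟩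
  have hJ' : J = ENNReal.ofReal (∫ s, ρ s) :=
    (ofReal_integral_eq_lintegral_ofReal hint (Filter.Eventually.of_forall hρ0)).symm
  have hpos : 0 < ∫ s, ρ s := by
    rcases (integral_nonneg hρ0 : 0 ≤ ∫ s, ρ s).lt_or_eq with h | h
    · exact h
    · exact absurd (by rw [hJ', ← h, ENNReal.ofReal_zero]) hJ0
  have hcZ : c * Z⁻¹ = ENNReal.ofReal (∫ s, ρ s)⁻¹ := by
    rw [ENNReal.ofReal_inv_of_pos hpos, ← hJ']
    exact ENNReal.eq_inv_of_mul_eq_one_left e1.symm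
  refine ⟨w, hwm, hlaw, ?_⟩
  refine Measure.ext_of_lintegral _ fun f hf => ?_
  rw [h1 f hf, lintegral_map hf (by fun_prop), laplaceLaw,
    lintegral_withDensity_eq_lintegral_mul _ (hρm.const_mul _).ennreal_ofReal (by fun_prop), hcZ,
    ← lintegral_const_mul _ (by fun_prop)]
  refine lintegral_congr fun s => ?_
  simp only [Pi.mul_apply]
  rw [ENNReal.ofReal_mul (inv_nonneg.2 hpos.le), mul_assoc]

/-- The index set of the independent pieces of a log-determinant with `p` columns. -/
abbrev PieceIndex (p : ℕ) : Type := Fin p ⊕ Σ i : Fin (p - 1), Fin (p - 1 - i)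

/-- The laws of the independent pieces of a log-determinant. -/
noncomputable def pieceLaw (g h : ℝ → ℝ) (n p : ℕ) : PieceIndex p → Measure ℝ
  | Sum.inl _ => (laplaceLaw g h n).map fun x => 2 * x
  | Sum.inr k => logSinLaw (n - 2 - k.1)

/-- Both laws have the same characteristic function: powers of a factor correspond to repeated
indices in `PieceIndex p`. -/
theorem map_logDetGram {G H : ℝ → ℝ} (hGH : RadiallyAdmissible G H) {n p : ℕ}
    (hp : 1 ≤ p) (hpn : p ≤ n) {Ω : Type*} [MeasurableSpace Ω] {P : Measure Ω}
    [IsProbabilityMeasure P] {A : Ω → Matrix (Fin n) (Fin p) ℝ}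
    (hA : ∀ j, HasLaw (fun ω => euclideanCol (A ω) j) (radialMeasure G H n) P)
    (hind : iIndepFun (fun (j : Fin p) (ω : Ω) => euclideanCol (A ω) j) P) :
    AEMeasurable (fun ω => logDetGram (A ω)) P ∧
    (∀ k, IsProbabilityMeasure
      (pieceLaw (fun s => G (Real.exp s)) (fun s => H (Real.exp s) - s) n p k)) ∧
    P.map (fun ω => logDetGram (A ω)) =
      (Measure.pi (pieceLaw (fun s => G (Real.exp s)) (fun s => H (Real.exp s) - s) n p)).map
        fun x => ∑ k, x k := by
  have hprob : IsProbabilityMeasure (radialMeasure G H n) := by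
    have h := hA ⟨0, by omega⟩
    rw [← h.map_eq]
    exact Measure.isProbabilityMeasure_map h.aemeasurable
  obtain ⟨w, hwm, hw, hlog⟩ := hGH.exists_profile (by omega) hprob
  have hwp : IsProbabilityMeasure (radialLaw w n) := hw ▸ hprob
  obtain ⟨-, hchar⟩ := charFun_log_gramDet p n w hpn hwm hwp
  have hWeq : (fun ω => logDetGram (A ω)) =
      (fun c => Real.log (gramDet c)) ∘ fun ω j => euclideanCol (A ω) j := by
    ext ω
    simp only [Function.comp_apply, logDetGram, gramDet]
    congr 2
    ext i j
    simp [Matrix.mul_apply, euclideanCol, PiLp.inner_apply, mul_comm]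
  have hlg : Measurable fun c : Fin p → EuclideanSpace ℝ (Fin n) => Real.log (gramDet c) :=
    Real.measurable_log.comp measurable_gramDet
  have hcol : AEMeasurable (fun ω j => euclideanCol (A ω) j) P :=
    aemeasurable_pi_lambda _ fun j => (hA j).aemeasurable
  have hjoint : P.map (fun ω j => euclideanCol (A ω) j) = Measure.pi fun _ => radialLaw w n := by
    rw [(iIndepFun_iff_map_fun_eq_pi_map fun j => (hA j).aemeasurable).1 hind]
    congr 1
    ext1 j
    rw [(hA j).map_eq, hw]
  have hpl : ∀ k, IsProbabilityMeasure
      (pieceLaw (fun s => G (Real.exp s)) (fun s => H (Real.exp s) - s) n p k) := by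
    rintro (j | k)
    · simp only [pieceLaw]
      rw [← hlog]
      exact Measure.isProbabilityMeasure_map
        (by fun_prop : Measurable fun x : EuclideanSpace ℝ (Fin n) => 2 * Real.log ‖x‖).aemeasurable
    · simp only [pieceLaw]
      infer_instance
  have hWm : AEMeasurable (fun ω => logDetGram (A ω)) P := hWeq ▸ hlg.comp_aemeasurable hcol
  refine ⟨hWm, hpl, ?_⟩
  have hW : P.map (fun ω => logDetGram (A ω)) =
      (Measure.pi fun _ : Fin p => radialLaw w n).map fun c => Real.log (gramDet c) := by
    rw [hWeq, ← hjoint, AEMeasurable.map_map_of_aemeasurable hlg.aemeasurable hcol]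
  have i1 : IsProbabilityMeasure (P.map fun ω => logDetGram (A ω)) :=
    Measure.isProbabilityMeasure_map hWm
  have i2 : IsProbabilityMeasure ((Measure.pi (pieceLaw (fun s => G (Real.exp s))
      (fun s => H (Real.exp s) - s) n p)).map fun x => ∑ k, x k) :=
    Measure.isProbabilityMeasure_map (by fun_prop)
  refine Measure.ext_of_charFun (funext fun t => ?_)
  rw [charFun_map_sum_pi_eq_prod, Finset.prod_apply, hW, hchar t, Fintype.prod_sum_type,
    Fintype.prod_sigma]
  simp only [pieceLaw, ← hlog, Finset.prod_const, Finset.card_univ, Fintype.card_fin]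
  rw [Finset.prod_range]

/-! ### Laplace's method for the radial pieces -/

theorem exp_neg_sq_div_four_le (u : ℝ) : Real.exp (-(u ^ 2 / 4)) * (1 + |u|) ^ 8 ≤ 200000 := by
  have h1 : ((1 + u ^ 2) / 4) ^ 4 / (Nat.factorial 4 : ℝ) ≤ Real.exp ((1 + u ^ 2) / 4) :=
    Real.pow_div_factorial_le_exp _ (by positivity) 4
  have h2 : (1 + |u|) ^ 8 ≤ 16 * (1 + u ^ 2) ^ 4 := by
    have h3 : (1 + |u|) ^ 2 ≤ 2 * (1 + u ^ 2) := by nlinarith [sq_nonneg (1 - |u|), sq_abs u]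
    calc (1 + |u|) ^ 8 = ((1 + |u|) ^ 2) ^ 4 := by ring
      _ ≤ (2 * (1 + u ^ 2)) ^ 4 := by gcongr
      _ = _ := by ring
  have h4 : Real.exp ((1 + u ^ 2) / 4) = Real.exp (1 / 4) * Real.exp (u ^ 2 / 4) := by
    rw [← Real.exp_add]; ring_nf
  have h5 : Real.exp (1 / 4) ≤ 2 := by
    have := Real.exp_one_lt_d9
    have h6 : Real.exp (1 / 4) ^ 4 = Real.exp 1 := by rw [← Real.exp_nat_mul]; norm_num
    by_contra h
    have h7 : (2 : ℝ) ^ 4 ≤ Real.exp (1 / 4) ^ 4 := by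
      have := (not_le.1 h).le
      gcongr
    norm_num at h7
    linarith
  have h8 : (0 : ℝ) < Real.exp (u ^ 2 / 4) := Real.exp_pos _
  rw [Real.exp_neg, inv_mul_le_iff₀ h8]
  rw [h4, show (Nat.factorial 4 : ℝ) = 24 by norm_num [Nat.factorial]] at h1
  have h9 : Real.exp (1 / 4) * Real.exp (u ^ 2 / 4) ≤ 2 * Real.exp (u ^ 2 / 4) :=
    mul_le_mul_of_nonneg_right h5 h8.le
  -- Here `12288 = 2 * 24 * 4 ^ 4`, and `16 * 12288 = 196608` gives the final constant.
  have h10 : (1 + u ^ 2) ^ 4 ≤ 12288 * Real.exp (u ^ 2 / 4) := by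
    have : ((1 + u ^ 2) / 4) ^ 4 / 24 = (1 + u ^ 2) ^ 4 / 6144 := by ring
    rw [this] at h1
    rw [div_le_iff₀ (by norm_num)] at h1
    linarith
  linarith

theorem abs_mul_exp_neg_sub_one_le (q B : ℝ) :
    |(1 + q) * Real.exp (-B) - 1| ≤ (|q| + |B|) * Real.exp |B| := by
  have h1 : Real.exp (-B) ≤ Real.exp |B| := Real.exp_le_exp.2 (neg_le_abs B)
  have h2 : |Real.exp (-B) - 1| ≤ |B| * Real.exp |B| := by
    rw [abs_le]
    constructor
    · have h3 := Real.add_one_le_exp (-B)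
      have h4 : |B| ≤ |B| * Real.exp |B| :=
        le_mul_of_one_le_right (abs_nonneg _) (Real.one_le_exp (abs_nonneg _))
      linarith [le_abs_self B]
    · have h3 := Real.add_one_le_exp B
      have h4 : Real.exp (-B) * Real.exp B = 1 := by rw [← Real.exp_add]; simp
      have h5 : Real.exp (-B) - 1 ≤ -B * Real.exp (-B) := by
        have := mul_le_mul_of_nonneg_left h3 (Real.exp_pos (-B)).le
        linarith
      have h6 : -B * Real.exp (-B) ≤ |B| * Real.exp |B| :=
        (mul_le_mul_of_nonneg_right (neg_le_abs B) (Real.exp_pos _).le).trans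
          (mul_le_mul_of_nonneg_left h1 (abs_nonneg _))
      linarith
  calc |(1 + q) * Real.exp (-B) - 1| = |q * Real.exp (-B) + (Real.exp (-B) - 1)| := by ring_nf
    _ ≤ |q| * Real.exp (-B) + |Real.exp (-B) - 1| := by
        refine (abs_add_le _ _).trans ?_
        rw [abs_mul, abs_of_pos (Real.exp_pos _)]
    _ ≤ |q| * Real.exp |B| + |B| * Real.exp |B| :=
        add_le_add (mul_le_mul_of_nonneg_left h1 (abs_nonneg _)) h2
    _ = _ := by ring

theorem exp_neg_le_six_div_cube {x : ℝ} (hx : 0 < x) : Real.exp (-x) ≤ 6 / x ^ 3 := by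
  have h := Real.pow_div_factorial_le_exp x hx.le 3
  rw [show (Nat.factorial 3 : ℝ) = 6 by norm_num [Nat.factorial]] at h
  rw [Real.exp_neg, inv_le_comm₀ (Real.exp_pos _) (by positivity), inv_div]
  exact h

set_option maxHeartbeats 1000000 in
/-- The rescaled weights are close to the Gaussian weight, uniformly up to a factor `n^{-1/2}`. -/
theorem Admissible.exists_gaussian_approx {g h : ℝ → ℝ} (H : Admissible g h) :
    ∃ (x₀ l K : ℝ) (n₁ : ℕ), 0 < l ∧ 0 < K ∧ 1 ≤ n₁ ∧ ∀ n, n₁ ≤ n →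
      0 < laplaceWeight g h n x₀ ∧ 1 ≤ Real.sqrt (n * l) ∧
      ∀ u : ℝ, |laplaceWeight g h n (x₀ + u / Real.sqrt (n * l)) / laplaceWeight g h n x₀ -
        Real.exp (-(u ^ 2 / 2))| * (1 + |u|) ^ 5 ≤ K / Real.sqrt (n * l) := by
  obtain ⟨x₀, δ, hδ, hmin, ha, -, -, hl, ⟨r, q, hb⟩, ⟨α, c, C, hα, hc, hC, htail⟩⟩ :=
    H.exists_center
  set l := deriv (deriv h) x₀ with hl_def
  have hg0 : 0 < g x₀ := by
    have h1 := (ha 1 le_rfl).2.1 (x₀ + 1) (by simp)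
    have h2 := H.laplaceWeight_nonneg 1 (x₀ + 1)
    have h3 : 0 < laplaceWeight g h 1 x₀ := h2.trans_lt h1
    exact pos_of_mul_pos_left h3 (Real.exp_pos _).le
  have hw : ∀ (n : ℕ) y, laplaceWeight g h n y / laplaceWeight g h n x₀ =
      g y / g x₀ * Real.exp (-(n * (h y - h x₀))) := by
    intro n y
    rw [laplaceWeight, laplaceWeight, mul_div_mul_comm, ← Real.exp_sub]
    congr 2; ring
  -- the local estimate
  have hloc : ∀ (n : ℕ) (y : ℝ), |y| ≤ δ →
      |laplaceWeight g h n (x₀ + y) / laplaceWeight g h n x₀ - Real.exp (-(n * l * y ^ 2 / 2))| ≤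
        Real.exp (-(n * l * y ^ 2 / 4)) * (|y| / (4 * δ) + n * l * |y| ^ 3 / (4 * δ)) := by
    intro n y hy
    have hy' := abs_le.1 hy
    obtain ⟨e1, e2, e3, e4⟩ := hb (x₀ + y) ⟨by linarith, by linarith⟩
    rw [add_sub_cancel_left] at e1 e2 e3 e4
    have hnl : 0 ≤ n * l := by positivity
    set B := n * l * r (x₀ + y) with hB
    have hB1 : |B| ≤ n * l * |y| ^ 3 / (4 * δ) := by
      rw [hB, abs_mul, abs_of_nonneg hnl]
      calc n * l * |r (x₀ + y)| ≤ n * l * (1 / (4 * δ) * |y| ^ 3) :=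
            mul_le_mul_of_nonneg_left e3 hnl
        _ = _ := by ring
    -- The constant `1 / (4δ)` in the expansion makes the remainder at most half of the quadratic
    -- term on the interval, so half of the Gaussian exponent survives.
    have hB2 : |B| ≤ n * l * y ^ 2 / 4 := by
      refine hB1.trans ?_
      rw [div_le_div_iff₀ (by positivity) (by norm_num), ← sq_abs y]
      have : n * l * |y| ^ 2 * |y| ≤ n * l * |y| ^ 2 * δ :=
        mul_le_mul_of_nonneg_left hy (by positivity)
      linarith
    have e5 : laplaceWeight g h n (x₀ + y) / laplaceWeight g h n x₀ -
        Real.exp (-(n * l * y ^ 2 / 2)) =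
        Real.exp (-(n * l * y ^ 2 / 2)) * ((1 + q y) * Real.exp (-B) - 1) := by
      rw [hw, e1, e2, mul_div_cancel_left₀ _ hg0.ne', add_sub_cancel_left,
        mul_sub (Real.exp _), mul_one, mul_left_comm (Real.exp _), ← Real.exp_add]
      congr 3; rw [hB]; ring
    rw [e5, abs_mul, abs_of_pos (Real.exp_pos _)]
    calc Real.exp (-(n * l * y ^ 2 / 2)) * |(1 + q y) * Real.exp (-B) - 1|
        ≤ Real.exp (-(n * l * y ^ 2 / 2)) * ((|q y| + |B|) * Real.exp (n * l * y ^ 2 / 4)) := by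
          refine mul_le_mul_of_nonneg_left ((abs_mul_exp_neg_sub_one_le _ _).trans ?_)
            (Real.exp_pos _).le
          exact mul_le_mul_of_nonneg_left (Real.exp_le_exp.2 hB2) (by positivity)
      _ = Real.exp (-(n * l * y ^ 2 / 4)) * (|q y| + |B|) := by
          rw [mul_left_comm, ← Real.exp_add, mul_comm]
          congr 2; ring
      _ ≤ _ := by
          refine mul_le_mul_of_nonneg_left (add_le_add ?_ hB1) (Real.exp_pos _).le
          calc |q y| ≤ _ := e4
            _ = _ := by ring
  -- The value at the edge of the interval bounds, by unimodality, all values farther out.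
  have hloc' : ∀ (n : ℕ) (y : ℝ), |y| = δ →
      laplaceWeight g h n (x₀ + y) / laplaceWeight g h n x₀ ≤
        5 / 4 * Real.exp (-(n * (l * δ ^ 2 / 4))) := by
    intro n y hy
    have hy' := abs_le.1 hy.le
    obtain ⟨e1, e2, e3, e4⟩ := hb (x₀ + y) ⟨by linarith, by linarith⟩
    rw [add_sub_cancel_left] at e1 e2 e3 e4
    rw [hy] at e3 e4
    have hq : 1 + q y ≤ 5 / 4 := by
      have : 1 / (4 * δ) * δ = 1 / 4 := by field_simp
      linarith [le_abs_self (q y)]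
    have hr : -(δ ^ 2 / 4) ≤ r (x₀ + y) := by
      have : 1 / (4 * δ) * δ ^ 3 = δ ^ 2 / 4 := by field_simp
      linarith [neg_abs_le (r (x₀ + y))]
    rw [hw, e1, e2, mul_div_cancel_left₀ _ hg0.ne']
    refine mul_le_mul hq (Real.exp_le_exp.2 ?_) (Real.exp_pos _).le (by norm_num)
    rw [neg_le_neg_iff, add_sub_cancel_left]
    refine mul_le_mul_of_nonneg_left ?_ (by positivity)
    rw [← sq_abs y, hy]
    have := mul_le_mul_of_nonneg_left hr hl.le
    linarith
  -- the tail estimate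
  obtain ⟨R, hR⟩ : ∃ R : ℝ, δ ≤ R ∧ h x₀ + 1 ≤ c / 2 * Real.log (1 + R) := by
    -- Beyond `R`, half of the logarithmic lower bound exceeds `h x₀ + 1`; the other half is kept
    -- for polynomial decay.
    refine ⟨max δ (Real.exp ((h x₀ + 1) / (c / 2))), le_max_left _ _, ?_⟩
    have h1 : (h x₀ + 1) / (c / 2) ≤ Real.log (1 + max δ (Real.exp ((h x₀ + 1) / (c / 2)))) := by
      rw [Real.le_log_iff_exp_le (by positivity)]
      linarith [le_max_right δ (Real.exp ((h x₀ + 1) / (c / 2)))]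
    rw [div_le_iff₀ (by positivity)] at h1
    linarith
  obtain ⟨hδR, hR⟩ := hR
  set K₂ := 12 * C / g x₀ + (1 + R) ^ 5 * (5 / 4 * (6 / (l * δ ^ 2 / 4) ^ 3)) with hK₂
  have hR0 : 0 < R := hδ.trans_le hδR
  have hK₂0 : 0 < K₂ := by positivity
  -- The conditions give `n ≥ 1`, `n l ≥ 1`, and a decay exponent `n c / 2` that beats the growth
  -- `α` of `g` and the weight of degree `5`.
  obtain ⟨n₁, hn₁⟩ := exists_nat_ge (max (max 1 (1 / l)) ((α + 5) / (c / 2)))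
  have hn₁1 : (1 : ℝ) ≤ n₁ := (le_max_left _ _).trans ((le_max_left _ _).trans hn₁)
  -- Three powers of `n` are needed: rescaling the weight costs `s ^ 5` with `s ^ 2 = n l`, and one
  -- factor `1 / s` must remain.
  have htl : ∀ n : ℕ, n₁ ≤ n → ∀ y, δ < |y| →
      laplaceWeight g h n (x₀ + y) / laplaceWeight g h n x₀ * (1 + |y|) ^ 5 ≤ K₂ / n ^ 3 := by
    intro n hn y hy
    have hnR : (n₁ : ℝ) ≤ n := by exact_mod_cast hn
    have hn0 : (0 : ℝ) < n := by linarith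
    have hn1 : 1 ≤ n := by exact_mod_cast hn₁1.trans hnR
    have hw0 : 0 < laplaceWeight g h n x₀ := mul_pos hg0 (Real.exp_pos _)
    rcases le_or_gt |y| R with hyR | hyR
    · have h1 : laplaceWeight g h n (x₀ + y) / laplaceWeight g h n x₀ ≤
          5 / 4 * Real.exp (-(n * (l * δ ^ 2 / 4))) := by
        rcases le_total 0 y with hy0 | hy0
        · rw [abs_of_nonneg hy0] at hy
          refine le_trans ?_ (hloc' n δ (abs_of_pos hδ))
          refine div_le_div_of_nonneg_right ?_ hw0.le
          exact (ha n hn1).2.2.2 (Set.mem_Ici.2 (by linarith)) (Set.mem_Ici.2 (by linarith))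
            (by linarith)
        · rw [abs_of_nonpos hy0] at hy
          refine le_trans ?_ (hloc' n (-δ) (by rw [abs_neg, abs_of_pos hδ]))
          refine div_le_div_of_nonneg_right ?_ hw0.le
          exact (ha n hn1).2.2.1 (Set.mem_Iic.2 (by linarith)) (Set.mem_Iic.2 (by linarith))
            (by linarith)
      have h2 : Real.exp (-(n * (l * δ ^ 2 / 4))) ≤ 6 / (l * δ ^ 2 / 4) ^ 3 / n ^ 3 := by
        refine (exp_neg_le_six_div_cube (by positivity)).trans (le_of_eq ?_)
        rw [mul_pow, div_div, mul_comm]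
      calc laplaceWeight g h n (x₀ + y) / laplaceWeight g h n x₀ * (1 + |y|) ^ 5
          ≤ 5 / 4 * (6 / (l * δ ^ 2 / 4) ^ 3 / n ^ 3) * (1 + R) ^ 5 := by
            refine mul_le_mul (h1.trans (by linarith)) ?_ (by positivity) (by positivity)
            gcongr
        _ = (1 + R) ^ 5 * (5 / 4 * (6 / (l * δ ^ 2 / 4) ^ 3)) / n ^ 3 := by ring
        _ ≤ K₂ / n ^ 3 := by
            refine div_le_div_of_nonneg_right ?_ (by positivity)
            rw [hK₂]
            have : 0 < 12 * C / g x₀ := by positivity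
            linarith
    · have hnot : x₀ + y ∉ Set.Icc (x₀ - δ) (x₀ + δ) := fun hm => by
        have : |y| ≤ δ := abs_le.2 ⟨by linarith [hm.1], by linarith [hm.2]⟩
        linarith
      obtain ⟨t1, t2⟩ := htail _ hnot
      rw [add_sub_cancel_left] at t1 t2
      set b := 1 + |y| with hb_def
      have hb1 : 1 ≤ b := by rw [hb_def]; linarith [abs_nonneg y]
      have hb0 : 0 < b := by linarith
      have h1 : 1 + |y| ^ α ≤ 2 * b ^ α := by
        have h2 : (1 : ℝ) ≤ b ^ α := Real.one_le_rpow hb1 hα.le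
        have h3 : |y| ^ α ≤ b ^ α :=
          Real.rpow_le_rpow (abs_nonneg _) (by rw [hb_def]; linarith) hα.le
        linarith
      have h2 : 1 + c / 2 * Real.log b ≤ h (x₀ + y) - h x₀ := by
        have h3 : Real.log (1 + R) ≤ Real.log b :=
          Real.log_le_log (by positivity) (by rw [hb_def]; linarith)
        have h4 : c / 2 * Real.log (1 + R) ≤ c / 2 * Real.log b :=
          mul_le_mul_of_nonneg_left h3 (by positivity)
        linarith
      have hlogb : 0 ≤ Real.log b := Real.log_nonneg hb1
      have hnc : α + 5 ≤ n * (c / 2) := by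
        have h3 : (α + 5) / (c / 2) ≤ n := (le_max_right _ _).trans (hn₁.trans hnR)
        rwa [div_le_iff₀ (by positivity)] at h3
      have h3 : Real.exp (-(n * (h (x₀ + y) - h x₀))) ≤
          Real.exp (-n) * (b ^ α * b ^ 5)⁻¹ := by
        have h4 : (b ^ α * b ^ 5)⁻¹ = Real.exp (-((α + 5) * Real.log b)) := by
          rw [Real.exp_neg, add_mul, Real.exp_add, mul_comm α, mul_comm 5,
            ← Real.rpow_def_of_pos hb0]
          congr 2
          rw [mul_comm, show (5 : ℝ) = ((5 : ℕ) : ℝ) by norm_num, Real.exp_nat_mul,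
            Real.exp_log hb0]
        rw [h4, ← Real.exp_add, Real.exp_le_exp]
        have h5 := mul_le_mul_of_nonneg_left h2 hn0.le
        have h6 := mul_le_mul_of_nonneg_right hnc hlogb
        have h7 : (n : ℝ) * (1 + c / 2 * Real.log b) = n + n * (c / 2) * Real.log b := by ring
        linarith
      have h7 : Real.exp (-(n : ℝ)) ≤ 6 / n ^ 3 := exp_neg_le_six_div_cube hn0
      have hbα : 0 < b ^ α := Real.rpow_pos_of_pos hb0 _
      rw [hw]
      calc g (x₀ + y) / g x₀ * Real.exp (-(n * (h (x₀ + y) - h x₀))) * b ^ 5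
          ≤ C * (2 * b ^ α) / g x₀ * (6 / n ^ 3 * (b ^ α * b ^ 5)⁻¹) * b ^ 5 := by
            refine mul_le_mul_of_nonneg_right (mul_le_mul ?_ (h3.trans ?_) (Real.exp_pos _).le
              (by positivity)) (by positivity)
            · refine div_le_div_of_nonneg_right (t2.trans ?_) hg0.le
              exact mul_le_mul_of_nonneg_left h1 hC.le
            · exact mul_le_mul_of_nonneg_right h7 (by positivity)
        _ = 12 * C / g x₀ / n ^ 3 := by field_simp; ring
        _ ≤ K₂ / n ^ 3 := by
            refine div_le_div_of_nonneg_right ?_ (by positivity)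
            rw [hK₂]
            have : 0 < (1 + R) ^ 5 * (5 / 4 * (6 / (l * δ ^ 2 / 4) ^ 3)) := by positivity
            linarith
  refine ⟨x₀, l, 200000 / δ + (200000 / δ + K₂ * l ^ 3), n₁, hl, by positivity,
    by exact_mod_cast hn₁1, fun n hn => ?_⟩
  have hnR : (n₁ : ℝ) ≤ n := by exact_mod_cast hn
  have hn0 : (0 : ℝ) < n := by linarith
  have hnl : 1 ≤ n * l := by
    have : 1 / l ≤ n := (le_max_right _ _).trans ((le_max_left _ _).trans (hn₁.trans hnR))
    rwa [div_le_iff₀ hl] at this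
  set s := Real.sqrt (n * l) with hs
  have hs1 : 1 ≤ s := Real.one_le_sqrt.2 hnl
  have hs0 : 0 < s := by linarith
  have hs2 : s ^ 2 = n * l := Real.sq_sqrt (by positivity)
  refine ⟨mul_pos hg0 (Real.exp_pos _), hs1, fun u => ?_⟩
  have hu2 : n * l * (u / s) ^ 2 = u ^ 2 := by rw [← hs2]; field_simp
  have hE := exp_neg_sq_div_four_le u
  have hu0 := abs_nonneg u
  have hE0 := Real.exp_pos (-(u ^ 2 / 4))
  rcases le_or_gt |u / s| δ with hle | hgt
  · have h1 := hloc n (u / s) hle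
    rw [hu2] at h1
    have h2 : |u / s| / (4 * δ) + n * l * |u / s| ^ 3 / (4 * δ) = (|u| + |u| ^ 3) / (4 * δ * s) := by
      rw [← hs2, abs_div, abs_of_pos hs0]
      field_simp
    rw [h2] at h1
    have h3 : |u| + |u| ^ 3 ≤ (1 + |u|) ^ 3 := by
      have : (1 + |u|) ^ 3 = 1 + 3 * |u| + 3 * |u| ^ 2 + |u| ^ 3 := by ring
      linarith [pow_nonneg hu0 2]
    have h4 : Real.exp (-(u ^ 2 / 4)) * ((|u| + |u| ^ 3) / (4 * δ * s)) * (1 + |u|) ^ 5 ≤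
        200000 / δ / s := by
      calc Real.exp (-(u ^ 2 / 4)) * ((|u| + |u| ^ 3) / (4 * δ * s)) * (1 + |u|) ^ 5
          ≤ Real.exp (-(u ^ 2 / 4)) * ((1 + |u|) ^ 3 / (4 * δ * s)) * (1 + |u|) ^ 5 := by gcongr
        _ = Real.exp (-(u ^ 2 / 4)) * (1 + |u|) ^ 8 / (4 * δ * s) := by ring
        _ ≤ 200000 / (4 * δ * s) := by gcongr
        _ ≤ 200000 / (δ * s) := by
            refine div_le_div_of_nonneg_left (by norm_num) (by positivity) ?_
            have := mul_pos hδ hs0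
            linarith
        _ = _ := by rw [div_div]
    calc _ ≤ Real.exp (-(u ^ 2 / 4)) * ((|u| + |u| ^ 3) / (4 * δ * s)) * (1 + |u|) ^ 5 :=
          mul_le_mul_of_nonneg_right h1 (by positivity)
      _ ≤ 200000 / δ / s := h4
      _ ≤ _ := by
          refine div_le_div_of_nonneg_right ?_ hs0.le
          have : 0 < 200000 / δ + K₂ * l ^ 3 := by positivity
          linarith
  · have h1 := htl n hn (u / s) hgt
    set W := laplaceWeight g h n (x₀ + u / s) / laplaceWeight g h n x₀ with hW
    have hW0 : 0 ≤ W := div_nonneg (H.laplaceWeight_nonneg _ _) (H.laplaceWeight_nonneg _ _)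
    rw [abs_div, abs_of_pos hs0] at h1 hgt
    rw [lt_div_iff₀ hs0] at hgt
    have h2 : W * (1 + |u|) ^ 5 ≤ K₂ * l ^ 3 / s := by
      have h3 : (1 + |u|) ^ 5 ≤ s ^ 5 * (1 + |u| / s) ^ 5 := by
        rw [← mul_pow, mul_add, mul_one, mul_div_cancel₀ _ hs0.ne']
        gcongr
      calc W * (1 + |u|) ^ 5 ≤ W * (s ^ 5 * (1 + |u| / s) ^ 5) :=
            mul_le_mul_of_nonneg_left h3 hW0
        _ = s ^ 5 * (W * (1 + |u| / s) ^ 5) := by ring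
        _ ≤ s ^ 5 * (K₂ / n ^ 3) := mul_le_mul_of_nonneg_left h1 (by positivity)
        _ = K₂ * l ^ 3 / s := by
            have : s ^ 6 = (n * l) ^ 3 := by rw [← hs2]; ring
            rw [mul_div_assoc', div_eq_div_iff (by positivity) hs0.ne']
            linear_combination K₂ * this
    have h3 : Real.exp (-(u ^ 2 / 2)) * (1 + |u|) ^ 5 ≤ 200000 / δ / s := by
      -- Outside the window `|u| > δ s`, which buys the factor `1 / s` for the Gaussian itself.
      have h4 : Real.exp (-(u ^ 2 / 2)) ≤ Real.exp (-(u ^ 2 / 4)) * ((1 + |u|) ^ 3 / (δ * s)) := by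
        have h5 : 1 ≤ (1 + |u|) ^ 3 / (δ * s) := by
          rw [one_le_div (by positivity)]
          have : (1 + |u|) ^ 3 = 1 + 3 * |u| + 3 * |u| ^ 2 + |u| ^ 3 := by ring
          linarith [pow_nonneg hu0 2, pow_nonneg hu0 3]
        calc Real.exp (-(u ^ 2 / 2)) ≤ Real.exp (-(u ^ 2 / 4)) :=
              Real.exp_le_exp.2 (by linarith [sq_nonneg u])
          _ ≤ _ := le_mul_of_one_le_right hE0.le h5
      calc Real.exp (-(u ^ 2 / 2)) * (1 + |u|) ^ 5
          ≤ Real.exp (-(u ^ 2 / 4)) * ((1 + |u|) ^ 3 / (δ * s)) * (1 + |u|) ^ 5 := by gcongr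
        _ = Real.exp (-(u ^ 2 / 4)) * (1 + |u|) ^ 8 / (δ * s) := by ring
        _ ≤ 200000 / (δ * s) := by gcongr
        _ = _ := by rw [div_div]
    have h4 : |W - Real.exp (-(u ^ 2 / 2))| ≤ W + Real.exp (-(u ^ 2 / 2)) := by
      rw [abs_le]; constructor <;> linarith [Real.exp_pos (-(u ^ 2 / 2))]
    calc |W - Real.exp (-(u ^ 2 / 2))| * (1 + |u|) ^ 5
        ≤ (W + Real.exp (-(u ^ 2 / 2))) * (1 + |u|) ^ 5 :=
          mul_le_mul_of_nonneg_right h4 (by positivity)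
      _ ≤ 200000 / δ / s + K₂ * l ^ 3 / s := by linarith
      _ = (200000 / δ + K₂ * l ^ 3) / s := by ring
      _ ≤ _ := by
          refine div_le_div_of_nonneg_right ?_ hs0.le
          have : 0 < 200000 / δ := by positivity
          linarith

/-! ### Stein regularity of the radial pieces -/

theorem laplaceLaw_eq_map {g h : ℝ → ℝ} {n : ℕ} (hm : Measurable (laplaceWeight g h n)) {x₀ s : ℝ}
    (hs : 0 < s) (hw : 0 < laplaceWeight g h n x₀) :
    laplaceLaw g h n = (volume.withDensity fun u => ENNReal.ofReal
      ((∫ v, laplaceWeight g h n (x₀ + v / s) / laplaceWeight g h n x₀)⁻¹ *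
        (laplaceWeight g h n (x₀ + u / s) / laplaceWeight g h n x₀))).map fun u => x₀ + u / s := by
  set ρ := laplaceWeight g h n with hρ
  have hI : ∫ v, ρ (x₀ + v / s) / ρ x₀ = s * (∫ y, ρ y) / ρ x₀ := by
    rw [integral_div, Measure.integral_comp_div (fun y => ρ (x₀ + y)) s,
      integral_add_left_eq_self ρ x₀, abs_of_pos hs, smul_eq_mul]
  have hT : Measurable fun u : ℝ => x₀ + u / s := by fun_prop
  refine Measure.ext_of_lintegral _ fun f hf => ?_
  have hm2 : Measurable fun u => ρ (x₀ + u / s) / ρ x₀ := (hm.comp hT).div_const _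
  rw [lintegral_map hf hT, laplaceLaw,
    lintegral_withDensity_eq_lintegral_mul _ (hm.const_mul _).ennreal_ofReal hf,
    lintegral_withDensity_eq_lintegral_mul _ (hm2.const_mul _).ennreal_ofReal (by fun_prop)]
  have h1 := lintegral_image_eq_lintegral_abs_deriv_mul (s := Set.univ) (f := fun u => x₀ + u / s)
    (f' := fun _ => 1 / s) MeasurableSet.univ
    (fun x _ => (((hasDerivAt_id x).div_const s).const_add x₀).hasDerivWithinAt)
    (fun a _ b _ hab => by
      have h2 : a / s = b / s := add_left_cancel hab
      rwa [div_left_inj' hs.ne'] at h2)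
    (fun x => ENNReal.ofReal ((∫ y, ρ y)⁻¹ * ρ x) * f x)
  have hrange : (fun u => x₀ + u / s) '' Set.univ = Set.univ := by
    rw [Set.image_univ, Set.range_eq_univ]
    exact fun y => ⟨(y - x₀) * s, by field_simp; ring⟩
  rw [hrange, Measure.restrict_univ] at h1
  simp only [Pi.mul_apply]
  rw [h1]
  refine lintegral_congr fun u => ?_
  rw [← mul_assoc, ← ENNReal.ofReal_mul (abs_nonneg _), hI, abs_of_pos (by positivity)]
  congr 2
  rw [inv_div, one_div, mul_comm s, div_mul_div_comm, mul_comm (ρ x₀),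
    mul_div_mul_right _ _ hw.ne', ← div_eq_inv_mul, inv_mul_eq_div, div_div]

/-- The weight of degree `5` leaves, besides the cubic weight required for near-Gaussian laws, the
integrable factor `1 / (1 + u ^ 2)`. -/
theorem one_add_cube_mul_le (u : ℝ) : (1 + |u| ^ 3) * (1 + u ^ 2) ≤ (1 + |u|) ^ 5 := by
  rw [← sq_abs u]
  have h := abs_nonneg u
  generalize |u| = x at h
  have : (1 + x) ^ 5 = (1 + x ^ 3) * (1 + x ^ 2) + (5 * x + 9 * x ^ 2 + 9 * x ^ 3 + 5 * x ^ 4) := by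
    ring
  rw [this]
  exact le_add_of_nonneg_right (by positivity)

theorem SteinRegular.affine {κ a M : ℝ} {Q : Measure ℝ} [IsProbabilityMeasure Q]
    (hreg : SteinRegular κ a M (Q.map fun x => x - ∫ y, y ∂Q))
    (hmem : MemLp (fun x : ℝ => x) 2 Q) (b : ℝ) {c : ℝ} (hc : 0 < c) :
    MemLp (fun x : ℝ => x) 2 (Q.map fun u => b + c * u) ∧
    SteinRegular κ (c ^ 2 * a) (c ^ 3 * M) ((Q.map fun u => b + c * u).map
      fun x => x - ∫ y, y ∂(Q.map fun u => b + c * u)) := by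
  have hmT : Measurable fun u : ℝ => b + c * u := by fun_prop
  have hQi : Integrable (fun u : ℝ => u) Q := hmem.integrable (by norm_num)
  have h2 : MemLp (fun u : ℝ => b + c * u) 2 Q := (memLp_const b).add (hmem.const_mul c)
  refine ⟨(memLp_map_measure_iff measurable_id.aestronglyMeasurable hmT.aemeasurable).2 h2, ?_⟩
  have hmean : ∫ y, y ∂(Q.map fun u => b + c * u) = b + c * ∫ y, y ∂Q := by
    rw [integral_map (f := fun y : ℝ => y) hmT.aemeasurable measurable_id.aestronglyMeasurable,
      integral_add (integrable_const _) (hQi.const_mul _), integral_const_mul]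
    simp
  have hfin : (Q.map fun u => b + c * u).map
      (fun x => x - ∫ y, y ∂(Q.map fun u => b + c * u)) =
      (Q.map fun x => x - ∫ y, y ∂Q).map fun x => c * x := by
    rw [hmean, Measure.map_map (by fun_prop) hmT, Measure.map_map (by fun_prop) (by fun_prop)]
    congr 1; ext u; simp only [Function.comp_apply]; ring
  rw [hfin]
  exact hreg.scale hc

set_option maxHeartbeats 1000000 in
-- After centring at `x₀` and scaling by `s = √(n l)` the normalised density is within `ε = K M₀ /
-- s` of the Gaussian. Undoing the scaling by `c = 2 / s` gives scale `c ^ 2 = 4 / (l n)` and defect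
-- of order `c ^ 3 ε`, that is, `s ^ (-4)`, hence `n ^ (-2)`.
theorem Admissible.exists_steinRegular_laplaceLaw {g h : ℝ → ℝ} (H : Admissible g h) :
    ∃ (κ a₀ : ℝ) (n₁ : ℕ), 1 ≤ κ ∧ 0 < a₀ ∧ ∀ n : ℕ, n₁ ≤ n →
      MemLp (fun x : ℝ => x) 2 ((laplaceLaw g h n).map fun x => 2 * x) ∧
      SteinRegular κ (a₀ / n) (κ / n ^ 2) (((laplaceLaw g h n).map fun x => 2 * x).map
        fun x => x - ∫ y, y ∂((laplaceLaw g h n).map fun x => 2 * x)) := by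
  obtain ⟨x₀, l, K, n₁, hl, hK, hn₁, happ⟩ := H.exists_gaussian_approx
  set φ := stdGaussianDensity with hφ
  have hφ0 : ∀ u, 0 < φ u := stdGaussianDensity_pos
  have hφi : Integrable fun u => (1 + |u| ^ 3) * φ u := by
    refine (integrable_stdGaussianDensity.add
      (integrable_abs_pow_mul_stdGaussianDensity 3)).congr (Filter.Eventually.of_forall fun u => ?_)
    simp only [Pi.add_apply]; ring
  -- The term `π` is the integral of `1 / (1 + u ^ 2)` from the pointwise error; the second term
  -- comes from normalising the density.
  set M₀ := Real.pi + 2 * ∫ u, (1 + |u| ^ 3) * φ u with hM₀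
  have hM0 : Real.pi ≤ M₀ := by
    have : 0 ≤ ∫ u, (1 + |u| ^ 3) * φ u :=
      integral_nonneg fun u => mul_nonneg (by positivity) (hφ0 u).le
    linarith
  have hpi := Real.pi_gt_three
  have hM0' : 0 < M₀ := by linarith
  obtain ⟨n₂, hn₂⟩ := exists_nat_ge ((4 * K * M₀) ^ 2 / l)
  -- `94 = 14 + 8 / c₀` with the lower bound `c₀ = 1 / 10` on `[-1, 1]`, and `112 = 2 ^ 3 * 14`.
  refine ⟨94 + 112 * (K * M₀) / l ^ 2, 4 / l, max n₁ n₂, ?_, by positivity, fun n hn => ?_⟩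
  · have : 0 ≤ 112 * (K * M₀) / l ^ 2 := by positivity
    linarith
  obtain ⟨hw0, hs1, hap⟩ := happ n ((le_max_left _ _).trans hn)
  have hn1 : 1 ≤ n := hn₁.trans ((le_max_left _ _).trans hn)
  have hn0 : (0 : ℝ) < n := by exact_mod_cast hn1
  set s := Real.sqrt (n * l) with hs
  have hs0 : 0 < s := by linarith
  have hs2 : s ^ 2 = n * l := Real.sq_sqrt (by positivity)
  have hsM : 4 * K * M₀ ≤ s := by
    rw [hs]
    refine Real.le_sqrt_of_sq_le ?_
    rw [← div_le_iff₀ hl]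
    exact hn₂.trans (by exact_mod_cast (le_max_right _ _).trans hn)
  have hm := H.measurable_laplaceWeight hn1
  set w : ℝ → ℝ := fun u => laplaceWeight g h n (x₀ + u / s) / laplaceWeight g h n x₀ with hw
  have hwm : Measurable w :=
    (hm.comp (by fun_prop : Measurable fun u : ℝ => x₀ + u / s)).div_const _
  have hwn : ∀ u, 0 ≤ w u := fun u => div_nonneg (H.laplaceWeight_nonneg _ _) hw0.le
  set E : ℝ → ℝ := fun u => Real.exp (-(u ^ 2 / 2)) with hE
  have hs2pi : 5 / 2 < Real.sqrt (2 * Real.pi) := by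
    refine Real.lt_sqrt_of_sq_lt ?_
    have := Real.pi_gt_d2
    norm_num at this ⊢; linarith
  have hs2pi' : Real.sqrt (2 * Real.pi) < 13 / 5 := by
    refine (Real.sqrt_lt' (by norm_num)).2 ?_
    have := Real.pi_lt_d2
    norm_num at this ⊢; linarith
  have hEφ : ∀ u, E u = Real.sqrt (2 * Real.pi) * φ u := fun u => by
    rw [hφ, stdGaussianDensity, hE, mul_div_cancel₀ _ (by positivity), neg_div]
  have hKs : K / s * M₀ ≤ 1 / 4 := by
    rw [div_mul_eq_mul_div, div_le_iff₀ hs0]; linarith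
  have hKs0 : 0 < K / s := by positivity
  have hKpi : K / s * Real.pi ≤ 1 / 4 := (mul_le_mul_of_nonneg_left hM0 hKs0.le).trans hKs
  have hD : ∀ u, (1 + |u| ^ 3) * |w u - E u| ≤ K / s * (1 + u ^ 2)⁻¹ := fun u => by
    rw [← div_eq_mul_inv, le_div_iff₀ (by positivity)]
    calc (1 + |u| ^ 3) * |w u - E u| * (1 + u ^ 2)
        = |w u - E u| * ((1 + |u| ^ 3) * (1 + u ^ 2)) := by ring
      _ ≤ |w u - E u| * (1 + |u|) ^ 5 :=
          mul_le_mul_of_nonneg_left (one_add_cube_mul_le u) (abs_nonneg _)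
      _ ≤ K / s := hap u
  have hD1 : ∀ u, |w u - E u| ≤ K / s * (1 + u ^ 2)⁻¹ := fun u =>
    (le_mul_of_one_le_left (abs_nonneg _) (by linarith [pow_nonneg (abs_nonneg u) 3])).trans (hD u)
  have hEm : Measurable E := by fun_prop
  have hEi : Integrable E := by
    have : E = fun u => Real.sqrt (2 * Real.pi) * φ u := funext hEφ
    rw [this]
    exact integrable_stdGaussianDensity.const_mul _
  have hEint : ∫ u, E u = Real.sqrt (2 * Real.pi) := by
    simp only [hEφ]
    rw [integral_const_mul, integral_stdGaussianDensity, mul_one]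
  have hwE : Integrable fun u => w u - E u :=
    (integrable_inv_one_add_sq.const_mul (K / s)).mono' (hwm.sub hEm).aestronglyMeasurable
      (Filter.Eventually.of_forall hD1)
  have hwi : Integrable w := (hwE.add hEi).congr
    (Filter.Eventually.of_forall fun u => by simp)
  set I := ∫ u, w u with hI
  have hIE : |I - Real.sqrt (2 * Real.pi)| ≤ K / s * Real.pi := by
    rw [← hEint, hI, ← integral_sub hwi hEi]
    refine (norm_integral_le_of_norm_le (integrable_inv_one_add_sq.const_mul (K / s))
      (Filter.Eventually.of_forall fun u => (Real.norm_eq_abs _).trans_le (hD1 u))).trans ?_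
    rw [integral_const_mul, integral_univ_inv_one_add_sq]
  obtain ⟨hI1, hI2⟩ := abs_le.1 hIE
  have hI3 : 2 < I := by linarith
  have hI4 : I ≤ 3 := by linarith
  have hI0 : 0 < I := by linarith
  set f : ℝ → ℝ := fun u => I⁻¹ * w u with hf
  have hfφ : ∀ u, |f u - φ u| ≤ |w u - E u| + 2 * (K / s) * φ u := by
    intro u
    have e1 : f u - φ u = I⁻¹ * (w u - E u) + I⁻¹ * (Real.sqrt (2 * Real.pi) - I) * φ u := by
      rw [hf, hEφ]; field_simp; ring
    have hinv : I⁻¹ ≤ 1 / 2 := by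
      rw [inv_le_comm₀ hI0 (by norm_num)]; norm_num; linarith
    have hinv0 : 0 < I⁻¹ := inv_pos.2 hI0
    have h1 : |I⁻¹ * (Real.sqrt (2 * Real.pi) - I) * φ u| ≤ 1 / 2 * (K / s * Real.pi) * φ u := by
      rw [abs_mul, abs_mul, abs_of_pos (hφ0 u), abs_of_pos hinv0, abs_sub_comm]
      refine mul_le_mul_of_nonneg_right ?_ (hφ0 u).le
      exact mul_le_mul hinv hIE (abs_nonneg _) (by norm_num)
    have h2 : |I⁻¹ * (w u - E u)| ≤ |w u - E u| := by
      rw [abs_mul, abs_of_pos hinv0]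
      exact mul_le_of_le_one_left (abs_nonneg _) (by linarith)
    have h3 : 1 / 2 * (K / s * Real.pi) * φ u ≤ 2 * (K / s) * φ u := by
      refine mul_le_mul_of_nonneg_right ?_ (hφ0 u).le
      have := mul_le_mul_of_nonneg_left Real.pi_le_four hKs0.le
      linarith
    rw [e1]
    exact (abs_add_le _ _).trans (add_le_add h2 (h1.trans h3))
  have hDf : ∀ u, (1 + |u| ^ 3) * |f u - φ u| ≤
      K / s * ((1 + u ^ 2)⁻¹ + 2 * ((1 + |u| ^ 3) * φ u)) := by
    intro u
    have h0 : (0 : ℝ) ≤ 1 + |u| ^ 3 := by positivity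
    calc (1 + |u| ^ 3) * |f u - φ u| ≤ (1 + |u| ^ 3) * (|w u - E u| + 2 * (K / s) * φ u) :=
          mul_le_mul_of_nonneg_left (hfφ u) h0
      _ = (1 + |u| ^ 3) * |w u - E u| + K / s * (2 * ((1 + |u| ^ 3) * φ u)) := by ring
      _ ≤ K / s * (1 + u ^ 2)⁻¹ + K / s * (2 * ((1 + |u| ^ 3) * φ u)) :=
          add_le_add_left (hD u) _
      _ = _ := by ring
  have hfm : Measurable f := hwm.const_mul _
  have hφm : Measurable φ := continuous_stdGaussianDensity.measurable
  have hdom : Integrable fun u => K / s * ((1 + u ^ 2)⁻¹ + 2 * ((1 + |u| ^ 3) * φ u)) :=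
    (integrable_inv_one_add_sq.add (hφi.const_mul 2)).const_mul _
  have hDfn : ∀ u, ‖(1 + |u| ^ 3) * |f u - φ u|‖ ≤
      K / s * ((1 + u ^ 2)⁻¹ + 2 * ((1 + |u| ^ 3) * φ u)) := fun u => by
    rw [Real.norm_of_nonneg (by positivity)]; exact hDf u
  have hDi : Integrable fun u => (1 + |u| ^ 3) * |f u - φ u| :=
    hdom.mono' (by fun_prop) (Filter.Eventually.of_forall hDfn)
  have hDint : ∫ u, (1 + |u| ^ 3) * |f u - φ u| ≤ K / s * M₀ := by
    refine (integral_mono hDi hdom hDf).trans (le_of_eq ?_)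
    rw [integral_const_mul, integral_add integrable_inv_one_add_sq (hφi.const_mul 2),
      integral_univ_inv_one_add_sq, integral_const_mul]
  have hlow : ∀ u ∈ Set.Icc (-1 : ℝ) 1, (1 / 10 : ℝ) ≤ f u := by
    intro u hu
    have hu2 : u ^ 2 ≤ 1 := (sq_le_one_iff_abs_le_one u).2 (abs_le.2 hu)
    have h1 : 1 / 2 ≤ E u := by
      have := Real.add_one_le_exp (-(u ^ 2 / 2))
      rw [hE]; simp only; linarith
    have h2 : |w u - E u| ≤ K / s := (hD1 u).trans
      (mul_le_of_le_one_right hKs0.le (inv_le_one_of_one_le₀ (by linarith [sq_nonneg u])))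
    have h3 : K / s ≤ 1 / 12 := by
      have := mul_le_mul_of_nonneg_left hpi.le hKs0.le
      linarith
    have h4 := (abs_le.1 h2).1
    rw [hf]; simp only
    rw [inv_mul_eq_div, le_div_iff₀ hI0]
    linarith
  obtain ⟨hmem, hreg⟩ := steinRegular_of_nearGaussian hfm
    (fun u => mul_nonneg (inv_nonneg.2 hI0.le) (hwn u)) (hwi.const_mul _)
    (by rw [integral_const_mul, ← hI, inv_mul_cancel₀ hI0.ne']) hKs (by norm_num) hlow hDi hDint
  set Q := volume.withDensity fun u => ENNReal.ofReal (f u) with hQ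
  have hlaw : laplaceLaw g h n = Q.map fun u => x₀ + u / s := laplaceLaw_eq_map hm hs0 hw0
  have hQp : IsProbabilityMeasure Q := ⟨by
    rw [hQ, withDensity_apply _ MeasurableSet.univ, Measure.restrict_univ,
      ← ofReal_integral_eq_lintegral_ofReal (hwi.const_mul _) (Filter.Eventually.of_forall
        fun u => mul_nonneg (inv_nonneg.2 hI0.le) (hwn u)), integral_const_mul, ← hI,
      inv_mul_cancel₀ hI0.ne', ENNReal.ofReal_one]⟩
  have hmap : (laplaceLaw g h n).map (fun x => 2 * x) = Q.map fun u => 2 * x₀ + 2 / s * u := by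
    rw [hlaw, Measure.map_map (by fun_prop) (by fun_prop)]
    congr 1; ext u; simp only [Function.comp_apply]; ring
  rw [hmap]
  obtain ⟨hmem', h1⟩ := hreg.affine hmem (2 * x₀) (c := 2 / s) (by positivity)
  refine ⟨hmem', ?_⟩
  have h2 : (2 / s) ^ 2 * 1 = 4 / l / n := by rw [div_pow, hs2]; field_simp; norm_num
  rw [h2] at h1
  refine h1.mono ?_ ?_
  · have : 0 ≤ 112 * (K * M₀) / l ^ 2 := by positivity
    norm_num; linarith
  · have h3 : (2 / s) ^ 3 * (14 * (K / s * M₀)) = 112 * (K * M₀) / l ^ 2 / n ^ 2 := by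
      have : s ^ 4 = (n * l) ^ 2 := by rw [← hs2]; ring
      rw [div_pow, div_mul_eq_mul_div, div_mul_eq_mul_div, mul_div_assoc', mul_div_assoc', div_div,
        div_div, div_eq_div_iff (by positivity) (by positivity)]
      linear_combination (-112 * K * M₀) * this
    rw [h3]
    refine div_le_div_of_nonneg_right ?_ (by positivity)
    linarith

/-! ### Positivity of the variance, and the normal approximation in terms of laws -/

theorem laplaceLaw_map_singleton (g h : ℝ → ℝ) (n : ℕ) (c : ℝ) :
    ((laplaceLaw g h n).map fun x => 2 * x) {c} = 0 := by
  rw [Measure.map_apply (by fun_prop) (measurableSet_singleton c)]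
  have : (fun x : ℝ => 2 * x) ⁻¹' {c} = {c / 2} := by
    ext x
    simp only [Set.mem_preimage, Set.mem_singleton_iff]
    constructor <;> intro h <;> linarith
  rw [this]
  exact withDensity_absolutelyContinuous _ _ (Real.volume_singleton)

/-- Zero variance would make the law of `W` a point mass, but convolution with one atomless factor
removes all atoms. -/
theorem variance_pos_of_noAtom {ι Ω : Type*} [Fintype ι] [MeasurableSpace Ω] {P : Measure Ω}
    [IsProbabilityMeasure P] {μ : ι → Measure ℝ} [∀ i, IsProbabilityMeasure (μ i)] {W : Ω → ℝ}
    (hW : MemLp W 2 P) (hlaw : P.map W = (Measure.pi μ).map fun x => ∑ i, x i) {k : ι}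
    (hk : ∀ c, μ k {c} = 0) : 0 < variance W P := by
  classical
  refine (variance_nonneg W P).lt_of_ne fun h0 => ?_
  have hae := ae_eq_integral_of_variance_eq_zero hW h0.symm
  set c := ∫ ω, W ω ∂P
  have h1 : P.map W {c} = 1 := by
    rw [Measure.map_apply_of_aemeasurable hW.aemeasurable (measurableSet_singleton c),
      ← prob_compl_eq_zero_iff₀
        (hW.aemeasurable.nullMeasurableSet_preimage (measurableSet_singleton c))]
    exact hae
  have hind : iIndepFun (fun i (x : ι → ℝ) => x i) (Measure.pi μ) :=
    iIndepFun_pi (X := fun _ x => x) fun i => aemeasurable_id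
  have h2 := hind.indepFun_finsetSum_of_notMem (fun i => measurable_pi_apply i)
    (Finset.notMem_erase k Finset.univ)
  have h3 : (Measure.pi μ).map (fun x => ∑ i, x i) =
      ((Measure.pi μ).map fun x => ∑ i ∈ Finset.univ.erase k, x i).conv (μ k) := by
    have h4 := h2.map_add_eq_map_conv_map₀ (by fun_prop)
      (measurable_pi_apply k).aemeasurable
    have h5 : (Measure.pi μ).map (fun x : ι → ℝ => x k) = μ k :=
      (measurePreserving_eval μ k).map_eq
    have h6 : (∑ i ∈ Finset.univ.erase k, fun x : ι → ℝ => x i) =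
        fun x => ∑ i ∈ Finset.univ.erase k, x i := by
      ext x; simp
    rw [h5, h6] at h4
    rw [← h4]
    congr 1
    ext x
    simp only [Pi.add_apply]
    rw [Finset.sum_erase_add _ _ (Finset.mem_univ k)]
  have h7 : ((Measure.pi μ).map fun x => ∑ i, x i) {c} = 0 := by
    rw [h3, ← lintegral_indicator_one (measurableSet_singleton c),
      Measure.lintegral_conv (measurable_one.indicator (measurableSet_singleton c))]
    refine (lintegral_congr fun x => ?_).trans lintegral_zero
    have h8 : ∀ y, ({c} : Set ℝ).indicator (1 : ℝ → ENNReal) (x + y) =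
        ({c - x} : Set ℝ).indicator 1 y := fun y => by
      simp only [Set.indicator, Set.mem_singleton_iff, eq_sub_iff_add_eq, add_comm x y]
      rfl
    simp only [h8]
    rw [lintegral_indicator_one (measurableSet_singleton _), hk]
  rw [hlaw, h7] at h1
  exact zero_ne_one h1

/-- The normal approximation bound for a sum of independent pieces, in terms of their laws. -/
theorem ks_le_of_law_eq_sum {ι Ω : Type*} [Fintype ι] [MeasurableSpace Ω] {P : Measure Ω}
    [IsProbabilityMeasure P] {μ : ι → Measure ℝ} [∀ i, IsProbabilityMeasure (μ i)] {W : Ω → ℝ}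
    (hWm : AEMeasurable W P) (hlaw : P.map W = (Measure.pi μ).map fun x => ∑ i, x i)
    {κ : ℝ} (hκ : 1 ≤ κ) {a M : ι → ℝ} (hmem : ∀ i, MemLp (fun x : ℝ => x) 2 (μ i))
    (hreg : ∀ i, SteinRegular κ (a i) (M i) ((μ i).map fun x => x - ∫ y, y ∂(μ i)))
    (hM : ∀ i, 0 ≤ M i) (hloo : ∀ k, (1 + κ) * a k ≤ κ * ∑ i, a i) (ha : 0 < ∑ i, a i) :
    MemLp W 2 P ∧ 0 < variance W P ∧
    ∀ r, |P.real {ω | standardized P W ω < r} - (gaussianReal 0 1).real (Set.Iio r)| ≤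
      28 * κ ^ 11 * ((∑ i, M i) / ((∑ i, a i) * Real.sqrt (∑ i, a i)) +
        (∑ i, a i ^ 2) / (∑ i, a i) ^ 2) := by
  have hκ0 : 0 < κ := by linarith
  set A := ∑ i, a i with hA
  have hSm : Measurable fun x : ι → ℝ => ∑ i, x i := by fun_prop
  have hev : ∀ i, MeasurePreserving (fun x : ι → ℝ => x i) (Measure.pi μ) (μ i) :=
    fun i => measurePreserving_eval μ i
  have hmemi : ∀ i, MemLp (fun x : ι → ℝ => x i) 2 (Measure.pi μ) := fun i =>
    (hmem i).comp_measurePreserving (hev i)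
  have hmemS : MemLp (fun x : ι → ℝ => ∑ i, x i) 2 (Measure.pi μ) :=
    memLp_finsetSum _ fun i _ => hmemi i
  have hmemW : MemLp W 2 P := by
    have h1 : MemLp (fun y : ℝ => y) 2 (P.map W) := by
      rw [hlaw]
      exact (memLp_map_measure_iff measurable_id.aestronglyMeasurable hSm.aemeasurable).2 hmemS
    exact (memLp_map_measure_iff measurable_id.aestronglyMeasurable hWm).1 h1
  set m : ι → ℝ := fun i => ∫ y, y ∂(μ i) with hm
  have hmean : ∫ ω, W ω ∂P = ∑ i, m i := by
    have h1 : ∫ ω, W ω ∂P = ∫ y, y ∂(P.map W) :=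
      (integral_map (f := fun y : ℝ => y) hWm measurable_id.aestronglyMeasurable).symm
    rw [h1, hlaw, integral_map (f := fun y : ℝ => y) hSm.aemeasurable
      measurable_id.aestronglyMeasurable,
      integral_finsetSum _ fun i _ => (hmemi i).integrable (by norm_num)]
    refine Finset.sum_congr rfl fun i _ => ?_
    rw [← integral_map (f := fun y : ℝ => y) (hev i).aemeasurable
      measurable_id.aestronglyMeasurable, (hev i).map_eq]
  set v : ι → ℝ := fun i => ∫ x, x ^ 2 ∂((μ i).map fun x => x - m i) with hv
  have hvar : variance W P = ∑ i, v i := by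
    have h1 : (fun x : ι → ℝ => ∑ i, x i) = ∑ i, fun x : ι → ℝ => x i := by ext x; simp
    rw [← variance_id_map hWm, hlaw, variance_map measurable_id.aemeasurable hSm.aemeasurable,
      Function.id_comp, h1, variance_sum_pi (X := fun _ x => x) hmem]
    refine Finset.sum_congr rfl fun i _ => ?_
    rw [variance_eq_integral (X := fun x : ℝ => x) measurable_id.aemeasurable, hv]
    simp only
    rw [integral_map (by fun_prop) (by fun_prop)]
  have hav : A ≤ κ * variance W P := by
    rw [hvar, Finset.mul_sum]
    exact Finset.sum_le_sum fun i _ => (hreg i).le_variance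
  have hσ2 : 0 < variance W P := pos_of_mul_pos_right (ha.trans_le hav) hκ0.le
  refine ⟨hmemW, hσ2, fun r => ?_⟩
  set σ := Real.sqrt (variance W P) with hσ
  have hσ0 : 0 < σ := Real.sqrt_pos.2 hσ2
  have hσs : σ ^ 2 = variance W P := Real.sq_sqrt hσ2.le
  -- The Berry-Esseen bound is applied on the product space; `W` enters only through its law.
  set X : ι → (ι → ℝ) → ℝ := fun i x => σ⁻¹ * (x i - m i) with hX
  have hXm : ∀ i, Measurable (X i) := fun i => by fun_prop
  have hXind : iIndepFun X (Measure.pi μ) :=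
    iIndepFun_pi (X := fun i x => σ⁻¹ * (x - m i)) fun i => by fun_prop
  have hXlaw : ∀ i, (Measure.pi μ).map (X i) =
      ((μ i).map fun x => x - m i).map fun x => σ⁻¹ * x := fun i => by
    rw [← (hev i).map_eq, Measure.map_map (by fun_prop) (hev i).measurable,
      Measure.map_map (by fun_prop) (by fun_prop)]
    rfl
  have hXreg : ∀ i, SteinRegular κ (σ⁻¹ ^ 2 * a i) (σ⁻¹ ^ 3 * M i) ((Measure.pi μ).map (X i)) :=
    fun i => by
      rw [hXlaw]
      exact (hreg i).scale (inv_pos.2 hσ0)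
  have hXvar : ∑ i, ∫ x, X i x ^ 2 ∂(Measure.pi μ) = 1 := by
    have h1 : ∀ i, ∫ x, X i x ^ 2 ∂(Measure.pi μ) = σ⁻¹ ^ 2 * v i := fun i => by
      rw [hv, ← integral_const_mul]
      have h2 := integral_map (hXm i).aemeasurable (μ := Measure.pi μ)
        (f := fun y : ℝ => y ^ 2) (by fun_prop)
      rw [← h2, hXlaw, integral_map (by fun_prop) (by fun_prop)]
      simp only [mul_pow]
    simp only [h1]
    rw [← Finset.mul_sum, ← hvar, ← hσs, ← mul_pow, inv_mul_cancel₀ hσ0.ne', one_pow]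
  have hks := ks_le_of_steinRegular hXm hXind hκ hXreg hXvar (fun k => by
    rw [← Finset.mul_sum, mul_left_comm, mul_left_comm κ]
    exact mul_le_mul_of_nonneg_left (hloo k) (by positivity)) r
  have hset : P.real {ω | standardized P W ω < r} =
      (Measure.pi μ).real {x | ∑ i, X i x < r} := by
    have hmS : MeasurableSet {y : ℝ | (y - ∑ i, m i) / σ < r} :=
      measurableSet_lt (by fun_prop) measurable_const
    have h1 : P.real {ω | standardized P W ω < r} =
        (P.map W).real {y : ℝ | (y - ∑ i, m i) / σ < r} := by
      rw [measureReal_def, measureReal_def, Measure.map_apply_of_aemeasurable hWm hmS]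
      simp only [standardized, hmean]
      rfl
    rw [h1, hlaw, measureReal_def, measureReal_def, Measure.map_apply hSm hmS]
    congr 2
    ext x
    simp only [Set.mem_preimage, Set.mem_ofPred_eq, hX]
    rw [← Finset.mul_sum, Finset.sum_sub_distrib, div_eq_inv_mul]
  rw [hset]
  refine hks.trans ?_
  rw [← Finset.mul_sum]
  have hM0 : 0 ≤ ∑ i, M i := Finset.sum_nonneg fun i _ => hM i
  have hsq : ∑ i, (σ⁻¹ ^ 2 * a i) ^ 2 = σ⁻¹ ^ 4 * ∑ i, a i ^ 2 := by
    rw [Finset.mul_sum]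
    exact Finset.sum_congr rfl fun i _ => by ring
  have hA0 : 0 ≤ ∑ i, a i ^ 2 := Finset.sum_nonneg fun i _ => sq_nonneg _
  have hsA : 0 < Real.sqrt A := Real.sqrt_pos.2 ha
  have hsA2 : Real.sqrt A ^ 2 = A := Real.sq_sqrt ha.le
  -- The variance is at least `A / κ`, so replacing `σ` by `√A` costs `κ ^ 2` in both terms; hence
  -- `κ ^ 11`.
  have hinv : σ⁻¹ ^ 2 ≤ κ / A := by
    rw [inv_pow, hσs, inv_le_comm₀ hσ2 (by positivity), inv_div, div_le_iff₀ hκ0]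
    linarith
  have hinv1 : σ⁻¹ ≤ κ / Real.sqrt A := by
    refine le_of_sq_le_sq ?_ (by positivity)
    rw [div_pow, hsA2]
    refine hinv.trans (div_le_div_of_nonneg_right ?_ ha.le)
    nlinarith
  have h3 : σ⁻¹ ^ 3 ≤ κ ^ 2 / (A * Real.sqrt A) := by
    calc σ⁻¹ ^ 3 = σ⁻¹ ^ 2 * σ⁻¹ := by ring
      _ ≤ κ / A * (κ / Real.sqrt A) := mul_le_mul hinv hinv1 (inv_pos.2 hσ0).le (by positivity)
      _ = _ := by rw [div_mul_div_comm, sq]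
  have h4 : σ⁻¹ ^ 4 ≤ κ ^ 2 / A ^ 2 := by
    calc σ⁻¹ ^ 4 = (σ⁻¹ ^ 2) ^ 2 := by ring
      _ ≤ (κ / A) ^ 2 := by gcongr
      _ = _ := by rw [div_pow]
  rw [hsq]
  calc 28 * κ ^ 9 * (σ⁻¹ ^ 3 * ∑ i, M i + σ⁻¹ ^ 4 * ∑ i, a i ^ 2)
      ≤ 28 * κ ^ 9 * (κ ^ 2 / (A * Real.sqrt A) * ∑ i, M i + κ ^ 2 / A ^ 2 * ∑ i, a i ^ 2) := by
        refine mul_le_mul_of_nonneg_left (add_le_add ?_ ?_) (by positivity)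
        · exact mul_le_mul_of_nonneg_right h3 hM0
        · exact mul_le_mul_of_nonneg_right h4 hA0
    _ = _ := by ring

/-! ### Sums over the pieces and the rate -/

/-- Telescoping, from `1 / y - 1 / (y + 1) ≤ 1 / y ^ 2`. The reverse bound below holds up to the
factor `2` because there `y ≥ 1`. -/
theorem sum_range_inv_sq_ge {n : ℝ} (m : ℕ) (hm : (m : ℝ) < n) :
    1 / (n - m) - 1 / n ≤ ∑ i ∈ Finset.range m, 1 / (n - 1 - i) ^ 2 := by
  induction m with
  | zero => simp
  | succ m ih =>
    push_cast at hm ⊢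
    rw [Finset.sum_range_succ]
    have h1 := ih (by linarith)
    have h2 : 1 / (n - (m + 1)) - 1 / (n - m) ≤ 1 / (n - 1 - m) ^ 2 := by
      have h3 : 0 < n - 1 - m := by linarith
      rw [show n - (m + 1) = n - 1 - m by ring, div_sub_div _ _ h3.ne' (by linarith),
        div_le_div_iff₀ (mul_pos h3 (by linarith)) (by positivity)]
      nlinarith
    linarith

theorem sum_range_inv_sq_le {n : ℝ} (m : ℕ) (hm : (m : ℝ) + 1 ≤ n) :
    ∑ i ∈ Finset.range m, 1 / (n - 1 - i) ^ 2 ≤ 2 * (1 / (n - m) - 1 / n) := by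
  induction m with
  | zero => simp
  | succ m ih =>
    push_cast at hm ⊢
    rw [Finset.sum_range_succ]
    have h1 := ih (by linarith)
    have h2 : 1 / (n - 1 - m) ^ 2 ≤ 2 * (1 / (n - (m + 1)) - 1 / (n - m)) := by
      have h3 : 1 ≤ n - 1 - m := by linarith
      have h4 : 0 < n - 1 - m := by linarith
      rw [show n - (m + 1) = n - 1 - m by ring, div_sub_div _ _ h4.ne' (by linarith),
        mul_div_assoc', div_le_div_iff₀ (by positivity) (mul_pos h4 (by linarith))]
      nlinarith
    linarith

/-- Induction on `q`: the right side grows by a sum of inverse squares, at least `1 / (n - q - 1) -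
1 / n` by telescoping, and this dominates the growth of the logarithm minus that of `q / n`. -/
theorem log_sub_le_sum {n : ℝ} (q : ℕ) (hq : (q : ℝ) < n) :
    Real.log (1 / (1 - q / n)) - q / n ≤
      ∑ i ∈ Finset.range q, ((q : ℝ) - i) / (n - 1 - i) ^ 2 := by
  induction q with
  | zero => simp
  | succ q ih =>
    push_cast at hq ⊢
    have hq0 : (0 : ℝ) ≤ q := q.cast_nonneg
    have h1 := ih (by linarith)
    have hn : 0 < n := by linarith
    have h2 : ∑ i ∈ Finset.range (q + 1), ((q + 1 : ℝ) - i) / (n - 1 - i) ^ 2 =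
        ∑ i ∈ Finset.range q, ((q : ℝ) - i) / (n - 1 - i) ^ 2 +
          ∑ i ∈ Finset.range (q + 1), 1 / (n - 1 - i) ^ 2 := by
      have h3 : ∑ i ∈ Finset.range q, ((q : ℝ) - i) / (n - 1 - i) ^ 2 =
          ∑ i ∈ Finset.range (q + 1), ((q : ℝ) - i) / (n - 1 - i) ^ 2 := by
        rw [Finset.sum_range_succ]; simp
      rw [h3, ← Finset.sum_add_distrib]
      exact Finset.sum_congr rfl fun i _ => by ring
    have h4 := sum_range_inv_sq_ge (n := n) (q + 1) (by push_cast; exact hq)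
    push_cast at h4
    have h5 : Real.log (1 / (1 - (q + 1) / n)) - Real.log (1 / (1 - q / n)) ≤
        1 / (n - (q + 1)) := by
      have e1 : 0 < n - (q + 1) := by linarith
      have e2 : 0 < n - q := by linarith
      have e3 : 1 - (q + 1) / n = (n - (q + 1)) / n := by field_simp
      have e4 : 1 - q / n = (n - q) / n := by field_simp
      rw [e3, e4, ← Real.log_div (by positivity) (by positivity)]
      refine (Real.log_le_sub_one_of_pos (by positivity)).trans (le_of_eq ?_)
      field_simp
      ring
    have h6 : ((q : ℝ) + 1) / n = q / n + 1 / n := by ring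
    rw [h6] at h5
    rw [h2, h6]
    linarith

/-- One factor `(q - i) / (n - 1 - i)` is at most `2 q / n`; the rest telescopes. -/
theorem sum_div_cube_le {n : ℝ} (q : ℕ) (hq : (q : ℝ) + 1 ≤ n) :
    ∑ i ∈ Finset.range q, ((q : ℝ) - i) / (n - 1 - i) ^ 3 ≤ 4 * q ^ 2 / (n ^ 2 * (n - q)) := by
  have hq0 : (0 : ℝ) ≤ q := q.cast_nonneg
  have hn : 0 < n := by linarith
  have h1 : ∀ i ∈ Finset.range q, ((q : ℝ) - i) / (n - 1 - i) ^ 3 ≤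
      2 * q / n * (1 / (n - 1 - i) ^ 2) := by
    intro i hi
    have hiq : (i : ℝ) + 1 ≤ q := by exact_mod_cast Finset.mem_range.1 hi
    have hi0 : (0 : ℝ) ≤ i := i.cast_nonneg
    have h3 : 1 ≤ n - 1 - i := by linarith
    rw [show ((q : ℝ) - i) / (n - 1 - i) ^ 3 = (q - i) / (n - 1 - i) * (1 / (n - 1 - i) ^ 2) by
      rw [div_mul_div_comm, mul_one]; ring]
    refine mul_le_mul_of_nonneg_right ?_ (by positivity)
    rw [div_le_div_iff₀ (by linarith) hn]
    nlinarith
  refine (Finset.sum_le_sum h1).trans ?_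
  rw [← Finset.mul_sum]
  have h2 := mul_le_mul_of_nonneg_left (sum_range_inv_sq_le q hq)
    (by positivity : 0 ≤ 2 * q / n)
  refine h2.trans (le_of_eq ?_)
  have : 0 < n - q := by linarith
  field_simp
  ring

theorem sum_div_four_le {n : ℝ} (q : ℕ) (hq : (q : ℝ) + 1 ≤ n) :
    ∑ i ∈ Finset.range q, ((q : ℝ) - i) / ((n - 1 - i) ^ 2) ^ 2 ≤
      4 * q ^ 2 / (n ^ 2 * (n - q)) := by
  refine le_trans (Finset.sum_le_sum fun i hi => ?_) (sum_div_cube_le q hq)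
  have hiq : (i : ℝ) + 1 ≤ q := by exact_mod_cast Finset.mem_range.1 hi
  have h3 : 1 ≤ n - 1 - i := by linarith
  refine div_le_div_of_nonneg_left (by linarith) (by positivity) ?_
  rw [← pow_mul]
  exact pow_le_pow_right₀ h3 (by norm_num)

theorem log_one_div_sub_pos {θ : ℝ} (h0 : 0 < θ) (h1 : θ < 1) :
    0 < Real.log (1 / (1 - θ)) - θ := by
  have := Real.log_lt_sub_one_of_pos (show 0 < 1 - θ by linarith) (by linarith)
  rw [one_div, Real.log_inv]
  linarith

theorem one_sub_mul_log_le {θ : ℝ} (h0 : 0 < θ) (h1 : θ < 1) :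
    (1 - θ) * (Real.log (1 / (1 - θ)) - θ) ≤ θ ^ 2 := by
  have h := Real.abs_log_sub_add_sum_range_le (x := θ) (by rwa [abs_of_pos h0]) 1
  rw [abs_of_pos h0] at h
  simp only [Finset.range_one, Finset.sum_singleton, Nat.cast_zero, zero_add, pow_one, div_one] at h
  have h2 := (abs_le.1 h).1
  rw [one_div, Real.log_inv]
  have h3 : -Real.log (1 - θ) - θ ≤ θ ^ 2 / (1 - θ) := by linarith
  rw [le_div_iff₀ (by linarith)] at h3
  linarith

/-- With `D = θ + L` each of the four quotients is compared with the target `T`. Terms in `θ ^ 2 /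
(n (1 - θ))` use `L ≤ D`, and terms in `θ / n` trade `(1 - θ) L` for `θ ^ 2`. Those divided by `D ^
2` rather than `D ^ (3/2)` also need `√L ≤ 2 D`. -/
theorem rate_le {n θ L A b κ a₀ SM S2 : ℝ} (hn : 0 < n) (h0 : 0 < θ) (h1 : θ < 1) (hL : 0 < L)
    (hL2 : (1 - θ) * L ≤ θ ^ 2) (hb : 0 < b) (hb1 : b ≤ 1) (hκ : 0 < κ)
    (hA : b * (θ + L) ≤ A)
    (hSM : SM ≤ κ * (2 * θ / n + 4 * θ ^ 2 / (n * (1 - θ))))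
    (hS2 : S2 ≤ 2 * a₀ ^ 2 * θ / n + 4 * θ ^ 2 / (n * (1 - θ))) :
    SM / (A * Real.sqrt A) + S2 / A ^ 2 ≤
      (6 * κ + 4 * a₀ ^ 2 + 8) / b ^ 2 * (θ ^ 2 / (n * (1 - θ) * L ^ (3 / 2 : ℝ))) := by
  have hθ : 0 < 1 - θ := by linarith
  -- For `θ ≤ 1/2` the hypothesis gives `L ≤ 2 θ ^ 2`; for `θ ≥ 1/2` the cross term `4 θ L`
  -- suffices.
  have hL3 : L ≤ 2 * (θ + L) ^ 2 := by
    rcases le_total θ (1 / 2) with h | h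
    · nlinarith [mul_pos h0 hL, sq_nonneg L]
    · nlinarith [mul_pos h0 hL, sq_nonneg L, sq_nonneg θ]
  set D := θ + L with hD
  have hD0 : 0 < D := by positivity
  set x := Real.sqrt L with hx
  have hx0 : 0 < x := Real.sqrt_pos.2 hL
  have hxL : x ^ 2 = L := Real.sq_sqrt hL.le
  have hpow : L ^ (3 / 2 : ℝ) = L * x := by
    rw [show (3 / 2 : ℝ) = 1 + 1 / 2 by norm_num, Real.rpow_add hL, Real.rpow_one,
      ← Real.sqrt_eq_rpow]
  have hxD : x ≤ 2 * D := by
    refine le_of_sq_le_sq ?_ (by positivity)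
    nlinarith
  set z := Real.sqrt D with hz
  have hz0 : 0 < z := Real.sqrt_pos.2 hD0
  have hxz : x ≤ z := Real.sqrt_le_sqrt (by linarith)
  have hA0 : 0 < A := lt_of_lt_of_le (by positivity) hA
  have hAz : b ^ 2 * (D * z) ≤ A * Real.sqrt A := by
    have h2 : b * z ≤ Real.sqrt A := by
      refine Real.le_sqrt_of_sq_le ?_
      rw [mul_pow, hz, Real.sq_sqrt hD0.le]
      refine le_trans ?_ hA
      refine mul_le_mul_of_nonneg_right ?_ hD0.le
      nlinarith
    calc b ^ 2 * (D * z) = b * D * (b * z) := by ring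
      _ ≤ A * Real.sqrt A := mul_le_mul hA h2 (by positivity) hA0.le
  have hA2 : b ^ 2 * D ^ 2 ≤ A ^ 2 := by
    rw [← mul_pow]
    exact pow_le_pow_left₀ (by positivity) hA 2
  set T := θ ^ 2 / (n * (1 - θ) * (L * x)) with hT
  have hT0 : 0 < T := by positivity
  have hθD : θ ≤ D := by linarith
  have hLD : L ≤ D := by linarith
  have hLx : (1 - θ) * (L * x) ≤ θ ^ 2 * x := by
    rw [← mul_assoc]; exact mul_le_mul_of_nonneg_right hL2 hx0.le
  have p1 : θ / n / (D * z) ≤ T := by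
    rw [hT, div_div, div_le_div_iff₀ (by positivity) (by positivity)]
    have h2 : (1 - θ) * (L * x) ≤ θ * (D * z) := by
      refine hLx.trans ?_
      rw [sq, mul_assoc]
      exact mul_le_mul_of_nonneg_left (mul_le_mul hθD hxz hx0.le hD0.le) h0.le
    calc θ * (n * (1 - θ) * (L * x)) = θ * n * ((1 - θ) * (L * x)) := by ring
      _ ≤ θ * n * (θ * (D * z)) := mul_le_mul_of_nonneg_left h2 (by positivity)
      _ = _ := by ring
  have p2 : θ ^ 2 / (n * (1 - θ)) / (D * z) ≤ T := by
    rw [hT, div_div]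
    refine div_le_div_of_nonneg_left (by positivity) (by positivity) ?_
    exact mul_le_mul_of_nonneg_left (mul_le_mul hLD hxz hx0.le hD0.le) (by positivity)
  have p3 : θ / n / D ^ 2 ≤ 2 * T := by
    rw [hT, mul_div_assoc', div_div, div_le_div_iff₀ (by positivity) (by positivity)]
    have h2 : (1 - θ) * (L * x) ≤ 2 * θ * D ^ 2 := by
      refine hLx.trans ?_
      calc θ ^ 2 * x ≤ θ ^ 2 * (2 * D) := mul_le_mul_of_nonneg_left hxD (by positivity)
        _ = 2 * θ * (θ * D) := by ring
        _ ≤ 2 * θ * (D * D) := by gcongr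
        _ = _ := by ring
    calc θ * (n * (1 - θ) * (L * x)) = θ * n * ((1 - θ) * (L * x)) := by ring
      _ ≤ θ * n * (2 * θ * D ^ 2) := mul_le_mul_of_nonneg_left h2 (by positivity)
      _ = _ := by ring
  have p4 : θ ^ 2 / (n * (1 - θ)) / D ^ 2 ≤ 2 * T := by
    rw [hT, mul_div_assoc', div_div, div_le_div_iff₀ (by positivity) (by positivity)]
    have h2 : L * x ≤ 2 * D ^ 2 := by
      calc L * x ≤ D * (2 * D) := mul_le_mul hLD hxD hx0.le hD0.le
        _ = _ := by ring
    calc θ ^ 2 * (n * (1 - θ) * (L * x)) = θ ^ 2 * (n * (1 - θ)) * (L * x) := by ring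
      _ ≤ θ ^ 2 * (n * (1 - θ)) * (2 * D ^ 2) := mul_le_mul_of_nonneg_left h2 (by positivity)
      _ = _ := by ring
  rw [hpow]
  have hb2 : 0 < b ^ 2 := by positivity
  have q1 : SM / (A * Real.sqrt A) ≤ 6 * κ / b ^ 2 * T := by
    calc SM / (A * Real.sqrt A)
        ≤ κ * (2 * θ / n + 4 * θ ^ 2 / (n * (1 - θ))) / (A * Real.sqrt A) := by gcongr
      _ ≤ κ * (2 * θ / n + 4 * θ ^ 2 / (n * (1 - θ))) / (b ^ 2 * (D * z)) := by gcongr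
      _ = κ / b ^ 2 * (2 * (θ / n / (D * z)) + 4 * (θ ^ 2 / (n * (1 - θ)) / (D * z))) := by
          field_simp
      _ ≤ κ / b ^ 2 * (2 * T + 4 * T) := by gcongr
      _ = _ := by ring
  have q2 : S2 / A ^ 2 ≤ (4 * a₀ ^ 2 + 8) / b ^ 2 * T := by
    calc S2 / A ^ 2 ≤ (2 * a₀ ^ 2 * θ / n + 4 * θ ^ 2 / (n * (1 - θ))) / A ^ 2 := by gcongr
      _ ≤ (2 * a₀ ^ 2 * θ / n + 4 * θ ^ 2 / (n * (1 - θ))) / (b ^ 2 * D ^ 2) := by gcongr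
      _ = 1 / b ^ 2 * (2 * a₀ ^ 2 * (θ / n / D ^ 2) + 4 * (θ ^ 2 / (n * (1 - θ)) / D ^ 2)) := by
          field_simp
      _ ≤ 1 / b ^ 2 * (2 * a₀ ^ 2 * (2 * T) + 4 * (2 * T)) := by gcongr
      _ = _ := by ring
  calc _ ≤ 6 * κ / b ^ 2 * T + (4 * a₀ ^ 2 + 8) / b ^ 2 * T := add_le_add q1 q2
    _ = _ := by ring

/-! ### Assembling the pieces -/

/-- The variance proxies of the independent pieces of a log-determinant. -/
noncomputable def pieceScale (a₀ : ℝ) (n p : ℕ) : PieceIndex p → ℝ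
  | Sum.inl _ => a₀ / n
  | Sum.inr k => 1 / (((n - 2 - k.1 : ℕ) : ℝ) + 1) ^ 2

/-- The Stein defect bounds of the independent pieces of a log-determinant. -/
noncomputable def pieceDefect (κ : ℝ) (n p : ℕ) : PieceIndex p → ℝ
  | Sum.inl _ => κ / n ^ 2
  | Sum.inr k => κ / (((n - 2 - k.1 : ℕ) : ℝ) + 1) ^ 3

theorem cast_sub_two_sub_add_one {n i : ℕ} (h : i + 2 ≤ n) :
    ((n - 2 - i : ℕ) : ℝ) + 1 = n - 1 - i := by
  rw [Nat.cast_sub (by omega), Nat.cast_sub (by omega)]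
  push_cast; ring

theorem sum_pieceIndex {n p : ℕ} (hpn : p ≤ n) (f : PieceIndex p → ℝ) (c : ℝ) (F : ℝ → ℝ)
    (h1 : ∀ j, f (Sum.inl j) = c)
    (h2 : ∀ k, f (Sum.inr k) = F (((n - 2 - k.1 : ℕ) : ℝ) + 1)) :
    ∑ k, f k = p * c + ∑ i ∈ Finset.range (p - 1), (((p - 1 : ℕ) : ℝ) - i) * F ((n : ℝ) - 1 - i) := by
  rw [Fintype.sum_sum_type, Fintype.sum_sigma, Finset.sum_range]
  simp only [h1, h2, Finset.sum_const, Finset.card_univ, Fintype.card_fin, nsmul_eq_mul]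
  congr 1
  refine Finset.sum_congr rfl fun i _ => ?_
  rw [cast_sub_two_sub_add_one (by omega), Nat.cast_sub i.2.le]

theorem pieceScale_nonneg {a₀ : ℝ} (ha : 0 < a₀) (n p : ℕ) (k : PieceIndex p) :
    0 ≤ pieceScale a₀ n p k := by
  rcases k with j | k <;> simp only [pieceScale] <;> positivity

theorem pieceDefect_nonneg {κ : ℝ} (hκ : 0 < κ) (n p : ℕ) (k : PieceIndex p) :
    0 ≤ pieceDefect κ n p k := by
  rcases k with j | k <;> simp only [pieceDefect] <;> positivity

/-- No piece dominates the others. -/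
theorem pieceScale_le_others {a₀ κ : ℝ} (ha : 0 < a₀) (hκ : 4 ≤ κ) (hκa : 4 / a₀ ≤ κ) {n p : ℕ}
    (hp : 2 ≤ p) (hpn : p ≤ n) (k : PieceIndex p) :
    (1 + κ) * pieceScale a₀ n p k ≤ κ * ∑ i, pieceScale a₀ n p i := by
  have hnn := pieceScale_nonneg ha n p
  have hn0 : (0 : ℝ) < n := by exact_mod_cast (by omega : 0 < n)
  -- It is enough that every piece has one other piece of comparable scale.
  suffices h : ∃ j, j ≠ k ∧ pieceScale a₀ n p k ≤ κ * pieceScale a₀ n p j by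
    obtain ⟨j, hjk, hj⟩ := h
    have h1 := Finset.add_le_sum (s := Finset.univ) (f := pieceScale a₀ n p) (fun i _ => hnn i)
      (Finset.mem_univ k) (Finset.mem_univ j) hjk.symm
    have h2 := mul_le_mul_of_nonneg_left h1 (by linarith : 0 ≤ κ)
    linarith
  rcases k with j | ⟨i, l⟩
  · obtain ⟨j', hj'⟩ : ∃ j' : Fin p, j' ≠ j := by
      have : Nontrivial (Fin p) := Fin.nontrivial_iff_two_le.2 hp
      exact exists_ne j
    refine ⟨Sum.inl j', fun h => hj' (Sum.inl_injective h), ?_⟩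
    simp only [pieceScale]
    exact le_mul_of_one_le_left (by positivity) (by linarith)
  · have hip := i.2
    by_cases hi : (i : ℕ) = 0
    -- The largest exponent may occur only once, so it is compared with a radial piece: `1 / (n - 1)
    -- ^ 2` is at most `4 / n`.
    · refine ⟨Sum.inl ⟨0, by omega⟩, by simp, ?_⟩
      simp only [pieceScale]
      rw [cast_sub_two_sub_add_one (by omega), hi]
      have h2 : (2 : ℝ) ≤ n := by exact_mod_cast (by omega : 2 ≤ n)
      have h3 : 4 ≤ κ * a₀ := by rwa [div_le_iff₀ ha] at hκa
      rw [mul_div_assoc', div_le_div_iff₀ (by norm_num; nlinarith) hn0]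
      norm_num
      nlinarith [mul_le_mul_of_nonneg_right h3 (sq_nonneg ((n : ℝ) - 1))]
    · have hl := l.2
      -- The next larger exponent changes `y` to `y + 1 ≤ 2 y`, so the scale drops by at most a
      -- factor `4`.
      refine ⟨Sum.inr ⟨⟨i - 1, by omega⟩, ⟨l, by simp only; omega⟩⟩, ?_, ?_⟩
      · intro h
        have h2 := congrArg (fun x => x.1.1) (Sum.inr_injective h)
        simp only at h2
        omega
      · simp only [pieceScale]
        have h1 : ((n - 2 - ((i : ℕ) - 1) : ℕ) : ℝ) + 1 = (((n - 2 - i : ℕ) : ℝ) + 1) + 1 := by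
          rw [show n - 2 - ((i : ℕ) - 1) = (n - 2 - i) + 1 by omega]
          push_cast; ring
        rw [h1]
        set y := ((n - 2 - i : ℕ) : ℝ) + 1 with hy
        have hy1 : 1 ≤ y := by rw [hy]; linarith [(n - 2 - (i : ℕ)).cast_nonneg (α := ℝ)]
        rw [mul_one_div, div_le_div_iff₀ (by positivity) (by positivity)]
        nlinarith

theorem RadiallyAdmissible.exists_asymptotic_bound {G H : ℝ → ℝ} (hGH : RadiallyAdmissible G H) :
    ∃ (C : ℝ) (n₀ : ℕ), 0 < C ∧
      ∀ (n p : ℕ), n₀ ≤ n → 2 ≤ p → p ≤ n →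
      ∀ (Ω : Type*) [MeasurableSpace Ω] (P : Measure Ω) [IsProbabilityMeasure P]
        (A : Ω → Matrix (Fin n) (Fin p) ℝ),
        (∀ j, HasLaw (fun ω => euclideanCol (A ω) j) (radialMeasure G H n) P) →
        iIndepFun (fun (j : Fin p) (ω : Ω) => euclideanCol (A ω) j) P →
        ∀ θ : ℝ, θ = ((p : ℝ) - 1) / n →
          MemLp (fun ω => logDetGram (A ω)) 2 P ∧
          ∀ r, |P.real {ω | standardized P (fun ω => logDetGram (A ω)) ω < r} -
            (gaussianReal 0 1).real (Set.Iio r)| ≤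
              C * (θ ^ 2 /
                (n * (1 - θ) * (Real.log (1 / (1 - θ)) - θ) ^ (3 / 2 : ℝ))) := by
  have hA : Admissible (fun s => G (Real.exp s)) (fun s => H (Real.exp s) - s) := hGH
  obtain ⟨κ₁, a₀, n₁, hκ₁, ha₀, hS⟩ := hA.exists_steinRegular_laplaceLaw
  obtain ⟨κ₂, hκ₂, hB⟩ := exists_steinRegular_logSin
  set κ := max (max κ₁ κ₂) (max 4 (4 / a₀)) with hκ
  have hκκ₁ : κ₁ ≤ κ := (le_max_left _ _).trans (le_max_left _ _)
  have hκκ₂ : κ₂ ≤ κ := (le_max_right _ _).trans (le_max_left _ _)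
  have hκ4 : 4 ≤ κ := (le_max_left _ _).trans (le_max_right _ _)
  have hκa : 4 / a₀ ≤ κ := (le_max_right _ _).trans (le_max_right _ _)
  have hκ0 : 0 < κ := by linarith
  set b := min a₀ 1 with hb
  have hb0 : 0 < b := lt_min ha₀ one_pos
  refine ⟨28 * κ ^ 11 * ((6 * κ + 4 * a₀ ^ 2 + 8) / b ^ 2), n₁, by positivity, ?_⟩
  intro n p hn hp hpn Ω _ P _ A hlaw hind θ hθ
  obtain ⟨hWm, hprob, hW⟩ := map_logDetGram hGH (by omega) hpn hlaw hind
  set μ := pieceLaw (fun s => G (Real.exp s)) (fun s => H (Real.exp s) - s) n p with hμ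
  have hpieces : ∀ k, MemLp (fun x : ℝ => x) 2 (μ k) ∧
      SteinRegular κ (pieceScale a₀ n p k) (pieceDefect κ n p k)
        ((μ k).map fun x => x - ∫ y, y ∂(μ k)) := by
    rintro (j | k)
    · obtain ⟨h1, h2⟩ := hS n hn
      exact ⟨h1, h2.mono hκκ₁ (div_le_div_of_nonneg_right hκκ₁ (by positivity))⟩
    · obtain ⟨h1, h2⟩ := hB (n - 2 - k.1)
      exact ⟨h1, h2.mono hκκ₂ (div_le_div_of_nonneg_right hκκ₂ (by positivity))⟩
  have hn0 : (0 : ℝ) < n := by exact_mod_cast (by omega : 0 < n)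
  set q : ℕ := p - 1 with hq
  have hqp : ((p : ℝ) - 1) = q := by rw [hq, Nat.cast_sub (by omega)]; norm_num
  have hq1 : (1 : ℝ) ≤ q := by exact_mod_cast (by omega : 1 ≤ q)
  have hqn : (q : ℝ) + 1 ≤ n := by exact_mod_cast (by omega : q + 1 ≤ n)
  -- There are `p` radial pieces while `θ = q / n` with `q = p - 1`; `p ≥ 2` makes the two
  -- comparable.
  have hp2 : (p : ℝ) ≤ 2 * q := by linarith
  rw [hqp] at hθ
  have hθ0 : 0 < θ := by rw [hθ]; positivity
  have hθ1 : θ < 1 := by rw [hθ, div_lt_one hn0]; linarith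
  have hnθ : n * (1 - θ) = n - q := by rw [hθ]; field_simp
  have hθ2 : 4 * (q : ℝ) ^ 2 / (n ^ 2 * (n - q)) = 4 * θ ^ 2 / (n * (1 - θ)) := by
    rw [hnθ, hθ]
    have : (0 : ℝ) < n - q := by linarith
    field_simp
  set L := Real.log (1 / (1 - θ)) - θ with hL
  have hL0 : 0 < L := log_one_div_sub_pos hθ0 hθ1
  -- the sum of the variance proxies
  have hsumA : b * (θ + L) ≤ ∑ k, pieceScale a₀ n p k := by
    rw [sum_pieceIndex hpn _ (a₀ / n) (fun y => 1 / y ^ 2) (fun _ => rfl) (fun _ => rfl)]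
    have h1 : L ≤ ∑ i ∈ Finset.range q, ((q : ℝ) - i) * (1 / ((n : ℝ) - 1 - i) ^ 2) := by
      have := log_sub_le_sum (n := n) q (by linarith)
      rw [hL, hθ]
      simpa only [mul_one_div] using this
    have h2 : a₀ * θ ≤ p * (a₀ / n) := by
      rw [hθ, mul_div_assoc', mul_div_assoc']
      refine div_le_div_of_nonneg_right ?_ hn0.le
      nlinarith
    have h3 : b * θ ≤ a₀ * θ := mul_le_mul_of_nonneg_right (min_le_left _ _) hθ0.le
    have h4 : b * L ≤ L := mul_le_of_le_one_left hL0.le (min_le_right _ _)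
    linarith
  have hApos : 0 < ∑ k, pieceScale a₀ n p k := lt_of_lt_of_le (by positivity) hsumA
  have hsumM : ∑ k, pieceDefect κ n p k ≤ κ * (2 * θ / n + 4 * θ ^ 2 / (n * (1 - θ))) := by
    rw [sum_pieceIndex hpn _ (κ / n ^ 2) (fun y => κ / y ^ 3) (fun _ => rfl) (fun _ => rfl)]
    have h1 := sum_div_cube_le (n := n) q hqn
    rw [hθ2] at h1
    have h2 : ∑ i ∈ Finset.range q, ((q : ℝ) - i) * (κ / ((n : ℝ) - 1 - i) ^ 3) =
        κ * ∑ i ∈ Finset.range q, ((q : ℝ) - i) / ((n : ℝ) - 1 - i) ^ 3 := by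
      rw [Finset.mul_sum]
      exact Finset.sum_congr rfl fun i _ => by ring
    rw [h2, mul_add]
    refine add_le_add ?_ (mul_le_mul_of_nonneg_left h1 hκ0.le)
    rw [hθ]
    calc p * (κ / n ^ 2) ≤ 2 * q * (κ / n ^ 2) := by gcongr
      _ = _ := by field_simp
  have hsum2 : ∑ k, pieceScale a₀ n p k ^ 2 ≤
      2 * a₀ ^ 2 * θ / n + 4 * θ ^ 2 / (n * (1 - θ)) := by
    rw [sum_pieceIndex hpn (fun k => pieceScale a₀ n p k ^ 2) ((a₀ / n) ^ 2)
      (fun y => (1 / y ^ 2) ^ 2) (fun _ => rfl) (fun _ => rfl)]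
    have h1 := sum_div_four_le (n := n) q hqn
    rw [hθ2] at h1
    refine add_le_add ?_ ((Finset.sum_le_sum fun i _ => ?_).trans h1)
    · rw [hθ]
      calc p * (a₀ / n) ^ 2 ≤ 2 * q * (a₀ / n) ^ 2 := by gcongr
        _ = _ := by field_simp
    · rw [one_div_pow, mul_one_div]
  obtain ⟨hmem, -, hks⟩ := ks_le_of_law_eq_sum hWm hW (by linarith) (fun k => (hpieces k).1)
    (fun k => (hpieces k).2) (pieceDefect_nonneg hκ0 n p)
    (pieceScale_le_others ha₀ hκ4 hκa hp hpn) hApos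
  refine ⟨hmem, fun r => (hks r).trans ?_⟩
  have hrate := rate_le hn0 hθ0 hθ1 hL0 (one_sub_mul_log_le hθ0 hθ1) hb0 (min_le_right _ _) hκ0
    hsumA hsumM hsum2
  rw [mul_assoc (28 * κ ^ 11)]
  exact mul_le_mul_of_nonneg_left hrate (by positivity)

theorem abs_real_sub_real_le_one {Ω Ω' : Type*} [MeasurableSpace Ω] [MeasurableSpace Ω']
    (P : Measure Ω) [IsProbabilityMeasure P] (Q : Measure Ω') [IsProbabilityMeasure Q]
    (s : Set Ω) (t : Set Ω') : |P.real s - Q.real t| ≤ 1 := by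
  have h1 : P.real s ≤ 1 := measureReal_le_one
  have h2 : Q.real t ≤ 1 := measureReal_le_one
  rw [abs_le]
  constructor <;> linarith [measureReal_nonneg (μ := P) (s := s),
    measureReal_nonneg (μ := Q) (s := t)]

theorem rate_pos {n p : ℕ} (hp : 2 ≤ p) (hpn : p ≤ n) {θ : ℝ} (hθ : θ = ((p : ℝ) - 1) / n) :
    0 < θ ^ 2 / (n * (1 - θ) * (Real.log (1 / (1 - θ)) - θ) ^ (3 / 2 : ℝ)) := by
  have hn0 : (0 : ℝ) < n := by exact_mod_cast (by omega : 0 < n)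
  have hp2 : (2 : ℝ) ≤ p := by exact_mod_cast hp
  have hpn' : (p : ℝ) ≤ n := by exact_mod_cast hpn
  have h0 : 0 < θ := by rw [hθ]; exact div_pos (by linarith) hn0
  have h1 : θ < 1 := by rw [hθ, div_lt_one hn0]; linarith
  have h2 := Real.rpow_pos_of_pos (log_one_div_sub_pos h0 h1) (3 / 2)
  have h3 : 0 < 1 - θ := by linarith
  positivity

/-- Only finitely many pairs `(n, p)` occur and the rate is positive on each. As a
Kolmogorov-Smirnov distance is at most `1`, a large constant settles small `n`. -/
theorem exists_one_le_mul_rate (n₀ : ℕ) : ∃ C : ℝ, 0 < C ∧ ∀ (n p : ℕ), n < n₀ → 2 ≤ p → p ≤ n →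
    ∀ θ : ℝ, θ = ((p : ℝ) - 1) / n →
      1 ≤ C * (θ ^ 2 / (n * (1 - θ) * (Real.log (1 / (1 - θ)) - θ) ^ (3 / 2 : ℝ))) := by
  set R : ℕ × ℕ → ℝ := fun z => (((z.2 : ℝ) - 1) / z.1) ^ 2 / (z.1 * (1 - ((z.2 : ℝ) - 1) / z.1) *
    (Real.log (1 / (1 - ((z.2 : ℝ) - 1) / z.1)) - ((z.2 : ℝ) - 1) / z.1) ^ (3 / 2 : ℝ)) with hR
  set s := Finset.range n₀ ×ˢ Finset.range n₀
  have hsum : ∀ z ∈ s, |(R z)⁻¹| ≤ ∑ z ∈ s, |(R z)⁻¹| := fun z hz =>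
    Finset.single_le_sum (f := fun z => |(R z)⁻¹|) (fun _ _ => abs_nonneg _) hz
  refine ⟨1 + ∑ z ∈ s, |(R z)⁻¹|, ?_, ?_⟩
  · have : 0 ≤ ∑ z ∈ s, |(R z)⁻¹| := Finset.sum_nonneg fun _ _ => abs_nonneg _
    linarith
  · intro n p hn hp hpn θ hθ
    have hpos := rate_pos hp hpn hθ
    have h1 := hsum (n, p) (Finset.mem_product.2
      ⟨Finset.mem_range.2 hn, Finset.mem_range.2 (by omega)⟩)
    have h2 : R (n, p) = θ ^ 2 / (n * (1 - θ) * (Real.log (1 / (1 - θ)) - θ) ^ (3 / 2 : ℝ)) := by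
      rw [hR, hθ]
    rw [h2] at h1
    rw [← div_le_iff₀ hpos, one_div]
    exact (le_abs_self _).trans (h1.trans (by linarith))

theorem theoremH (G H : ℝ → ℝ) (hGH : RadiallyAdmissible G H) :
    ∃ (C : ℝ) (n₀ : ℕ), 0 < C ∧
      ∀ (n p : ℕ), 2 ≤ p → p ≤ n →
      ∀ (Ω : Type*) [MeasurableSpace Ω] (P : Measure Ω) [IsProbabilityMeasure P]
        (A : Ω → Matrix (Fin n) (Fin p) ℝ),
        (∀ j, HasLaw (fun ω => euclideanCol (A ω) j) (radialMeasure G H n) P) →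
        iIndepFun (fun (j : Fin p) (ω : Ω) => euclideanCol (A ω) j) P →
        ∀ (W : Ω → ℝ) (θ : ℝ), W = (fun ω => logDetGram (A ω)) → θ = ((p : ℝ) - 1) / n →
          (n₀ ≤ n → MemLp W 2 P) ∧
          (MemLp W 2 P →
            0 < variance W P ∧
            ksDistGaussian P (standardized P W) ≤
              C * (θ ^ 2 /
                (n * (1 - θ) * (Real.log (1 / (1 - θ)) - θ) ^ (3 / 2 : ℝ)))) := by
  obtain ⟨C₁, n₀, hC₁, hmain⟩ := hGH.exists_asymptotic_bound
  obtain ⟨C₂, hC₂, hsmall⟩ := exists_one_le_mul_rate n₀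
  refine ⟨C₁ + C₂, n₀, by positivity, ?_⟩
  intro n p hp hpn Ω _ P _ A hlaw hind W θ hW hθ
  subst hW
  have hrate := rate_pos hp hpn hθ
  refine ⟨fun hn => (hmain n p hn hp hpn Ω P A hlaw hind θ hθ).1, fun hmem => ⟨?_, ?_⟩⟩
  -- Positivity is needed for every `n`, also below `n₀`; it uses only the decomposition and a
  -- radial piece with a density.
  · obtain ⟨-, hprob, hWlaw⟩ := map_logDetGram hGH (by omega) hpn hlaw hind
    exact variance_pos_of_noAtom hmem hWlaw (k := Sum.inl ⟨0, by omega⟩)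
      (laplaceLaw_map_singleton _ _ n)
  · refine ciSup_le fun r => ?_
    rw [add_mul]
    rcases lt_or_ge n n₀ with hn | hn
    · have h1 := hsmall n p hn hp hpn θ hθ
      have h2 := mul_pos hC₁ hrate
      exact (abs_real_sub_real_le_one P _ _ _).trans (by linarith)
    · have h1 := (hmain n p hn hp hpn Ω P A hlaw hind θ hθ).2 r
      have h2 := mul_pos hC₂ hrate
      linarith
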